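/- Let $R$ be a principal ideal domain and $\mathbb F$ a field. All vertex sets below carry a chosen total order. **Hyper(di)graphs.** A hyperdigraph $\vec{\mathcal H}$ on a set $V$ is a set of nonempty finite sequences of distinct elements of $V$ (directed hyperedges); a hypergraph on $V$ is a set of nonempty finite subsets of $V$. The underlying hypergraph $\mathcal H$ of $\vec{\mathcal H}$ consists of the underlying sets of the directed hyperedges. A morphism is a map of vertices (not necessarily monotone) sending (directed) hyperedges to (directed) hyperedges; a morphism of hyperdigraphs is also a morphism of the underlying hypergraphs. The join $\vec{\mathcal H}*\vec{\mathcal H}'$ on $V\sqcup V'$ (ordered with $V$ before $V'$) consists of the directed hyperedges of $\vec{\mathcal H}$, those of $\vec{\mathcal H}'$, and all $(v_1,\dots,v_k,v'_1,\dots,v'_l)$ with $(v_1,\dots,v_k)\in\vec{\mathcal H}$, $(v'_1,\dots,v'_l)\in\vec{\mathcal H}'$; the join $\mathcal H*\mathcal H'$ of hypergraphs is defined in the same way with disjoint unions, and $\mathcal H*\mathcal H'$ is the underlying hypergraph of $\vec{\mathcal H}*\vec{\mathcal H}'$. **Embedded homology.** Let $D_n(\vec{\mathcal H})$, $n\ge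 1$, be the free $R$-module on the directed hyperedges with $n$ vertices, let $D_0=R$ be spanned by the empty sequence, and put $\vec\partial(v_1,\dots,v_n)=\sum_{i=1}^n(-1)^{i-1}(v_1,\dots,\widehat{v_i},\dots,v_n)$. Let $\mathrm{Inf}_n(\vec{\mathcal H})=D_n(\vec{\mathcal H})\cap\vec\partial^{-1}D_{n-1}(\vec{\mathcal H})$ (with $D_{-1}=0$), a chain complex, and let $H_n(\vec{\mathcal H})$ be its homology; this is the reduced embedded homology in dimension $n-1$. Define $\mathrm{Inf}_n(\mathcal H)$ and $H_n(\mathcal H)$ in the same way from finite sets, with $\partial\{v_1\prec\dots\prec v_n\}=\sum_i(-1)^{i-1}\{v_1,\dots,\widehat{v_i},\dots,v_n\}$. The projection $\pi$ sends $(v_{s(1)},\dots,v_{s(n)})$ to $\operatorname{sgn}(s)\{v_1,\dots,v_n\}$ for $v_1\prec\dots\prec v_n$, and induces chain maps $\mathrm{Inf}_\bullet(\vec{\mathcal H})\to\mathrm{Inf}_\bullet(\mathcal H)$. Morphisms induce chain maps: a directed hyperedge is sent to its image sequence, and a hyperedge $\{v_1\prec\dots\prec v_n\}$ is sent to $\pi(\varphi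 v_1,\dots,\varphi v_n)$, or to $0$ if $\varphi$ is not injective on it. **Regular maps.** For a graph $G$ on $V$, the directed independence complex $\overrightarrow{\mathrm{Ind}}(G)$ consists of all nonempty finite sequences of distinct mutually non-adjacent vertices, and $\mathrm{sk}^{k-1}$ keeps those with at most $k$ entries. A map $f:V\to\mathbb F^N$ is $k$-regular on $G$ if any at most $k$ distinct mutually non-adjacent vertices have linearly independent images. For a finite $S\subseteq\mathbb F^N$, let $\vec{\mathcal M}$ be the hyperdigraph on $S$ of all nonempty sequences of distinct elements of $S$ that are linearly independent (the vectorial directed matroid without its empty sequence), and $\mathcal M$ its underlying hypergraph (the vectorial matroid without the empty set). **Theorem.** (1) For all pairs of hyperdigraphs $\vec{\mathcal A},\vec{\mathcal A}'$, and for all pairs of hypergraphs, there are for every $n\ge 0$ short exact sequences of Künneth type, denoted $\mathrm{KU}_n(\vec{\mathcal A},\vec{\mathcal A}')$, $$0\to\bigoplus_{p+q=n}H_p(\vec{\mathcal A})\otimes_R H_q(\vec{\mathcal A}')\to H_n(\vec{\mathcal A}*\vec{\mathcal A}')\to\bigoplus_{p+q+1=n}\mathrm{Tor}_1^R\big(H_p(\vec{\mathcal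 A}),H_q(\vec{\mathcal A}')\big)\to 0$$ ($p,q\ge 0$), and likewise $\mathrm{KU}_n(\mathcal A,\mathcal A')$ for hypergraphs, whose first map is $[x]\otimes[y]\mapsto[x*y]$. They can be chosen functorial in pairs of morphisms of hyperdigraphs, respectively of hypergraphs, the three components of an induced map being the maps induced on the three terms, and such that the maps induced by the projections $\pi$ on the three terms form a natural morphism of short exact sequences $\pi_*:\mathrm{KU}_n(\vec{\mathcal A},\vec{\mathcal A}')\to\mathrm{KU}_n(\mathcal A,\mathcal A')$. (2) Let $f:V\to\mathbb F^N$ be $k$-regular on a graph $G$ on $V$ and $f':V'\to\mathbb F^{N'}$ be $k'$-regular on a graph $G'$ on $V'$, with $f(V)\subseteq S$ and $f'(V')\subseteq S'$ for finite sets $S\subseteq\mathbb F^N$, $S'\subseteq\mathbb F^{N'}$ with directed matroids $\vec{\mathcal M},\vec{\mathcal M}'$. Let $\vec{\mathcal H}\subseteq\mathrm{sk}^{k-1}\overrightarrow{\mathrm{Ind}}(G)$ and $\vec{\mathcal H}'\subseteq\mathrm{sk}^{k'-1}\overrightarrow{\mathrm{Ind}}(G')$ be any sub-hyperdigraphs,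 with underlying hypergraphs $\mathcal H,\mathcal H'$. Then $f$ and $f'$ are morphisms $\vec{\mathcal H}\to\vec{\mathcal M}$ and $\vec{\mathcal H}'\to\vec{\mathcal M}'$, and for every $n\ge 0$ the sequences of (1) and the maps induced by $f$, $f'$ and $f\sqcup f':V\sqcup V'\to S\sqcup S'$ form a commutative diagram of short exact sequences $$\begin{array}{ccc}\mathrm{KU}_n(\vec{\mathcal H},\vec{\mathcal H}')&\longrightarrow&\mathrm{KU}_n(\vec{\mathcal M},\vec{\mathcal M}')\\ \downarrow{\scriptstyle\pi_*}&&\downarrow{\scriptstyle\pi_*}\\ \mathrm{KU}_n(\mathcal H,\mathcal H')&\longrightarrow&\mathrm{KU}_n(\mathcal M,\mathcal M').\end{array}$$ The diagram is functorial: hyperdigraph morphisms $\vec{\mathcal A}\to\vec{\mathcal B}$, $a:\vec{\mathcal A}\to\vec{\mathcal H}$, $b:\vec{\mathcal B}\to\vec{\mathcal M}$ such that $\vec{\mathcal A}\to\vec{\mathcal B}\xrightarrow{b}\vec{\mathcal M}$ and $\vec{\mathcal A}\xrightarrow{a}\vec{\mathcal H}\xrightarrow{f}\vec{\mathcal M}$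 agree as maps of vertices, together with morphisms for $\vec{\mathcal H}',\vec{\mathcal M}',f'$ satisfying the analogous condition, induce a commutative cube of short exact sequences (in particular for the inclusions given by filtrations of $V$ and $V'$). -/

import Mathlib

open CategoryTheory CategoryTheory.Limits CategoryTheory.MonoidalCategory

universe u

noncomputable section

namespace RegularKunneth

/-! ### Hyperdigraphs and hypergraphs -/

/-- A hyperdigraph on `V`: a collection of directed hyperedges, i.e. of nonempty finite sequences
of distinct vertices. -/
structure Hyperdigraph (V : Type u) where
  edges : Set (List V)
  nodup : ∀ l ∈ edges, l.Nodup
  ne_nil : ∀ l ∈ edges, l ≠ []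

/-- A hypergraph on `V`: a collection of hyperedges, i.e. of nonempty finite sets of vertices. -/
structure Hypergraph (V : Type u) where
  edges : Set (Finset V)
  nonempty : ∀ s ∈ edges, s.Nonempty

variable {V V' W W' : Type u}

/-- The underlying hypergraph: its hyperedges are the underlying sets of the directed hyperedges. -/
def Hyperdigraph.underlying [DecidableEq V] (H : Hyperdigraph V) : Hypergraph V where
  edges := List.toFinset '' H.edges
  nonempty := by
    rintro _ ⟨l, hl, rfl⟩
    rw [List.toFinset_nonempty_iff]
    exact H.ne_nil l hl

/-- The join `(v₁, …, vₖ, v'₁, …, v'ₗ)` of two sequences, on the disjoint union of the two vertex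
sets; `V ⊕ₗ V'` is the disjoint union in which every element of `V` precedes every element
of `V'`. -/
def joinList (l : List V) (l' : List V') : List (V ⊕ₗ V') :=
  l.map Sum.inlₗ ++ l'.map Sum.inrₗ

/-- The join (disjoint union) of two finite sets. -/
def joinFinset [LinearOrder V] [LinearOrder V'] (s : Finset V) (s' : Finset V') :
    Finset (V ⊕ₗ V') :=
  s.image Sum.inlₗ ∪ s'.image Sum.inrₗ

/-- The join of hyperdigraphs:
the directed hyperedges of both, together with all joins of a directed hyperedge of the first and a
directed hyperedge of the second. -/
def Hyperdigraph.join (H : Hyperdigraph V) (H' : Hyperdigraph V') : Hyperdigraph (V ⊕ₗ V') where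
  edges := (List.map Sum.inlₗ '' H.edges ∪ List.map Sum.inrₗ '' H'.edges) ∪
    Set.image2 joinList H.edges H'.edges
  nodup := by
    rintro _ ((⟨l, hl, rfl⟩ | ⟨l, hl, rfl⟩) | ⟨l, hl, l', hl', rfl⟩)
    · exact (H.nodup l hl).map Sum.inl_injective
    · exact (H'.nodup l hl).map Sum.inr_injective
    · refine List.Nodup.append ((H.nodup l hl).map Sum.inl_injective)
        ((H'.nodup l' hl').map Sum.inr_injective) ?_
      intro x hx hx'
      obtain ⟨a, _, rfl⟩ := List.mem_map.1 hx
      obtain ⟨b, _, hb⟩ := List.mem_map.1 hx'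
      cases hb
  ne_nil := by
    rintro _ ((⟨l, hl, rfl⟩ | ⟨l, hl, rfl⟩) | ⟨l, hl, l', hl', rfl⟩)
    · simpa using H.ne_nil l hl
    · simpa using H'.ne_nil l hl
    · simp [joinList, H.ne_nil l hl]

/-- The join of hypergraphs. -/
def Hypergraph.join [LinearOrder V] [LinearOrder V'] (H : Hypergraph V) (H' : Hypergraph V') :
    Hypergraph (V ⊕ₗ V') where
  edges := (Finset.image Sum.inlₗ '' H.edges ∪ Finset.image Sum.inrₗ '' H'.edges) ∪
    Set.image2 joinFinset H.edges H'.edges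
  nonempty := by
    rintro _ ((⟨l, hl, rfl⟩ | ⟨l, hl, rfl⟩) | ⟨l, hl, l', hl', rfl⟩)
    · exact (H.nonempty l hl).image _
    · exact (H'.nonempty l hl).image _
    · exact ((H.nonempty l hl).image _).mono Finset.subset_union_left

/-- The category of hyperdigraphs on totally ordered vertex sets. -/
structure HyperdigraphCat : Type (u + 1) where
  V : Type u
  [order : LinearOrder V]
  graph : Hyperdigraph V

attribute [instance] HyperdigraphCat.order

/-- The category of hypergraphs on totally ordered vertex sets. -/
structure HypergraphCat : Type (u + 1) where
  V : Type u
  [order : LinearOrder V]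
  graph : Hypergraph V

attribute [instance] HypergraphCat.order

/-- A morphism of hyperdigraphs: a map of the vertices (not necessarily monotone) that sends directed
hyperedges to directed hyperedges. -/
@[ext]
structure HyperdigraphCat.Hom (X Y : HyperdigraphCat.{u}) where
  toFun : X.V → Y.V
  map_edges : ∀ l ∈ X.graph.edges, l.map toFun ∈ Y.graph.edges

/-- A morphism of hypergraphs: a map of the vertices (not necessarily monotone) that sends
hyperedges to hyperedges. -/
@[ext]
structure HypergraphCat.Hom (X Y : HypergraphCat.{u}) where
  toFun : X.V → Y.V
  map_edges : ∀ s ∈ X.graph.edges, s.image toFun ∈ Y.graph.edges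

instance : Category HyperdigraphCat.{u} where
  Hom := HyperdigraphCat.Hom
  id X := ⟨id, by simp⟩
  comp f g := ⟨g.toFun ∘ f.toFun, fun l hl => by
    rw [← List.map_map]
    exact g.map_edges _ (f.map_edges l hl)⟩

instance : Category HypergraphCat.{u} where
  Hom := HypergraphCat.Hom
  id X := ⟨id, by simp⟩
  comp f g := ⟨g.toFun ∘ f.toFun, fun s hs => by
    rw [← Finset.image_image]
    exact g.map_edges _ (f.map_edges s hs)⟩

theorem image_toFinset [DecidableEq V] [DecidableEq W] (φ : V → W) (l : List V) :
    l.toFinset.image φ = (l.map φ).toFinset := by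
  ext; simp

/-- Passing to the underlying hypergraph is functorial. -/
@[simps]
def underlyingFunctor : HyperdigraphCat.{u} ⥤ HypergraphCat.{u} where
  obj X := ⟨X.V, X.graph.underlying⟩
  map {X Y} f := HypergraphCat.Hom.mk (X := ⟨X.V, X.graph.underlying⟩)
    (Y := ⟨Y.V, Y.graph.underlying⟩) f.toFun (by
      rintro _ ⟨l, hl, rfl⟩
      exact ⟨_, f.map_edges l hl, (image_toFinset _ _).symm⟩)

/-- The map induced by two maps on the disjoint union. -/
def sumMap (φ : V → W) (φ' : V' → W') : V ⊕ₗ V' → W ⊕ₗ W' :=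
  fun x => toLex (Sum.map φ φ' (ofLex x))

theorem map_joinList (φ : V → W) (φ' : V' → W') (l : List V) (l' : List V') :
    (joinList l l').map (sumMap φ φ') = joinList (l.map φ) (l'.map φ') := by
  simp only [joinList, List.map_append, List.map_map]
  rfl

theorem image_joinFinset [LinearOrder V] [LinearOrder V'] [LinearOrder W] [LinearOrder W']
    (φ : V → W) (φ' : V' → W') (s : Finset V) (s' : Finset V') :
    (joinFinset s s').image (sumMap φ φ') = joinFinset (s.image φ) (s'.image φ') := by
  simp only [joinFinset, Finset.image_union, Finset.image_image]
  rfl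

theorem toFinset_joinList [LinearOrder V] [LinearOrder V'] (l : List V) (l' : List V') :
    (joinList l l').toFinset = joinFinset l.toFinset l'.toFinset := by
  ext; simp [joinList, joinFinset]

/-- The join of hyperdigraphs, as a functor. -/
@[simps]
def joinD : HyperdigraphCat.{u} × HyperdigraphCat.{u} ⥤ HyperdigraphCat.{u} where
  obj P := ⟨P.1.V ⊕ₗ P.2.V, P.1.graph.join P.2.graph⟩
  map {P Q} f := HyperdigraphCat.Hom.mk (X := ⟨P.1.V ⊕ₗ P.2.V, P.1.graph.join P.2.graph⟩)
    (Y := ⟨Q.1.V ⊕ₗ Q.2.V, Q.1.graph.join Q.2.graph⟩) (sumMap f.1.toFun f.2.toFun) (by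
      rintro _ ((⟨l, hl, rfl⟩ | ⟨l, hl, rfl⟩) | ⟨l, hl, l', hl', rfl⟩)
      · refine Or.inl (Or.inl ⟨_, f.1.map_edges l hl, ?_⟩)
        simp only [List.map_map]
        rfl
      · refine Or.inl (Or.inr ⟨_, f.2.map_edges l hl, ?_⟩)
        simp only [List.map_map]
        rfl
      · exact Or.inr ⟨_, f.1.map_edges l hl, _, f.2.map_edges l' hl', (map_joinList _ _ _ _).symm⟩)
  map_id P := HyperdigraphCat.Hom.ext (funext fun x => by rcases x with x | x <;> rfl)
  map_comp f g := HyperdigraphCat.Hom.ext (funext fun x => by rcases x with x | x <;> rfl)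

/-- The join of hypergraphs, as a functor. -/
@[simps]
def joinU : HypergraphCat.{u} × HypergraphCat.{u} ⥤ HypergraphCat.{u} where
  obj P := ⟨P.1.V ⊕ₗ P.2.V, P.1.graph.join P.2.graph⟩
  map {P Q} f := HypergraphCat.Hom.mk (X := ⟨P.1.V ⊕ₗ P.2.V, P.1.graph.join P.2.graph⟩)
    (Y := ⟨Q.1.V ⊕ₗ Q.2.V, Q.1.graph.join Q.2.graph⟩) (sumMap f.1.toFun f.2.toFun) (by
      rintro _ ((⟨l, hl, rfl⟩ | ⟨l, hl, rfl⟩) | ⟨l, hl, l', hl', rfl⟩)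
      · refine Or.inl (Or.inl ⟨_, f.1.map_edges l hl, ?_⟩)
        simp only [Finset.image_image]
        rfl
      · refine Or.inl (Or.inr ⟨_, f.2.map_edges l hl, ?_⟩)
        simp only [Finset.image_image]
        rfl
      · exact Or.inr
          ⟨_, f.1.map_edges l hl, _, f.2.map_edges l' hl', (image_joinFinset _ _ _ _).symm⟩)
  map_id P := HypergraphCat.Hom.ext (funext fun x => by rcases x with x | x <;> rfl)
  map_comp f g := HypergraphCat.Hom.ext (funext fun x => by rcases x with x | x <;> rfl)

/-- The canonical morphism from the underlying hypergraph of a join to the join of the underlying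
hypergraphs; it is the identity map on the vertices. -/
def underlyingJoin : joinD.{u} ⋙ underlyingFunctor ⟶
    underlyingFunctor.prod underlyingFunctor ⋙ joinU where
  app P := HypergraphCat.Hom.mk (X := (joinD ⋙ underlyingFunctor).obj P)
    (Y := (underlyingFunctor.prod underlyingFunctor ⋙ joinU).obj P) id (by
      rintro _ ⟨_, ((⟨l, hl, rfl⟩ | ⟨l, hl, rfl⟩) | ⟨l, hl, l', hl', rfl⟩), rfl⟩
      · exact Or.inl (Or.inl ⟨_, ⟨l, hl, rfl⟩, (image_toFinset _ _).trans Finset.image_id.symm⟩)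
      · exact Or.inl (Or.inr ⟨_, ⟨l, hl, rfl⟩,
          (image_toFinset _ _).trans Finset.image_id.symm⟩)
      · refine Or.inr ⟨_, ⟨l, hl, rfl⟩, _, ⟨l', hl', rfl⟩, ?_⟩
        exact (toFinset_joinList l l').symm.trans Finset.image_id.symm)

/-! ### Chains -/

variable (R : Type u) [CommRing R]

/-- The boundary `∂(v₁, …, vₙ) = ∑ᵢ (-1)^(i-1) (v₁, …, v̂ᵢ, …, vₙ)` on the free module on all finite
sequences. It is augmented: the boundary of `(v)` is the empty sequence. -/
def boundaryD (V : Type u) : (List V →₀ R) →ₗ[R] (List V →₀ R) :=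
  Finsupp.lift (List V →₀ R) R (List V) fun l =>
    ∑ i : Fin l.length, Finsupp.single (l.eraseIdx i) ((-1) ^ (i : ℕ))

/-- The boundary `∂{v₁ < … < vₙ} = ∑ᵢ (-1)^(i-1) {v₁, …, v̂ᵢ, …, vₙ}` on the free module on all
finite sets; the exponent `i - 1` is the number of elements smaller than the removed one. It is
augmented: the boundary of `{v}` is the empty set. -/
def boundaryU (V : Type u) [LinearOrder V] : (Finset V →₀ R) →ₗ[R] (Finset V →₀ R) :=
  Finsupp.lift (Finset V →₀ R) R (Finset V) fun s =>
    ∑ v ∈ s, Finsupp.single (s.erase v) ((-1) ^ (s.filter (· < v)).card)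

/-- The map `(v₁, …, vₙ) ↦ (φ v₁, …, φ vₙ)`, extended linearly. -/
def chainMapD (φ : V → W) : (List V →₀ R) →ₗ[R] (List W →₀ R) :=
  Finsupp.lmapDomain R R (List.map φ)

/-- The map induced on the chains of (unordered) finite sets:
a set on which `φ` is not injective is sent to `0`; otherwise
`{v₁ < … < vₙ}` is sent to `{φ v₁, …, φ vₙ}` times the sign of the permutation that sorts the
sequence `φ v₁, …, φ vₙ`, computed as `(-1)` to the number of inversions. -/
def chainMapU [LinearOrder V] [LinearOrder W] (φ : V → W) :
    (Finset V →₀ R) →ₗ[R] (Finset W →₀ R) :=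
  open Classical in
  Finsupp.lift (Finset W →₀ R) R (Finset V) fun s =>
    if Set.InjOn φ s then
      Finsupp.single (s.image φ)
        ((-1) ^ ((s ×ˢ s).filter fun p => p.1 < p.2 ∧ φ p.2 < φ p.1).card)
    else 0

/-- The number of inversions of a sequence. -/
def inversions [LinearOrder V] : List V → ℕ
  | [] => 0
  | a :: l => l.countP (· < a) + inversions l

/-- The projection `(v₁, …, vₙ) ↦ sgn · {v₁, …, vₙ}` from directed chains to chains, where `sgn` is
the sign of the permutation that sorts `v₁, …, vₙ`. (Sequences with repetitions, which never occur
in a hyperdigraph, are sent to `0`.) -/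
def projChain (V : Type u) [LinearOrder V] : (List V →₀ R) →ₗ[R] (Finset V →₀ R) :=
  Finsupp.lift (Finset V →₀ R) R (List V) fun l =>
    if l.Nodup then Finsupp.single l.toFinset ((-1) ^ inversions l) else 0

/-- The join of directed chains, the bilinear extension of the join of sequences. -/
def joinChainD (x : List V →₀ R) (y : List V' →₀ R) : List (V ⊕ₗ V') →₀ R :=
  x.sum fun l a => y.sum fun l' b => Finsupp.single (joinList l l') (a * b)

/-- The join of chains, the bilinear extension of the join of finite sets. -/
def joinChainU [LinearOrder V] [LinearOrder V'] (x : Finset V →₀ R) (y : Finset V' →₀ R) :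
    Finset (V ⊕ₗ V') →₀ R :=
  x.sum fun s a => y.sum fun s' b => Finsupp.single (joinFinset s s') (a * b)

/-! ### Auxiliary facts: the identities that make the maps above into chain maps -/

variable {R}

theorem boundaryD_nil : boundaryD R V (Finsupp.single [] 1) = 0 := by
  simp [boundaryD]

/-- Prepending a vertex. -/
def consChain (a : V) : (List V →₀ R) →ₗ[R] (List V →₀ R) :=
  Finsupp.lmapDomain R R (List.cons a)

@[simp] theorem consChain_single (a : V) (l : List V) (r : R) :
    consChain a (Finsupp.single l r) = Finsupp.single (a :: l) r := by
  simp [consChain]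

theorem boundaryD_single_cons (a : V) (l : List V) :
    boundaryD R V (Finsupp.single (a :: l) 1) =
      Finsupp.single l 1 - consChain a (boundaryD R V (Finsupp.single l 1)) := by
  simp [boundaryD, Fin.sum_univ_succ, map_sum, pow_succ, sub_eq_add_neg]

theorem boundaryD_consChain (a : V) (x : List V →₀ R) :
    boundaryD R V (consChain a x) = x - consChain a (boundaryD R V x) := by
  have : boundaryD R V ∘ₗ consChain a = LinearMap.id - consChain a ∘ₗ boundaryD R V := by
    refine Finsupp.lhom_ext' fun l => LinearMap.ext_ring ?_
    simpa using boundaryD_single_cons (R := R) a l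
  exact LinearMap.congr_fun this x

theorem listHom_ext {M : Type*} [AddCommGroup M] [Module R M] {f g : (List V →₀ R) →ₗ[R] M}
    (h0 : f (Finsupp.single [] 1) = g (Finsupp.single [] 1))
    (h : ∀ a x, f x = g x → f (consChain a x) = g (consChain a x)) : f = g := by
  refine Finsupp.lhom_ext' fun l => LinearMap.ext_ring ?_
  simp only [LinearMap.comp_apply, Finsupp.lsingle_apply]
  induction l with
  | nil => exact h0
  | cons a l ih => simpa using h a _ ih

theorem boundaryD_comp_self : boundaryD R V ∘ₗ boundaryD R V = 0 := by
  refine listHom_ext (by simp [boundaryD_nil]) fun a x hx => ?_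
  simp only [LinearMap.comp_apply, LinearMap.zero_apply] at hx ⊢
  simp [boundaryD_consChain, hx]

theorem chainMapD_consChain (φ : V → W) (a : V) (x : List V →₀ R) :
    chainMapD R φ (consChain a x) = consChain (φ a) (chainMapD R φ x) := by
  have : chainMapD R φ ∘ₗ consChain a = consChain (φ a) ∘ₗ chainMapD R φ := by
    refine Finsupp.lhom_ext' fun l => LinearMap.ext_ring ?_
    simp [chainMapD]
  exact LinearMap.congr_fun this x

theorem chainMapD_comp_boundaryD (φ : V → W) :
    chainMapD R φ ∘ₗ boundaryD R V = boundaryD R W ∘ₗ chainMapD R φ := by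
  refine listHom_ext ?_ fun a x hx => ?_
  · have : chainMapD R φ (Finsupp.single [] 1) = Finsupp.single [] 1 := by simp [chainMapD]
    simp [this, boundaryD_nil]
  · simp only [LinearMap.comp_apply] at hx ⊢
    simp [boundaryD_consChain, chainMapD_consChain, hx]

section Wedge

variable [LinearOrder V] [LinearOrder W]

/-- Exterior multiplication by a vertex from the left. -/
def wedge (a : V) : (Finset V →₀ R) →ₗ[R] (Finset V →₀ R) :=
  Finsupp.lift (Finset V →₀ R) R (Finset V) fun s =>
    if a ∈ s then 0 else Finsupp.single (insert a s) ((-1) ^ (s.filter (· < a)).card)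

theorem wedge_mem {a : V} {s : Finset V} (h : a ∈ s) (r : R) :
    wedge a (Finsupp.single s r) = 0 := by
  simp [wedge, h]

theorem wedge_notMem {a : V} {s : Finset V} (h : a ∉ s) (r : R) :
    wedge a (Finsupp.single s r) =
      Finsupp.single (insert a s) (r * (-1) ^ (s.filter (· < a)).card) := by
  simp [wedge, h]

theorem boundaryU_single (s : Finset V) (r : R) : boundaryU R V (Finsupp.single s r) =
    ∑ v ∈ s, Finsupp.single (s.erase v) (r * (-1) ^ (s.filter (· < v)).card) := by
  simp [boundaryU, Finset.smul_sum]

theorem negOne_pow_mul_self (n : ℕ) : ((-1 : R) ^ n) * (-1) ^ n = 1 := by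
  rw [← mul_pow]; simp

theorem negOne_pow_congr {m n : ℕ} (h : (m + n) % 2 = 0) : ((-1 : R) ^ m) = (-1) ^ n := by
  rw [neg_one_pow_eq_pow_mod_two m, neg_one_pow_eq_pow_mod_two n]
  congr 1
  omega

theorem negOne_pow_congr_neg {m n : ℕ} (h : (m + n) % 2 = 1) : ((-1 : R) ^ m) = -(-1) ^ n := by
  have := negOne_pow_congr (R := R) (m := m) (n := n + 1) (by omega)
  rw [this, pow_succ]; ring

theorem boundaryU_wedge (a : V) (x : Finset V →₀ R) :
    boundaryU R V (wedge a x) = x - wedge a (boundaryU R V x) := by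
  suffices h : boundaryU R V ∘ₗ wedge a = LinearMap.id - wedge a ∘ₗ boundaryU R V from
    LinearMap.congr_fun h x
  refine Finsupp.lhom_ext' fun s => LinearMap.ext_ring ?_
  simp only [LinearMap.comp_apply, Finsupp.lsingle_apply, LinearMap.sub_apply, LinearMap.id_apply]
  rw [boundaryU_single, map_sum]
  by_cases ha : a ∈ s
  · rw [wedge_mem ha, map_zero, eq_comm, sub_eq_zero]
    rw [Finset.sum_eq_single_of_mem a ha]
    · rw [wedge_notMem (Finset.notMem_erase a s), Finset.insert_erase ha]
      have : (s.erase a).filter (· < a) = s.filter (· < a) := by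
        ext v; simp only [Finset.mem_filter, Finset.mem_erase]
        constructor
        · rintro ⟨⟨_, h⟩, h'⟩; exact ⟨h, h'⟩
        · rintro ⟨h, h'⟩; exact ⟨⟨h'.ne, h⟩, h'⟩
      rw [this, one_mul, negOne_pow_mul_self]
    · intro v _ hva
      exact wedge_mem (Finset.mem_erase.2 ⟨hva.symm, ha⟩) _
  · rw [wedge_notMem ha, boundaryU_single, Finset.sum_insert ha, Finset.erase_insert ha,
      sub_eq_add_neg]
    congr 1
    · have : (insert a s).filter (· < a) = s.filter (· < a) := by
        rw [Finset.filter_insert]; simp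
      rw [this, one_mul, negOne_pow_mul_self]
    · rw [← Finset.sum_neg_distrib]
      refine Finset.sum_congr rfl fun v hv => ?_
      have hav : a ≠ v := fun h => ha (h ▸ hv)
      rw [wedge_notMem (fun h => ha (Finset.mem_of_mem_erase h)), ← Finsupp.single_neg,
        Finset.erase_insert_of_ne hav]
      congr 1
      simp only [one_mul, ← pow_add]
      refine negOne_pow_congr_neg ?_
      rw [Finset.filter_insert, Finset.filter_erase]
      rcases lt_or_gt_of_ne hav with h | h
      · rw [if_pos h, Finset.card_insert_of_notMem (by simp [ha]),
          Finset.erase_eq_of_notMem (by simp [h.le])]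
        omega
      · rw [if_neg h.le.not_gt]
        have := Finset.card_erase_add_one (s := s.filter (· < a)) (a := v) (by simp [hv, h])
        omega

/-- A linear map on the chains of finite sets is determined by its value on the empty set and its
behaviour under exterior multiplication. -/
theorem finsetHom_ext {M : Type*} [AddCommGroup M] [Module R M] {f g : (Finset V →₀ R) →ₗ[R] M}
    (h0 : f (Finsupp.single ∅ 1) = g (Finsupp.single ∅ 1))
    (h : ∀ a x, f x = g x → f (wedge a x) = g (wedge a x)) : f = g := by
  refine Finsupp.lhom_ext' fun s => LinearMap.ext_ring ?_
  simp only [LinearMap.comp_apply, Finsupp.lsingle_apply]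
  induction s using Finset.induction_on with
  | empty => exact h0
  | insert a s ha ih =>
    have e : (Finsupp.single (insert a s) 1 : Finset V →₀ R) =
        ((-1 : R) ^ (s.filter (· < a)).card) • wedge a (Finsupp.single s 1) := by
      rw [wedge_notMem ha, Finsupp.smul_single, smul_eq_mul, one_mul, negOne_pow_mul_self]
    rw [e, map_smul, map_smul, h a _ ih]

theorem boundaryU_empty : boundaryU R V (Finsupp.single ∅ 1) = 0 := by
  simp [boundaryU]

theorem boundaryU_comp_self : boundaryU R V ∘ₗ boundaryU R V = 0 := by
  refine finsetHom_ext (by simp [boundaryU_empty]) fun a x hx => ?_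
  simp only [LinearMap.comp_apply, LinearMap.zero_apply] at hx ⊢
  simp [boundaryU_wedge, hx]

theorem chainMapU_of_injOn {φ : V → W} {s : Finset V} (h : Set.InjOn φ s) (r : R) :
    chainMapU R φ (Finsupp.single s r) = Finsupp.single (s.image φ)
      (r * (-1) ^ ((s ×ˢ s).filter fun p => p.1 < p.2 ∧ φ p.2 < φ p.1).card) := by
  simp [chainMapU, h]

theorem chainMapU_of_not_injOn {φ : V → W} {s : Finset V} (h : ¬ Set.InjOn φ s) (r : R) :
    chainMapU R φ (Finsupp.single s r) = 0 := by
  simp [chainMapU, h]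

theorem chainMapU_empty (φ : V → W) :
    chainMapU R φ (Finsupp.single ∅ 1) = Finsupp.single ∅ 1 := by
  rw [chainMapU_of_injOn (by simp)]; simp

theorem chainMapU_wedge (φ : V → W) (a : V) (x : Finset V →₀ R) :
    chainMapU R φ (wedge a x) = wedge (φ a) (chainMapU R φ x) := by
  suffices h : chainMapU R φ ∘ₗ wedge a = wedge (φ a) ∘ₗ chainMapU R φ from
    LinearMap.congr_fun h x
  refine Finsupp.lhom_ext' fun s => LinearMap.ext_ring ?_
  simp only [LinearMap.comp_apply, Finsupp.lsingle_apply]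
  by_cases ha : a ∈ s
  · rw [wedge_mem ha, map_zero]
    by_cases hs : Set.InjOn φ s
    · rw [chainMapU_of_injOn hs, wedge_mem (Finset.mem_image_of_mem φ ha)]
    · rw [chainMapU_of_not_injOn hs, map_zero]
  rw [wedge_notMem ha]
  by_cases hs : Set.InjOn φ s
  · rw [chainMapU_of_injOn hs]
    by_cases hφ : φ a ∈ s.image φ
    · rw [wedge_mem hφ, chainMapU_of_not_injOn]
      intro hi
      obtain ⟨b, hb, hab⟩ := Finset.mem_image.1 hφ
      have : b = a := hi (by simp [hb]) (by simp) hab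
      exact ha (this ▸ hb)
    · have hi : Set.InjOn φ (insert a s : Finset V) := by
        rw [Finset.coe_insert, Set.injOn_insert (by simpa using ha)]
        exact ⟨hs, by simpa using hφ⟩
      rw [wedge_notMem hφ, chainMapU_of_injOn hi, Finset.image_insert]
      congr 1
      simp only [one_mul, ← pow_add]
      refine negOne_pow_congr ?_
      have e1 : (((insert a s) ×ˢ (insert a s)).filter fun p : V × V => p.1 < p.2 ∧ φ p.2 < φ p.1).card
          = ((s ×ˢ s).filter fun p => p.1 < p.2 ∧ φ p.2 < φ p.1).card
            + (s.filter fun v => a < v ∧ φ v < φ a).card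
            + (s.filter fun v => v < a ∧ φ a < φ v).card := by
        have hd : ((insert a s) ×ˢ (insert a s)).filter
              (fun p : V × V => p.1 < p.2 ∧ φ p.2 < φ p.1)
            = ((s ×ˢ s).filter (fun p => p.1 < p.2 ∧ φ p.2 < φ p.1) ∪
              (s.filter fun v => a < v ∧ φ v < φ a).image (fun v => (a, v))) ∪
              (s.filter fun v => v < a ∧ φ a < φ v).image (fun v => (v, a)) := by
          ext ⟨p, q⟩
          simp only [Finset.mem_filter, Finset.mem_product, Finset.mem_insert, Finset.mem_union,
            Finset.mem_image, Prod.mk.injEq]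
          constructor
          · rintro ⟨⟨rfl | hp, rfl | hq⟩, h1, h2⟩
            · exact absurd h1 (lt_irrefl _)
            · exact Or.inl (Or.inr ⟨q, ⟨hq, h1, h2⟩, rfl, rfl⟩)
            · exact Or.inr ⟨p, ⟨hp, h1, h2⟩, rfl, rfl⟩
            · exact Or.inl (Or.inl ⟨⟨hp, hq⟩, h1, h2⟩)
          · rintro ((⟨⟨hp, hq⟩, h1, h2⟩ | ⟨v, ⟨hv, h1, h2⟩, rfl, rfl⟩) |
              ⟨v, ⟨hv, h1, h2⟩, rfl, rfl⟩)
            · exact ⟨⟨Or.inr hp, Or.inr hq⟩, h1, h2⟩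
            · exact ⟨⟨Or.inl rfl, Or.inr hv⟩, h1, h2⟩
            · exact ⟨⟨Or.inr hv, Or.inl rfl⟩, h1, h2⟩
        rw [hd, Finset.card_union_of_disjoint, Finset.card_union_of_disjoint,
          Finset.card_image_of_injective _ (fun _ _ h => (Prod.mk.inj h).2),
          Finset.card_image_of_injective _ (fun _ _ h => (Prod.mk.inj h).1)]
        · rw [Finset.disjoint_left]
          rintro ⟨p, q⟩ h1 h2
          simp only [Finset.mem_filter, Finset.mem_product, Finset.mem_image, Prod.mk.injEq] at h1 h2
          obtain ⟨v, _, rfl, rfl⟩ := h2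
          exact ha h1.1.1
        · rw [Finset.disjoint_left]
          rintro ⟨p, q⟩ h1 h2
          simp only [Finset.mem_filter, Finset.mem_product, Finset.mem_image, Finset.mem_union,
            Prod.mk.injEq] at h1 h2
          obtain ⟨v, hv, rfl, rfl⟩ := h2
          rcases h1 with h1 | ⟨w, hw, rfl, rfl⟩
          · exact ha h1.1.2
          · exact ha hv.1
      have e2 : ((s.image φ).filter (· < φ a)).card
          = (s.filter fun v => a < v ∧ φ v < φ a).card
            + (s.filter fun v => v < a ∧ φ v < φ a).card := by
        rw [Finset.filter_image, Finset.card_image_of_injOn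
          (hs.mono (Finset.coe_subset.2 (Finset.filter_subset _ _))), ← Finset.card_union_of_disjoint]
        · congr 1
          ext v
          simp only [Finset.mem_filter, Finset.mem_union]
          constructor
          · rintro ⟨hv, h⟩
            rcases lt_trichotomy a v with h' | rfl | h'
            · exact Or.inl ⟨hv, h', h⟩
            · exact absurd h (lt_irrefl _)
            · exact Or.inr ⟨hv, h', h⟩
          · rintro (⟨hv, _, h⟩ | ⟨hv, _, h⟩) <;> exact ⟨hv, h⟩
        · rw [Finset.disjoint_left]
          intro v h1 h2
          simp only [Finset.mem_filter] at h1 h2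
          exact lt_asymm h1.2.1 h2.2.1
      have e3 : (s.filter (· < a)).card
          = (s.filter fun v => v < a ∧ φ a < φ v).card
            + (s.filter fun v => v < a ∧ φ v < φ a).card := by
        rw [← Finset.card_union_of_disjoint]
        · congr 1
          ext v
          simp only [Finset.mem_filter, Finset.mem_union]
          constructor
          · rintro ⟨hv, h⟩
            rcases lt_trichotomy (φ a) (φ v) with h' | h' | h'
            · exact Or.inl ⟨hv, h, h'⟩
            · exact absurd (Finset.mem_image.2 ⟨v, hv, h'.symm⟩) hφ
            · exact Or.inr ⟨hv, h, h'⟩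
          · rintro (⟨hv, h, _⟩ | ⟨hv, h, _⟩) <;> exact ⟨hv, h⟩
        · rw [Finset.disjoint_left]
          intro v h1 h2
          simp only [Finset.mem_filter] at h1 h2
          exact lt_asymm h1.2.2 h2.2.2
      rw [e1, e2, e3]
      omega
  · rw [chainMapU_of_not_injOn hs, map_zero, chainMapU_of_not_injOn]
    exact fun h => hs (h.mono (by simp))

theorem chainMapU_comp_boundaryU (φ : V → W) :
    chainMapU R φ ∘ₗ boundaryU R V = boundaryU R W ∘ₗ chainMapU R φ := by
  refine finsetHom_ext ?_ fun a x hx => ?_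
  · simp [chainMapU_empty, boundaryU_empty]
  · simp only [LinearMap.comp_apply] at hx ⊢
    simp [boundaryU_wedge, chainMapU_wedge, hx]

theorem chainMapU_id : chainMapU R (id : V → V) = LinearMap.id := by
  refine finsetHom_ext (by simp [chainMapU_empty]) fun a x hx => ?_
  simpa [chainMapU_wedge] using congrArg (wedge a) hx

theorem chainMapU_comp {X : Type u} [LinearOrder X] (φ : V → W) (ψ : W → X) :
    chainMapU R (ψ ∘ φ) = chainMapU R ψ ∘ₗ chainMapU R φ := by
  refine finsetHom_ext (by simp [chainMapU_empty]) fun a x hx => ?_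
  simpa [chainMapU_wedge] using congrArg (wedge (ψ (φ a))) hx

theorem projChain_of_nodup {l : List V} (h : l.Nodup) :
    projChain R V (Finsupp.single l 1) = Finsupp.single l.toFinset ((-1) ^ inversions l) := by
  unfold projChain
  rw [Finsupp.lift_apply, Finsupp.sum_single_index (by simp only [zero_smul]), one_smul, if_pos h]

theorem projChain_of_not_nodup {l : List V} (h : ¬ l.Nodup) :
    projChain R V (Finsupp.single l 1) = 0 := by
  unfold projChain
  rw [Finsupp.lift_apply, Finsupp.sum_single_index (by simp only [zero_smul]), one_smul, if_neg h]

theorem projChain_nil : projChain R V (Finsupp.single [] 1) = Finsupp.single ∅ 1 := by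
  rw [projChain_of_nodup List.nodup_nil, List.toFinset_nil, inversions, pow_zero]

theorem projChain_consChain (a : V) (x : List V →₀ R) :
    projChain R V (consChain a x) = wedge a (projChain R V x) := by
  suffices h : projChain R V ∘ₗ consChain a = wedge a ∘ₗ projChain R V from
    LinearMap.congr_fun h x
  refine Finsupp.lhom_ext' fun l => LinearMap.ext_ring ?_
  simp only [LinearMap.comp_apply, Finsupp.lsingle_apply, consChain_single]
  by_cases hl : l.Nodup
  · rw [projChain_of_nodup hl]
    by_cases ha : a ∈ l
    · rw [wedge_mem (by simpa using ha),
        projChain_of_not_nodup (fun h => (List.nodup_cons.1 h).1 ha)]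
    · rw [wedge_notMem (by simpa using ha), projChain_of_nodup (List.nodup_cons.2 ⟨ha, hl⟩)]
      have hc : (l.toFinset.filter (· < a)).card = l.countP (· < a) := by
        have : l.toFinset.filter (· < a) = (l.filter (· < a)).toFinset := by ext; simp
        rw [this, List.toFinset_card_of_nodup (hl.filter _), List.countP_eq_length_filter]
      rw [List.toFinset_cons, inversions, hc, pow_add, mul_comm]
  · rw [projChain_of_not_nodup hl, map_zero,
      projChain_of_not_nodup (fun h => hl (List.nodup_cons.1 h).2)]

theorem projChain_comp_boundaryD :
    projChain R V ∘ₗ boundaryD R V = boundaryU R V ∘ₗ projChain R V := by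
  refine listHom_ext ?_ fun a x hx => ?_
  · simp [boundaryD_nil, projChain_nil, boundaryU_empty]
  · simp only [LinearMap.comp_apply] at hx ⊢
    simp [boundaryD_consChain, boundaryU_wedge, projChain_consChain, hx]

theorem projChain_comp_chainMapD (φ : V → W) :
    projChain R W ∘ₗ chainMapD R φ = chainMapU R φ ∘ₗ projChain R V := by
  refine listHom_ext ?_ fun a x hx => ?_
  · have : chainMapD R φ (Finsupp.single [] 1) = Finsupp.single [] 1 := by simp [chainMapD]
    simp [this, projChain_nil, chainMapU_empty]
  · simp only [LinearMap.comp_apply] at hx ⊢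
    simp [chainMapD_consChain, chainMapU_wedge, projChain_consChain, hx]

end Wedge

/-! ### The infimum chain complex -/

section Inf

variable {B B' B'' : Type u}

/-- The degree-`n` part of the infimum complex of a set `A` of generators of a free module
with boundary `d`, where `deg` is the degree of the generators: `R(Aₙ) ∩ d⁻¹ R(Aₙ₋₁)`. -/
def infModule (deg : B → ℕ) (d : (B →₀ R) →ₗ[R] (B →₀ R)) (A : Set B) (n : ℕ) :
    Submodule R (B →₀ R) :=
  Finsupp.supported R R {b | b ∈ A ∧ deg b = n} ⊓
    (Finsupp.supported R R {b | b ∈ A ∧ deg b + 1 = n}).comap d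

variable {deg : B → ℕ} {d : (B →₀ R) →ₗ[R] (B →₀ R)} {A : Set B}
  {deg' : B' → ℕ} {d' : (B' →₀ R) →ₗ[R] (B' →₀ R)} {A' : Set B'}
  {deg'' : B'' → ℕ} {d'' : (B'' →₀ R) →ₗ[R] (B'' →₀ R)} {A'' : Set B''}

theorem boundary_mem_infModule (hd : d ∘ₗ d = 0) (n : ℕ) (x : B →₀ R)
    (hx : x ∈ infModule deg d A (n + 1)) : d x ∈ infModule deg d A n := by
  refine ⟨?_, ?_⟩
  · have := hx.2
    simpa using this
  · have h0 : d (d x) = 0 := LinearMap.congr_fun hd x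
    rw [SetLike.mem_coe, Submodule.mem_comap, h0]
    exact Submodule.zero_mem _

variable (deg d A) in
/-- The infimum chain complex, the largest subcomplex contained in the span of `A`. -/
def infComplex (hd : d ∘ₗ d = 0) : ChainComplex (ModuleCat.{u} R) ℕ :=
  ChainComplex.of (fun n => ModuleCat.of R (infModule deg d A n))
    (fun n => ModuleCat.ofHom (d.restrict (boundary_mem_infModule hd n)))
    (fun n => by
      refine ModuleCat.hom_ext (LinearMap.ext fun x => Subtype.ext ?_)
      exact LinearMap.congr_fun hd x.1)

/-- The chains that belong to the infimum complex in degree `n`, as honest linear combinations of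
generators. -/
def infComplexIncl (hd : d ∘ₗ d = 0) (n : ℕ) (x : (infComplex deg d A hd).X n) : B →₀ R :=
  Subtype.val (p := fun y => y ∈ infModule deg d A n) x

/-- A linear map that commutes with the boundaries and sends each generator in `A` to a linear
combination of generators in `A'` of the same degree. -/
structure IsInfMap (deg : B → ℕ) (d : (B →₀ R) →ₗ[R] (B →₀ R)) (A : Set B)
    (deg' : B' → ℕ) (d' : (B' →₀ R) →ₗ[R] (B' →₀ R)) (A' : Set B')
    (g : (B →₀ R) →ₗ[R] (B' →₀ R)) : Prop where
  comm : g ∘ₗ d = d' ∘ₗ g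
  map : ∀ b ∈ A, g (Finsupp.single b 1) ∈ Finsupp.supported R R {b' | b' ∈ A' ∧ deg' b' = deg b}

theorem IsInfMap.map_supported {g : (B →₀ R) →ₗ[R] (B' →₀ R)}
    (hg : IsInfMap deg d A deg' d' A' g) (p : ℕ → Prop) (x : B →₀ R)
    (hx : x ∈ Finsupp.supported R R {b | b ∈ A ∧ p (deg b)}) :
    g x ∈ Finsupp.supported R R {b | b ∈ A' ∧ p (deg' b)} := by
  rw [Finsupp.supported_eq_span_single] at hx
  have hle : Submodule.span R ((fun i => Finsupp.single i (1 : R)) '' {b | b ∈ A ∧ p (deg b)}) ≤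
      (Finsupp.supported R R {b | b ∈ A' ∧ p (deg' b)}).comap g := by
    rw [Submodule.span_le]
    rintro _ ⟨b, ⟨hb, hp⟩, rfl⟩
    refine Finsupp.supported_mono ?_ (hg.map b hb)
    rintro b' ⟨h1, h2⟩
    exact ⟨h1, h2 ▸ hp⟩
  exact hle hx

theorem IsInfMap.map_infModule {g : (B →₀ R) →ₗ[R] (B' →₀ R)}
    (hg : IsInfMap deg d A deg' d' A' g) (n : ℕ) (x : B →₀ R)
    (hx : x ∈ infModule deg d A n) : g x ∈ infModule deg' d' A' n := by
  refine ⟨hg.map_supported (· = n) x hx.1, ?_⟩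
  rw [SetLike.mem_coe, Submodule.mem_comap, ← LinearMap.comp_apply, ← hg.comm]
  exact hg.map_supported (· + 1 = n) _ hx.2

theorem IsInfMap.comp {g : (B →₀ R) →ₗ[R] (B' →₀ R)} {g' : (B' →₀ R) →ₗ[R] (B'' →₀ R)}
    (hg : IsInfMap deg d A deg' d' A' g) (hg' : IsInfMap deg' d' A' deg'' d'' A'' g') :
    IsInfMap deg d A deg'' d'' A'' (g' ∘ₗ g) where
  comm := by
    rw [LinearMap.comp_assoc, hg.comm, ← LinearMap.comp_assoc, hg'.comm, LinearMap.comp_assoc]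
  map b hb := hg'.map_supported (· = deg b) _ (hg.map b hb)

/-- The chain map between infimum complexes induced by restriction. -/
def infMap (hd : d ∘ₗ d = 0) (hd' : d' ∘ₗ d' = 0) (g : (B →₀ R) →ₗ[R] (B' →₀ R))
    (hg : IsInfMap deg d A deg' d' A' g) :
    infComplex deg d A hd ⟶ infComplex deg' d' A' hd' :=
  ChainComplex.ofHom
    (fun n => ModuleCat.ofHom (g.restrict (hg.map_infModule n)))
    (fun n => by
      simp only [infComplex, ChainComplex.of, ChainComplex.of_d]
      refine ModuleCat.hom_ext (LinearMap.ext fun x => Subtype.ext ?_)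
      exact (LinearMap.congr_fun hg.comm x.1).symm)

theorem infMap_eq_id (hd : d ∘ₗ d = 0) (g : (B →₀ R) →ₗ[R] (B →₀ R))
    (hg : IsInfMap deg d A deg d A g) (h : g = LinearMap.id) : infMap hd hd g hg = 𝟙 _ := by
  subst h
  rfl

theorem infMap_comp (hd : d ∘ₗ d = 0) (hd' : d' ∘ₗ d' = 0) (hd'' : d'' ∘ₗ d'' = 0)
    (g : (B →₀ R) →ₗ[R] (B' →₀ R)) (hg : IsInfMap deg d A deg' d' A' g)
    (g' : (B' →₀ R) →ₗ[R] (B'' →₀ R)) (hg' : IsInfMap deg' d' A' deg'' d'' A'' g')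
    (k : (B →₀ R) →ₗ[R] (B'' →₀ R)) (hk : IsInfMap deg d A deg'' d'' A'' k)
    (h : k = g' ∘ₗ g) :
    infMap hd hd'' k hk = infMap hd hd' g hg ≫ infMap hd' hd'' g' hg' := by
  subst h
  rfl

end Inf

/-! ### Embedded homology -/

/-- The generators of the augmented chains of a hyperdigraph: its directed hyperedges and the empty
sequence. -/
def Hyperdigraph.aug (H : Hyperdigraph V) : Set (List V) := insert [] H.edges

/-- The generators of the augmented chains of a hypergraph: its hyperedges and the empty set. -/
def Hypergraph.aug (H : Hypergraph V) : Set (Finset V) := insert ∅ H.edges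

theorem isInfMap_chainMapD {X Y : HyperdigraphCat.{u}} (f : X ⟶ Y) :
    IsInfMap List.length (boundaryD R X.V) X.graph.aug List.length (boundaryD R Y.V) Y.graph.aug
      (chainMapD R f.toFun) where
  comm := chainMapD_comp_boundaryD _
  map := by
    intro l hl
    have : chainMapD R f.toFun (Finsupp.single l 1) = Finsupp.single (l.map f.toFun) 1 := by
      simp [chainMapD]
    rw [this]
    refine Finsupp.single_mem_supported R 1 ⟨?_, by simp⟩
    rcases hl with rfl | hl
    · exact Or.inl rfl
    · exact Or.inr (f.map_edges l hl)

theorem isInfMap_chainMapU {X Y : HypergraphCat.{u}} (f : X ⟶ Y) :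
    IsInfMap Finset.card (boundaryU R X.V) X.graph.aug Finset.card (boundaryU R Y.V) Y.graph.aug
      (chainMapU R f.toFun) where
  comm := chainMapU_comp_boundaryU _
  map := by
    intro s hs
    by_cases hi : Set.InjOn f.toFun s
    · rw [chainMapU_of_injOn hi]
      refine Finsupp.single_mem_supported R _ ⟨?_, Finset.card_image_of_injOn hi⟩
      rcases hs with rfl | hs
      · exact Or.inl rfl
      · exact Or.inr (f.map_edges s hs)
    · rw [chainMapU_of_not_injOn hi]
      exact Submodule.zero_mem _

theorem isInfMap_projChain (X : HyperdigraphCat.{u}) :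
    IsInfMap List.length (boundaryD R X.V) X.graph.aug Finset.card (boundaryU R X.V)
      (underlyingFunctor.obj X).graph.aug (projChain R X.V) where
  comm := projChain_comp_boundaryD
  map := by
    intro l hl
    have hn : l.Nodup := by
      rcases hl with rfl | hl
      · exact List.nodup_nil
      · exact X.graph.nodup l hl
    rw [projChain_of_nodup hn]
    refine Finsupp.single_mem_supported R _ ⟨?_, List.toFinset_card_of_nodup hn⟩
    rcases hl with rfl | hl
    · exact Or.inl List.toFinset_nil
    · exact Or.inr ⟨l, hl, rfl⟩

variable (R)

/-- The (augmented) infimum chain complex of a hyperdigraph. The degree is the number of vertices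
of a directed hyperedge, one more than its dimension; in degree `0` it is the free module on
the empty sequence. Its homology in degree `n` is the reduced embedded homology
of the hyperdigraph in dimension `n - 1`. -/
def infD : HyperdigraphCat.{u} ⥤ ChainComplex (ModuleCat.{u} R) ℕ where
  obj X := infComplex List.length (boundaryD R X.V) X.graph.aug boundaryD_comp_self
  map f := infMap _ _ _ (isInfMap_chainMapD f)
  map_id X := by
    have h : chainMapD R (𝟙 X : X ⟶ X).toFun = LinearMap.id := by
      refine Finsupp.lhom_ext' fun l => LinearMap.ext_ring ?_
      change chainMapD R (id : X.V → X.V) _ = _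
      simp [chainMapD]
    exact infMap_eq_id _ _ _ h
  map_comp f g := by
    refine infMap_comp _ _ _ _ (isInfMap_chainMapD f) _ (isInfMap_chainMapD g) _
      (isInfMap_chainMapD (f ≫ g)) ?_
    refine Finsupp.lhom_ext' fun l => LinearMap.ext_ring ?_
    simp only [chainMapD, LinearMap.comp_apply, Finsupp.lsingle_apply, Finsupp.lmapDomain_apply,
      Finsupp.mapDomain_single, List.map_map]
    rfl

/-- The (augmented) infimum chain complex of a hypergraph, graded by the number of vertices; its
homology in degree `n` is the reduced embedded homology of the hypergraph in dimension `n - 1`. -/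
def infU : HypergraphCat.{u} ⥤ ChainComplex (ModuleCat.{u} R) ℕ where
  obj X := infComplex Finset.card (boundaryU R X.V) X.graph.aug boundaryU_comp_self
  map f := infMap _ _ _ (isInfMap_chainMapU f)
  map_id X := infMap_eq_id _ _ (isInfMap_chainMapU (𝟙 X)) chainMapU_id
  map_comp f g :=
    infMap_comp _ _ _ _ (isInfMap_chainMapU f) _ (isInfMap_chainMapU g) _
      (isInfMap_chainMapU (f ≫ g)) (chainMapU_comp f.toFun g.toFun)

/-- The projection from the infimum complex of a hyperdigraph to that of its underlying
hypergraph. -/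
def projInf : infD.{u} R ⟶ underlyingFunctor ⋙ infU R where
  app X := infMap _ _ _ (isInfMap_projChain X)
  naturality X Y f :=
    (infMap_comp _ _ _ _ (isInfMap_chainMapD f) _ (isInfMap_projChain Y) _
      ((isInfMap_chainMapD f).comp (isInfMap_projChain Y)) rfl).symm.trans
      (infMap_comp _ _ _ _ (isInfMap_projChain X) _
        (isInfMap_chainMapU (underlyingFunctor.map f)) _ _ (projChain_comp_chainMapD f.toFun))

/-- The projection from the infimum complex of the join of two hyperdigraphs to that of the join of
their underlying hypergraphs. -/
def projInfJoin : joinD.{u} ⋙ infD R ⟶ underlyingFunctor.prod underlyingFunctor ⋙ joinU ⋙ infU R :=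
  Functor.whiskerLeft joinD (projInf R) ≫ Functor.whiskerRight underlyingJoin (infU R)

/-! ### Künneth-type short exact sequences -/

instance (n : ℕ) : Finite {i : ℕ × ℕ // i.1 + i.2 = n} :=
  Finite.of_injective (β := Fin (n + 1) × Fin (n + 1))
    (fun i => (⟨i.1.1, by have := i.2; omega⟩, ⟨i.1.2, by have := i.2; omega⟩)) (by
      rintro ⟨⟨a, b⟩, h⟩ ⟨⟨c, d⟩, h'⟩ e
      simpa using e)

instance (n : ℕ) : Finite {i : ℕ × ℕ // i.1 + i.2 + 1 = n} :=
  Finite.of_injective (β := Fin (n + 1) × Fin (n + 1))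
    (fun i => (⟨i.1.1, by have := i.2; omega⟩, ⟨i.1.2, by have := i.2; omega⟩)) (by
      rintro ⟨⟨a, b⟩, h⟩ ⟨⟨c, d⟩, h'⟩ e
      simpa using e)

/-- The functor `(C, C') ↦ ⨁_{p + q = n} H_p(C) ⊗ H_q(C')`. -/
@[simps]
def tensorTerm (n : ℕ) :
    ChainComplex (ModuleCat.{u} R) ℕ × ChainComplex (ModuleCat.{u} R) ℕ ⥤ ModuleCat.{u} R where
  obj C := ⨁ fun i : {i : ℕ × ℕ // i.1 + i.2 = n} => C.1.homology i.1.1 ⊗ C.2.homology i.1.2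
  map f := biproduct.map fun i =>
    HomologicalComplex.homologyMap f.1 i.1.1 ⊗ₘ HomologicalComplex.homologyMap f.2 i.1.2
  map_id C := by
    refine biproduct.hom_ext _ _ fun i => ?_
    simp
  map_comp f g := by
    refine biproduct.hom_ext _ _ fun i => ?_
    simp [HomologicalComplex.homologyMap_comp]

/-- The element `[x] ⊗ [y]` of the summand `H_p(C) ⊗ H_q(C')`, for cycles `x` and `y`. -/
def tensorClass (C : ChainComplex (ModuleCat.{u} R) ℕ × ChainComplex (ModuleCat.{u} R) ℕ)
    (p q : ℕ) (x : C.1.cycles p) (y : C.2.cycles q) : (tensorTerm R (p + q)).obj C :=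
  (biproduct.ι (fun i : {i : ℕ × ℕ // i.1 + i.2 = p + q} =>
    C.1.homology i.1.1 ⊗ C.2.homology i.1.2) ⟨(p, q), rfl⟩).hom
    (TensorProduct.tmul R ((C.1.homologyπ p).hom x) ((C.2.homologyπ q).hom y))

/-- The linear combination of sequences that a cycle of the infimum complex of a hyperdigraph is. -/
def cycleD (X : HyperdigraphCat.{u}) (n : ℕ) (x : ((infD R).obj X).cycles n) : List X.V →₀ R :=
  infComplexIncl boundaryD_comp_self n ((((infD R).obj X).iCycles n).hom x)

/-- The linear combination of finite sets that a cycle of the infimum complex of a hypergraph is. -/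
def cycleU (X : HypergraphCat.{u}) (n : ℕ) (x : ((infU R).obj X).cycles n) : Finset X.V →₀ R :=
  infComplexIncl boundaryU_comp_self n ((((infU R).obj X).iCycles n).hom x)

/-- The functor `(C, C') ↦ ⨁_{p + q + 1 = n} Tor(H_p(C), H_q(C'))`. -/
@[simps]
def torTerm (n : ℕ) :
    ChainComplex (ModuleCat.{u} R) ℕ × ChainComplex (ModuleCat.{u} R) ℕ ⥤ ModuleCat.{u} R where
  obj C := ⨁ fun i : {i : ℕ × ℕ // i.1 + i.2 + 1 = n} =>
    ((Tor (ModuleCat.{u} R) 1).obj (C.1.homology i.1.1)).obj (C.2.homology i.1.2)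
  map f := biproduct.map fun i =>
    ((Tor (ModuleCat.{u} R) 1).map (HomologicalComplex.homologyMap f.1 i.1.1)).app _ ≫
      ((Tor (ModuleCat.{u} R) 1).obj _).map (HomologicalComplex.homologyMap f.2 i.1.2)
  map_id C := by
    refine biproduct.hom_ext _ _ fun i => ?_
    simp only [biproduct.map_π, prod_id_fst, prod_id_snd, HomologicalComplex.homologyMap_id,
      CategoryTheory.Functor.map_id, NatTrans.id_app, Category.comp_id, Category.id_comp]
  map_comp f g := by
    refine biproduct.hom_ext _ _ fun i => ?_
    simp only [biproduct.map_π, biproduct.map_π_assoc, Category.assoc, prod_comp_fst,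
      prod_comp_snd, HomologicalComplex.homologyMap_comp, CategoryTheory.Functor.map_comp,
      NatTrans.comp_app, NatTrans.naturality_assoc]

variable {R}

/-- Künneth-type short exact sequences
`0 ⟶ ⨁_{p + q = n} H_p(C) ⊗ H_q(C') ⟶ H_n(J) ⟶ ⨁_{p + q + 1 = n} Tor(H_p(C), H_q(C')) ⟶ 0`
for a functorial family of complexes `C`, `C'`, `J`, indexed by the objects of a
category `P` and natural with respect to the morphisms of `P`. -/
structure NaturalKU {P : Type (u + 1)} [Category.{u} P]
    (C : P ⥤ ChainComplex (ModuleCat.{u} R) ℕ × ChainComplex (ModuleCat.{u} R) ℕ)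
    (J : P ⥤ ChainComplex (ModuleCat.{u} R) ℕ) (n : ℕ) where
  f : C ⋙ tensorTerm R n ⟶ J ⋙ HomologicalComplex.homologyFunctor _ _ n
  g : J ⋙ HomologicalComplex.homologyFunctor _ _ n ⟶ C ⋙ torTerm R n
  zero : f ≫ g = 0
  exact : ∀ X : P, (ShortComplex.mk (f.app X) (g.app X) (NatTrans.congr_app zero X)).ShortExact

variable {P : Type (u + 1)} [Category.{u} P]
  {C : P ⥤ ChainComplex (ModuleCat.{u} R) ℕ × ChainComplex (ModuleCat.{u} R) ℕ}
  {J : P ⥤ ChainComplex (ModuleCat.{u} R) ℕ} {n : ℕ}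

/-- The short exact sequences, as a functor. On a morphism it is given by the three maps
induced on the tensor terms, on the homology of `J`, and on the Tor terms. -/
@[simps]
def NaturalKU.functor (K : NaturalKU C J n) : P ⥤ ShortComplex (ModuleCat.{u} R) where
  obj X := ShortComplex.mk (K.f.app X) (K.g.app X) (NatTrans.congr_app K.zero X)
  map φ :=
    { τ₁ := (C ⋙ tensorTerm R n).map φ
      τ₂ := (J ⋙ HomologicalComplex.homologyFunctor _ _ n).map φ
      τ₃ := (C ⋙ torTerm R n).map φ
      comm₁₂ := K.f.naturality φ
      comm₂₃ := K.g.naturality φ }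
  map_id X := by
    ext1
    · exact (C ⋙ tensorTerm R n).map_id X
    · exact (J ⋙ HomologicalComplex.homologyFunctor _ _ n).map_id X
    · exact (C ⋙ torTerm R n).map_id X
  map_comp φ ψ := by
    ext1
    · exact (C ⋙ tensorTerm R n).map_comp φ ψ
    · exact (J ⋙ HomologicalComplex.homologyFunctor _ _ n).map_comp φ ψ
    · exact (C ⋙ torTerm R n).map_comp φ ψ

/-! ### Regular maps, independence complexes and matroids -/

/-- The directed independence complex of a graph: all nonempty finite sequences of distinct,
mutually non-adjacent vertices. -/
def directedInd (G : SimpleGraph V) : Hyperdigraph V where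
  edges := {l | l ≠ [] ∧ l.Nodup ∧ ∀ v ∈ l, ∀ w ∈ l, ¬ G.Adj v w}
  nodup _ hl := hl.2.1
  ne_nil _ hl := hl.1

/-- The `(k-1)`-skeleton: the directed hyperedges with at most `k` vertices. -/
def Hyperdigraph.skeleton (H : Hyperdigraph V) (k : ℕ) : Hyperdigraph V where
  edges := {l | l ∈ H.edges ∧ l.length ≤ k}
  nodup l hl := H.nodup l hl.1
  ne_nil l hl := H.ne_nil l hl.1

/-- `f` is `k`-regular on `G`: any at most `k` distinct, mutually non-adjacent vertices have linearly
independent images. -/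
def IsRegular {𝔽 : Type u} [Field 𝔽] {N : ℕ} (G : SimpleGraph V) (k : ℕ)
    (f : V → (Fin N → 𝔽)) : Prop :=
  ∀ l ≤ k, ∀ v : Fin l → V, Function.Injective v → (∀ i j, ¬ G.Adj (v i) (v j)) →
    LinearIndependent 𝔽 fun i => f (v i)

/-- The vectorial directed matroid of a finite set `S` of vectors, without its empty sequence: all
nonempty finite sequences of distinct elements of `S` whose set of entries is linearly
independent. -/
def directedMatroid {𝔽 : Type u} [Field 𝔽] {N : ℕ} (S : Finset (Fin N → 𝔽)) :
    Hyperdigraph S where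
  edges := {l | l ≠ [] ∧ l.Nodup ∧
    LinearIndependent 𝔽 fun v : {v : S // v ∈ l} => (v.1 : Fin N → 𝔽)}
  nodup _ hl := hl.2.1
  ne_nil _ hl := hl.1

end RegularKunneth

end

noncomputable section

namespace RegularKunneth

/-! ### Submodules of projective modules over a principal ideal domain -/

section PID

variable {R : Type*} [CommRing R] [IsDomain R]

-- Write `P` for the projection onto the generators outside a given set of (directed) hyperedges.
-- The theorem rests on the identity Inf(A * A') = Inf(A) ⊗ Inf(A') of chain complexes, followed by
-- the Künneth theorem over a principal ideal domain.
--
-- Once the empty sequence or set is adjoined, the generators of a join are exactly the pairs of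
-- generators of the factors (`aug_joinD`, `aug_joinU`), and the boundary satisfies the Leibniz rule
-- (`boundaryD_leibniz`, `boundaryU_leibniz`). Let `t` be the tensor of a chain of Inf(A * A'). Then
-- (P ⊗ 1) t = 0, and applying P ⊗ 1 to the Leibniz rule for the boundary gives (P d ⊗ 1) t = 0,
-- because `P` commutes with the sign operator. Hence `t` lies in Inf(A) ⊗ F', with F' the free
-- module of all chains of the second factor; symmetrically it lies in F ⊗ Inf(A'). For flat modules
-- the intersection of the two is Inf(A) ⊗ Inf(A') (`exists_map_eq_of_exact`,
-- `IsJoin.exists_map_ker_eq_unjoin`). The other inclusion is again the Leibniz rule.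
--
-- Submodules of free modules of any rank over a principal ideal domain are free, so chains, cycles
-- Z and boundaries B of the infimum complexes are projective, hence flat. The first Künneth map
-- sends [x] ⊗ [y] to [x ⊗ y]. For the second, Tor(H_p, H'_q) is the kernel of H_p ⊗ B'_q → H_p ⊗
-- Z'_q, since 0 → B'_q → Z'_q → H'_q → 0 is a projective resolution. A cycle z is sent to the class
-- of (1 ⊗ d) z_{p,q+1}, viewed in (C_p / B_p) ⊗ B'_q, where Tor(H_p, H'_q) embeds. Splittings are
-- used to prove exactness (`TensorData.shortExact`), but they do not enter the definition of either
-- map. Both maps are therefore natural for every family of chain maps compatible with the tensor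
-- decompositions; morphisms of hyper(di)graphs and the projections π are of this kind.
--
-- Compatibility of signs is never proved by comparing permutations of a join: all maps intertwine
-- prepending a vertex with exterior multiplication by it, and this determines them inductively. For
-- part (2), linear independence of the images makes a regular map a morphism; the squares and cubes
-- then come from functoriality and from naturality of π.

theorem linearIndependent_of_triangular {ι J : Type*} [LinearOrder ι] (v : J → ι →₀ R) (e : J → ι)
    (hne : ∀ j, v j (e j) ≠ 0) (he : Function.Injective e)
    (h : ∀ j k, e j < e k → v j (e k) = 0) : LinearIndependent R v := by
  rw [linearIndependent_iff]
  intro c hc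
  by_contra h0
  -- Look at the coordinate of largest index `e j` among the vectors that occur: by triangularity
  -- only `v j` contributes to it.
  obtain ⟨j, hj, hmax⟩ := Finset.exists_max_image c.support e (Finsupp.support_nonempty_iff.2 h0)
  have h1 : (Finsupp.linearCombination R v c) (e j) = 0 := by rw [hc]; rfl
  rw [Finsupp.linearCombination_apply, Finsupp.sum, Finsupp.finsetSum_apply,
    Finset.sum_eq_single_of_mem j hj] at h1
  · rw [Finsupp.smul_apply, smul_eq_mul, mul_eq_zero] at h1
    exact h1.elim (Finsupp.mem_support_iff.1 hj) (hne j)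
  · intro k hk hkj
    rw [Finsupp.smul_apply, h k j (lt_of_le_of_ne (hmax k hk) (he.ne hkj)), smul_zero]

variable [IsPrincipalIdealRing R]

/-- A submodule of a free module over a principal ideal domain is free, in arbitrary rank. -/
theorem free_of_submodule_finsupp {ι : Type*} (N : Submodule R (ι →₀ R)) : Module.Free R N := by
  classical
  let _ : LinearOrder ι := IsWellOrder.linearOrder (α := ι) WellOrderingRel
  have : WellFoundedLT ι := ⟨(inferInstance : IsWellFounded ι WellOrderingRel).wf⟩
  -- The ideal of leading coefficients at `i` of the elements of `N` supported on indices at most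
  -- `i`. The element `n i` chosen below realises a generator of it; the `n i` with nonzero leading
  -- coefficient will form a basis.
  let I (i : ι) : Ideal R :=
    (N ⊓ Finsupp.supported R R (Set.Iic i)).map (Finsupp.lapply i : (ι →₀ R) →ₗ[R] R)
  have hgen (i : ι) : ∃ n ∈ N ⊓ Finsupp.supported R R (Set.Iic i),
      n i = Submodule.IsPrincipal.generator (I i) := by
    obtain ⟨n, hn, h⟩ := Submodule.IsPrincipal.generator_mem (I i)
    exact ⟨n, hn, h⟩
  choose n hn hni using hgen
  have hvanish (i j : ι) (h : i < j) : n i j = 0 := by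
    by_contra h0
    exact (((Finsupp.mem_supported R _).1 (hn i).2) (Finsupp.mem_support_iff.2 h0)).not_gt h
  let J := {i : ι // n i i ≠ 0}
  let v : J → N := fun j => ⟨n j.1, (hn j.1).1⟩
  have hli : LinearIndependent R v :=
    LinearIndependent.of_comp N.subtype (linearIndependent_of_triangular (fun j : J => n j.1)
      (fun j => j.1) (fun j => j.2) Subtype.val_injective fun j k h => hvanish _ _ h)
  have hspan (i : ι) : ∀ x (hx : x ∈ N), x ∈ Finsupp.supported R R (Set.Iic i) →
      (⟨x, hx⟩ : N) ∈ Submodule.span R (Set.range v) := by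
    induction i using WellFoundedLT.induction with
    | ind i ih =>
      -- If the coefficient at `i` vanishes, the top index of `x` is strictly below `i`, and the
      -- transfinite induction hypothesis applies at that index.
      have key : ∀ x (hx : x ∈ N), x ∈ Finsupp.supported R R (Set.Iic i) → x i = 0 →
          (⟨x, hx⟩ : N) ∈ Submodule.span R (Set.range v) := by
        intro x hx hxi h0
        rcases x.support.eq_empty_or_nonempty with he | hne
        · rw [Finsupp.support_eq_empty] at he
          subst he
          exact Submodule.zero_mem _
        · have hm := Finset.max'_mem _ hne
          refine ih (x.support.max' hne) (lt_of_le_of_ne ((Finsupp.mem_supported R x).1 hxi hm) ?_)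
            x hx ?_
          · intro h
            rw [h] at hm
            exact Finsupp.mem_support_iff.1 hm h0
          · rw [Finsupp.mem_supported]
            intro k hk
            exact Finset.le_max' _ k hk
      intro x hx hxi
      have hxI : x i ∈ I i := ⟨x, ⟨hx, hxi⟩, rfl⟩
      -- The leading coefficient of `x` is `r` times that of `n i`, so subtracting `r • n i` removes
      -- it. If the generator is zero, it was absent from the start.
      obtain ⟨r, hr⟩ := (Submodule.IsPrincipal.mem_iff_eq_smul_generator (I i)).1 hxI
      rw [← hni, smul_eq_mul] at hr
      by_cases hi : n i i = 0
      · exact key x hx hxi (by rw [hr, hi, mul_zero])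
      · have := key (x - r • n i) (N.sub_mem hx (N.smul_mem r (hn i).1))
          (Submodule.sub_mem _ hxi (Submodule.smul_mem _ r (hn i).2)) (by simp [hr])
        have h2 : (⟨x, hx⟩ : N) = ⟨x - r • n i, N.sub_mem hx (N.smul_mem r (hn i).1)⟩ +
            r • v ⟨i, hi⟩ := by
          ext1; simp [v]
        rw [h2]
        exact Submodule.add_mem _ this
          (Submodule.smul_mem _ _ (Submodule.subset_span ⟨_, rfl⟩))
  refine Module.Free.of_basis (Module.Basis.mk hli ?_)
  rintro ⟨x, hx⟩ -
  rcases x.support.eq_empty_or_nonempty with he | hne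
  · rw [Finsupp.support_eq_empty] at he
    subst he
    exact Submodule.zero_mem _
  · refine hspan (x.support.max' hne) x hx ?_
    rw [Finsupp.mem_supported]
    exact fun k hk => Finset.le_max' _ k hk

/-- A module that embeds into a projective module over a principal ideal domain is projective. -/
theorem projective_of_injective {M N : Type*} [AddCommGroup M] [Module R M] [AddCommGroup N]
    [Module R N] [Module.Projective R M] (f : N →ₗ[R] M) (hf : Function.Injective f) :
    Module.Projective R N := by
  -- A splitting embeds `M` in the free module `M →₀ R`, hence `N` is isomorphic to a submodule of a
  -- free module.
  obtain ⟨s, hs⟩ := Module.projective_def'.1 ‹Module.Projective R M›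
  have hs' : Function.Injective s := fun x y h => by
    simpa using (LinearMap.congr_fun hs x).symm.trans
      ((congrArg (Finsupp.linearCombination R id) h).trans (LinearMap.congr_fun hs y))
  have := free_of_submodule_finsupp (LinearMap.range (s ∘ₗ f))
  exact Module.Projective.of_equiv
    (LinearEquiv.ofInjective (s ∘ₗ f) (by simpa using hs'.comp hf)).symm

end PID

/-! ### Tensor products of kernels -/

section Kernel

open TensorProduct

variable {R : Type*} [CommRing R] {M N K K' P P' : Type*} [AddCommGroup M] [Module R M]
  [AddCommGroup N] [Module R N] [AddCommGroup K] [Module R K] [AddCommGroup K'] [Module R K']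
  [AddCommGroup P] [Module R P] [AddCommGroup P'] [Module R P']

/-- For flat modules, the intersection of `ker θ ⊗ N` and `M ⊗ ker θ'` in `M ⊗ N` is
`ker θ ⊗ ker θ'`. -/
theorem exists_map_eq_of_exact [Module.Flat R K] [Module.Flat R N] [Module.Flat R P']
    {i : K →ₗ[R] M} {θ : M →ₗ[R] P} {i' : K' →ₗ[R] N} {θ' : N →ₗ[R] P'}
    (hi : Function.Injective i) (h : Function.Exact i θ) (h' : Function.Exact i' θ')
    (t : M ⊗[R] N) (ht : θ.rTensor N t = 0) (ht' : θ'.lTensor M t = 0) :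
    ∃ s : K ⊗[R] K', TensorProduct.map i i' s = t := by
  obtain ⟨s, rfl⟩ := (Module.Flat.rTensor_exact N h t).1 ht
  -- Flatness of `P'` makes `K ⊗ P' → M ⊗ P'` injective, so the vanishing of `(1 ⊗ θ') s` can be
  -- tested in `M ⊗ P'`, where it is the hypothesis on `t`.
  have h1 : θ'.lTensor K s = 0 := by
    apply Module.Flat.rTensor_preserves_injective_linearMap (M := P') i hi
    rw [map_zero, ← ht', ← LinearMap.comp_apply, ← LinearMap.comp_apply,
      LinearMap.rTensor_comp_lTensor, LinearMap.lTensor_comp_rTensor]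
  obtain ⟨r, rfl⟩ := (Module.Flat.lTensor_exact K h' s).1 h1
  refine ⟨r, ?_⟩
  rw [← LinearMap.comp_apply, LinearMap.rTensor_comp_lTensor]

theorem map_injective_of_flat [Module.Flat R K] [Module.Flat R N] {i : K →ₗ[R] M} {i' : K' →ₗ[R] N}
    (hi : Function.Injective i) (hi' : Function.Injective i') :
    Function.Injective (TensorProduct.map i i') := by
  rw [← LinearMap.rTensor_comp_lTensor]
  exact (Module.Flat.rTensor_preserves_injective_linearMap i hi).comp
    (Module.Flat.lTensor_preserves_injective_linearMap i' hi')

end Kernel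

end RegularKunneth

end

noncomputable section

namespace RegularKunneth

/-! ### Left derived functors by means of resolutions of length one -/

section TwoTerm

open scoped ZeroObject

variable {A : Type*} [Category* A] [Abelian A]

/-- The terms of `twoTerm`. -/
def twoTermX (S : ShortComplex A) : ℕ → A
  | 0 => S.X₂
  | 1 => S.X₁
  | _ + 2 => 0

/-- The differentials of `twoTerm`. -/
def twoTermD (S : ShortComplex A) : ∀ n, twoTermX S (n + 1) ⟶ twoTermX S n
  | 0 => S.f
  | _ + 1 => 0

/-- The complex `⋯ ⟶ 0 ⟶ S.X₁ ⟶ S.X₂`. -/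
def twoTerm (S : ShortComplex A) : ChainComplex A ℕ :=
  ChainComplex.of (twoTermX S) (twoTermD S) (fun _ => zero_comp)

/-- The degree-zero term of `twoTerm`. -/
def twoTermIsoZero (S : ShortComplex A) : (twoTerm S).X 0 ≅ S.X₂ := Iso.refl _

/-- The degree-one term of `twoTerm`. -/
def twoTermIsoOne (S : ShortComplex A) : (twoTerm S).X 1 ≅ S.X₁ := Iso.refl _

theorem twoTerm_d (S : ShortComplex A) :
    (twoTerm S).d 1 0 ≫ (twoTermIsoZero S).hom = (twoTermIsoOne S).hom ≫ S.f :=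
  (Category.comp_id _).trans
    ((ChainComplex.of_d (twoTermX S) (twoTermD S) 0).trans (Category.id_comp S.f).symm)

theorem twoTerm_isZero (S : ShortComplex A) (n : ℕ) : IsZero ((twoTerm S).X (n + 2)) :=
  isZero_zero A

/-- The components of `twoTermMap`. -/
def twoTermMapF {S T : ShortComplex A} (φ : S ⟶ T) : ∀ n, (twoTerm S).X n ⟶ (twoTerm T).X n
  | 0 => (twoTermIsoZero S).hom ≫ φ.τ₂ ≫ (twoTermIsoZero T).inv
  | 1 => (twoTermIsoOne S).hom ≫ φ.τ₁ ≫ (twoTermIsoOne T).inv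
  | _ + 2 => 0

/-- The map of two-term complexes induced by a morphism of short complexes. -/
def twoTermMap {S T : ShortComplex A} (φ : S ⟶ T) : twoTerm S ⟶ twoTerm T :=
  ChainComplex.ofHom (twoTermMapF φ) (by
    rintro (_ | n)
    · change twoTermMapF φ 1 ≫ (twoTerm T).d 1 0 = (twoTerm S).d 1 0 ≫ twoTermMapF φ 0
      rw [← cancel_mono (twoTermIsoZero T).hom]
      simp [twoTermMapF, twoTerm_d, reassoc_of% (twoTerm_d S), φ.comm₁₂]
    · exact (twoTerm_isZero S n).eq_of_src _ _)

/-- The augmentation of the two-term complex. -/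
def twoTermπ (S : ShortComplex A) : twoTerm S ⟶ (ChainComplex.single₀ A).obj S.X₃ :=
  (ChainComplex.toSingle₀Equiv _ _).symm ⟨(twoTermIsoZero S).hom ≫ S.g, by
    rw [reassoc_of% (twoTerm_d S), S.zero, comp_zero]⟩

theorem twoTermπ_f_zero (S : ShortComplex A) :
    (twoTermπ S).f 0 = (twoTermIsoZero S).hom ≫ S.g :=
  ChainComplex.toSingle₀Equiv_symm_apply_f_zero _ _

/-- A short exact sequence with projective middle and left terms is a projective resolution of its
right term. -/
def twoTermResolution (S : ShortComplex A) (hS : S.ShortExact) [Projective S.X₁] [Projective S.X₂] :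
    ProjectiveResolution S.X₃ where
  complex := twoTerm S
  projective := by
    rintro (_ | _ | n)
    · exact Projective.of_iso (twoTermIsoZero S).symm inferInstance
    · exact Projective.of_iso (twoTermIsoOne S).symm inferInstance
    · exact (twoTerm_isZero S n).projective
  π := twoTermπ S
  quasiIso := ⟨fun n => by
    have := hS.mono_f
    have := hS.epi_g
    -- In degree 0 the claim is exactness at `S.X₂` together with surjectivity of `S.g`; in degree 1
    -- it is injectivity of `S.f`; above, all terms vanish.
    cases n with
    | zero =>
      rw [ChainComplex.quasiIsoAt₀_iff, ShortComplex.quasiIso_iff_of_zeros']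
      · refine (ShortComplex.exact_and_epi_g_iff_of_iso ?_).2 ⟨hS.exact, hS.epi_g⟩
        exact ShortComplex.isoMk (twoTermIsoOne S) (twoTermIsoZero S) (Iso.refl _)
          (twoTerm_d S).symm ((twoTermπ_f_zero S).symm.trans (Category.comp_id _).symm)
      all_goals rfl
    | succ n =>
      rw [quasiIsoAt_iff_exactAt']
      · rw [HomologicalComplex.exactAt_iff' _ (n + 2) (n + 1) n (by simp) (by simp)]
        cases n with
        | zero =>
          have h : Mono ((twoTerm S).d 1 0) := by
            have : Mono ((twoTerm S).d 1 0 ≫ (twoTermIsoZero S).hom) := by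
              rw [twoTerm_d]; infer_instance
            exact mono_of_mono _ (twoTermIsoZero S).hom
          rw [ShortComplex.exact_iff_mono]
          · exact h
          · exact (twoTerm_isZero S 0).eq_of_src _ _
        | succ n => exact ShortComplex.exact_of_isZero_X₂ _ (twoTerm_isZero S n)
      · apply ChainComplex.exactAt_succ_single_obj⟩

variable {D : Type*} [Category* D] [Abelian D]

/-- The image of the two-term complex under an additive functor. -/
abbrev mapTwoTerm (F : A ⥤ D) [F.Additive] (S : ShortComplex A) : ChainComplex D ℕ :=
  (F.mapHomologicalComplex (ComplexShape.down ℕ)).obj (twoTerm S)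

theorem mapTwoTerm_d_eq_zero (F : A ⥤ D) [F.Additive] (S : ShortComplex A) :
    (mapTwoTerm F S).d 2 1 = 0 :=
  (F.map_isZero (twoTerm_isZero S 0)).eq_of_src _ _

/-- The degree-one term of `mapTwoTerm`. -/
def mapTwoTermIsoOne (F : A ⥤ D) [F.Additive] (S : ShortComplex A) :
    (mapTwoTerm F S).X 1 ≅ F.obj S.X₁ := F.mapIso (twoTermIsoOne S)

/-- The degree-zero term of `mapTwoTerm`. -/
def mapTwoTermIsoZero (F : A ⥤ D) [F.Additive] (S : ShortComplex A) :
    (mapTwoTerm F S).X 0 ≅ F.obj S.X₂ := F.mapIso (twoTermIsoZero S)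

theorem mapTwoTerm_d (F : A ⥤ D) [F.Additive] (S : ShortComplex A) :
    (mapTwoTerm F S).d 1 0 ≫ (mapTwoTermIsoZero F S).hom =
      (mapTwoTermIsoOne F S).hom ≫ F.map S.f := by
  have := congrArg F.map (twoTerm_d S)
  rwa [F.map_comp, F.map_comp] at this

/-- The first homology of the two-term complex is the module of cycles. -/
def mapTwoTermHomologyIso (F : A ⥤ D) [F.Additive] (S : ShortComplex A) :
    (mapTwoTerm F S).cycles 1 ≅ (mapTwoTerm F S).homology 1 :=
  (mapTwoTerm F S).isoHomologyπ 2 1 (by simp) (mapTwoTerm_d_eq_zero F S)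

theorem mapTwoTermHomologyIso_inv_naturality (F G : A ⥤ D) [F.Additive] [G.Additive]
    (S T : ShortComplex A) (φ : mapTwoTerm F S ⟶ mapTwoTerm G T) :
    HomologicalComplex.homologyMap φ 1 ≫ (mapTwoTermHomologyIso G T).inv =
      (mapTwoTermHomologyIso F S).inv ≫ HomologicalComplex.cyclesMap φ 1 := by
  rw [Iso.comp_inv_eq, Category.assoc, Iso.eq_inv_comp]
  exact (HomologicalComplex.homologyπ_naturality φ 1)

variable [HasProjectiveResolutions A]

/-- The isomorphism between the first left derived functor at `S.X₃` and the homology of the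
two-term complex. -/
def leftDerivedOneIso (F : A ⥤ D) [F.Additive] (S : ShortComplex A) (hS : S.ShortExact)
    [Projective S.X₁] [Projective S.X₂] :
    (F.leftDerived 1).obj S.X₃ ≅ (mapTwoTerm F S).homology 1 :=
  (twoTermResolution S hS).isoLeftDerivedObj F 1

/-- The embedding of the first left derived functor at `S.X₃` into `F.obj S.X₁`. -/
def leftDerivedOneι (F : A ⥤ D) [F.Additive] (S : ShortComplex A) (hS : S.ShortExact)
    [Projective S.X₁] [Projective S.X₂] : (F.leftDerived 1).obj S.X₃ ⟶ F.obj S.X₁ :=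
  (leftDerivedOneIso F S hS).hom ≫ (mapTwoTermHomologyIso F S).inv ≫
    (mapTwoTerm F S).iCycles 1 ≫ (mapTwoTermIsoOne F S).hom

variable (F G : A ⥤ D) [F.Additive] [G.Additive] (S T : ShortComplex A)
  (hS : S.ShortExact) (hT : T.ShortExact)
  [Projective S.X₁] [Projective S.X₂] [Projective T.X₁] [Projective T.X₂]

instance mono_leftDerivedOneι : Mono (leftDerivedOneι F S hS) := by
  unfold leftDerivedOneι
  infer_instance

theorem leftDerivedOneι_comp : leftDerivedOneι F S hS ≫ F.map S.f = 0 := by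
  rw [leftDerivedOneι, Category.assoc, Category.assoc, Category.assoc, ← mapTwoTerm_d,
    HomologicalComplex.iCycles_d_assoc, zero_comp, comp_zero, comp_zero]

/-- The resolution has no term in degree two, so its first homology after applying `F` is the module
of cycles, the kernel of `F.map S.f`. This turns Tor into a concrete kernel that can be compared
with chains. -/
theorem exact_leftDerivedOneι :
    (ShortComplex.mk (leftDerivedOneι F S hS) (F.map S.f) (leftDerivedOneι_comp F S hS)).Exact := by
  let K := mapTwoTerm F S
  have h : (ShortComplex.mk (K.iCycles 1) (K.d 1 0) (K.iCycles_d 1 0)).Exact :=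
    ShortComplex.exact_of_f_is_kernel _ (K.cyclesIsKernel 1 0 (by simp))
  refine (ShortComplex.exact_iff_of_iso ?_).1 h
  exact ShortComplex.isoMk (mapTwoTermHomologyIso F S ≪≫ (leftDerivedOneIso F S hS).symm)
    (mapTwoTermIsoOne F S) (mapTwoTermIsoZero F S)
    (by simp [leftDerivedOneι, K]) (mapTwoTerm_d F S).symm

/-- The morphism `φ` itself provides a lift of `φ.τ₃` to the two resolutions, and derived functors
may be computed with any lift. -/
theorem leftDerivedOneι_map (φ : S ⟶ T) :
    (F.leftDerived 1).map φ.τ₃ ≫ leftDerivedOneι F T hT =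
      leftDerivedOneι F S hS ≫ F.map φ.τ₁ := by
  have comm : (twoTermMap φ).f 0 ≫ (twoTermIsoZero T).hom ≫ T.g =
      ((twoTermIsoZero S).hom ≫ S.g) ≫ φ.τ₃ := by
    change ((twoTermIsoZero S).hom ≫ φ.τ₂ ≫ (twoTermIsoZero T).inv) ≫ _ = _
    simp [φ.comm₂₃]
  rw [← twoTermπ_f_zero T, ← twoTermπ_f_zero S] at comm
  have h : (F.leftDerived 1).map φ.τ₃ ≫ (leftDerivedOneIso F T hT).hom =
      (leftDerivedOneIso F S hS).hom ≫ HomologicalComplex.homologyMap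
        ((F.mapHomologicalComplex _).map (twoTermMap φ)) 1 :=
    ProjectiveResolution.isoLeftDerivedObj_hom_naturality φ.τ₃ (twoTermResolution S hS)
      (twoTermResolution T hT) (twoTermMap φ) comm F 1
  have h1 : ((F.mapHomologicalComplex _).map (twoTermMap φ)).f 1 ≫ (mapTwoTermIsoOne F T).hom =
      (mapTwoTermIsoOne F S).hom ≫ F.map φ.τ₁ := by
    change F.map ((twoTermIsoOne S).hom ≫ φ.τ₁ ≫ (twoTermIsoOne T).inv) ≫
      F.map (twoTermIsoOne T).hom = F.map (twoTermIsoOne S).hom ≫ _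
    rw [← F.map_comp, ← F.map_comp]
    simp
  rw [leftDerivedOneι, leftDerivedOneι, reassoc_of% h,
    reassoc_of% (mapTwoTermHomologyIso_inv_naturality F F S T),
    HomologicalComplex.cyclesMap_i_assoc, h1]
  simp only [Category.assoc]

theorem leftDerivedOneι_app (α : F ⟶ G) :
    (NatTrans.leftDerived α 1).app S.X₃ ≫ leftDerivedOneι G S hS =
      leftDerivedOneι F S hS ≫ α.app S.X₁ := by
  have h : (NatTrans.leftDerived α 1).app S.X₃ ≫ (leftDerivedOneIso G S hS).hom =
      (leftDerivedOneIso F S hS).hom ≫ HomologicalComplex.homologyMap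
        ((NatTrans.mapHomologicalComplex α _).app (twoTerm S)) 1 := by
    rw [← Iso.eq_comp_inv, Category.assoc]
    exact ProjectiveResolution.leftDerived_app_eq α (twoTermResolution S hS) 1
  have h1 : ((NatTrans.mapHomologicalComplex α _).app (twoTerm S)).f 1 ≫
      (mapTwoTermIsoOne G S).hom = (mapTwoTermIsoOne F S).hom ≫ α.app S.X₁ :=
    (α.naturality (twoTermIsoOne S).hom).symm
  rw [leftDerivedOneι, leftDerivedOneι, reassoc_of% h,
    reassoc_of% (mapTwoTermHomologyIso_inv_naturality F G S S),
    HomologicalComplex.cyclesMap_i_assoc, h1]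
  simp only [Category.assoc]

end TwoTerm

/-! ### Tor of a quotient of projective objects -/

section Tor

variable {A : Type*} [Category* A] [Abelian A] [MonoidalCategory A] [MonoidalPreadditive A]
  [HasProjectiveResolutions A] (M N : A) (S T : ShortComplex A) (hS : S.ShortExact)
  (hT : T.ShortExact)
  [Projective S.X₁] [Projective S.X₂] [Projective T.X₁] [Projective T.X₂]

/-- The embedding `Tor(M, Z / B) ⟶ M ⊗ B`. -/
def torι : ((Tor A 1).obj M).obj S.X₃ ⟶ M ⊗ S.X₁ :=
  leftDerivedOneι ((tensoringLeft A).obj M) S hS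

instance mono_torι : Mono (torι M S hS) :=
  inferInstanceAs (Mono (leftDerivedOneι ((tensoringLeft A).obj M) S hS))

theorem torι_comp : torι M S hS ≫ M ◁ S.f = 0 :=
  leftDerivedOneι_comp ((tensoringLeft A).obj M) S hS

theorem exact_torι : (ShortComplex.mk (torι M S hS) (M ◁ S.f) (torι_comp M S hS)).Exact :=
  exact_leftDerivedOneι ((tensoringLeft A).obj M) S hS

/-- Only the second variable is resolved. A map in the first variable is thus a natural
transformation of the derived functor, while a map in the second is a map of resolutions; the two
cases are composed. -/
theorem torι_naturality {M N : A} {S T : ShortComplex A} (hS : S.ShortExact) (hT : T.ShortExact)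
    [Projective S.X₁] [Projective S.X₂] [Projective T.X₁] [Projective T.X₂]
    (a : M ⟶ N) (φ : S ⟶ T) :
    (((Tor A 1).map a).app S.X₃ ≫ ((Tor A 1).obj N).map φ.τ₃) ≫ torι N T hT =
      torι M S hS ≫ (a ⊗ₘ φ.τ₁) := by
  have h1 : ((Tor A 1).map a).app S.X₃ ≫ torι N S hS = torι M S hS ≫ a ▷ S.X₁ :=
    leftDerivedOneι_app _ _ S hS ((tensoringLeft A).map a)
  have h2 : ((Tor A 1).obj N).map φ.τ₃ ≫ torι N T hT = torι N S hS ≫ N ◁ φ.τ₁ :=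
    leftDerivedOneι_map ((tensoringLeft A).obj N) S T hS hT φ
  rw [Category.assoc, h2, reassoc_of% h1, MonoidalCategory.tensorHom_def]

end Tor

end RegularKunneth

end

noncomputable section

namespace RegularKunneth

open TensorProduct

/-! ### Auxiliary linear algebra -/

section LinearAlgebra

variable {R : Type*} [CommRing R] {W X Y Z : Type*} [AddCommGroup W] [Module R W]
  [AddCommGroup X] [Module R X] [AddCommGroup Y] [Module R Y] [AddCommGroup Z] [Module R Z]

/-- The lift of a linear map along an injective linear map that contains its range. -/
def liftOfInjective (a : X →ₗ[R] Y) (ha : Function.Injective a) (b : W →ₗ[R] Y)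
    (hb : ∀ w, ∃ x, a x = b w) : W →ₗ[R] X :=
  (LinearEquiv.ofInjective a ha).symm.toLinearMap ∘ₗ b.codRestrict (LinearMap.range a) hb

theorem liftOfInjective_spec (a : X →ₗ[R] Y) (ha : Function.Injective a) (b : W →ₗ[R] Y)
    (hb : ∀ w, ∃ x, a x = b w) (w : W) : a (liftOfInjective a ha b hb w) = b w := by
  have := congrArg Subtype.val ((LinearEquiv.ofInjective a ha).apply_symm_apply
    (b.codRestrict (LinearMap.range a) hb w))
  exact this

/-- The map induced by `t` on the target of a surjective linear map `s` with `ker s ≤ ker t`. -/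
def descOfSurjective (s : X →ₗ[R] Y) (hs : Function.Surjective s) (t : X →ₗ[R] Z)
    (h : ∀ x, s x = 0 → t x = 0) : Y →ₗ[R] Z :=
  (LinearMap.ker s).liftQ t h ∘ₗ (s.quotKerEquivOfSurjective hs).symm.toLinearMap

theorem descOfSurjective_spec (s : X →ₗ[R] Y) (hs : Function.Surjective s) (t : X →ₗ[R] Z)
    (h : ∀ x, s x = 0 → t x = 0) (x : X) : descOfSurjective s hs t h (s x) = t x := by
  have : (s.quotKerEquivOfSurjective hs).symm (s x) = (LinearMap.ker s).mkQ x := by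
    rw [LinearEquiv.symm_apply_eq]
    rfl
  rw [descOfSurjective, LinearMap.comp_apply, LinearEquiv.coe_coe, this]
  exact Submodule.liftQ_apply _ _ _

theorem rTensor_lTensor_comm (f : W →ₗ[R] X) (g : Y →ₗ[R] Z) (t : W ⊗[R] Y) :
    f.rTensor Z (g.lTensor W t) = g.lTensor X (f.rTensor Y t) := by
  rw [← LinearMap.comp_apply, ← LinearMap.comp_apply, LinearMap.rTensor_comp_lTensor,
    LinearMap.lTensor_comp_rTensor]

theorem map_eq_rTensor_lTensor (f : W →ₗ[R] X) (g : Y →ₗ[R] Z) (t : W ⊗[R] Y) :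
    TensorProduct.map f g t = f.rTensor Z (g.lTensor W t) := by
  rw [← LinearMap.comp_apply, LinearMap.rTensor_comp_lTensor]

theorem map_eq_lTensor_rTensor (f : W →ₗ[R] X) (g : Y →ₗ[R] Z) (t : W ⊗[R] Y) :
    TensorProduct.map f g t = g.lTensor X (f.rTensor Y t) := by
  rw [← LinearMap.comp_apply, LinearMap.lTensor_comp_rTensor]

end LinearAlgebra

/-! ### Cycles, boundaries and homology of complexes of modules -/

section Elements

variable {R : Type u} [CommRing R]

/-- An element is a map out of `R`, so the universal property of the biproduct applies to it. -/
theorem biproduct_ext_zero {ι : Type} [Finite ι] (M : ι → ModuleCat.{u} R) (x : (⨁ M : ModuleCat R))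
    (h : ∀ i, (biproduct.π M i).hom x = 0) : x = 0 := by
  have h1 : ModuleCat.ofHom (LinearMap.toSpanSingleton R _ x) = 0 :=
    biproduct.hom_ext _ _ fun i => ModuleCat.hom_ext (LinearMap.ext_ring (by simpa using h i))
  simpa using congrArg (fun φ : ModuleCat.of R R ⟶ ⨁ M => φ.hom (1 : R)) h1

variable (K L : ChainComplex (ModuleCat.{u} R) ℕ) (n : ℕ)

theorem iCycles_injective : Function.Injective (K.iCycles n).hom :=
  (ModuleCat.mono_iff_injective _).1 inferInstance

theorem homologyπ_surjective : Function.Surjective (K.homologyπ n).hom :=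
  (ModuleCat.epi_iff_surjective _).1 inferInstance

theorem homologyι_injective : Function.Injective (K.homologyι n).hom :=
  (ModuleCat.mono_iff_injective _).1 inferInstance

theorem pOpcycles_surjective : Function.Surjective (K.pOpcycles n).hom :=
  (ModuleCat.epi_iff_surjective _).1 inferInstance

/-- The truncated `n - 1` gives a statement uniform in `n`: for `n = 0` the map is `d 0 0 = 0`, and
indeed every chain of degree 0 is a cycle. -/
theorem exact_iCycles_d : Function.Exact (K.iCycles n).hom (K.d n (n - 1)).hom := by
  refine (ShortComplex.ShortExact.moduleCat_exact_iff_function_exact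
    (ShortComplex.mk (K.iCycles n) (K.d n (n - 1)) (K.iCycles_d _ _))).1 ?_
  cases n with
  | zero =>
    have h : K.d 0 (0 - 1) = 0 := K.shape _ _ (by simp)
    rw [ShortComplex.exact_iff_epi _ h]
    have := K.isIso_iCycles 0 0 (by simp) (K.shape _ _ (by simp))
    exact inferInstanceAs (Epi (K.iCycles 0))
  | succ n => exact ShortComplex.exact_of_f_is_kernel _ (K.cyclesIsKernel (n + 1) n (by simp))

theorem exact_toCycles_homologyπ :
    Function.Exact (K.toCycles (n + 1) n).hom (K.homologyπ n).hom :=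
  (ShortComplex.ShortExact.moduleCat_exact_iff_function_exact
    (ShortComplex.mk (K.toCycles (n + 1) n) (K.homologyπ n) (K.toCycles_comp_homologyπ _ _))).1
    (ShortComplex.exact_of_g_is_cokernel _ (K.homologyIsCokernel (n + 1) n (by simp)))

theorem exact_d_pOpcycles : Function.Exact (K.d (n + 1) n).hom (K.pOpcycles n).hom :=
  (ShortComplex.ShortExact.moduleCat_exact_iff_function_exact
    (ShortComplex.mk (K.d (n + 1) n) (K.pOpcycles n) (K.d_pOpcycles _ _))).1
    (ShortComplex.exact_of_g_is_cokernel _ (K.opcyclesIsCokernel (n + 1) n (by simp)))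

theorem exists_cycle (z : K.X n) (h : ∀ m, n = m + 1 → (K.d n m).hom z = 0) :
    ∃ c : K.cycles n, (K.iCycles n).hom c = z := by
  refine (exact_iCycles_d K n z).1 ?_
  cases n with
  | zero => rw [K.shape 0 (0 - 1) (by simp)]; rfl
  | succ n => exact h n rfl

/-- The boundaries. -/
def bdry : ModuleCat.{u} R := kernel (K.homologyπ n)

/-- The inclusion of the boundaries into the cycles. -/
def bdryι : bdry K n ⟶ K.cycles n := kernel.ι _

/-- The differential, as a map onto the boundaries. -/
def toBdry : K.X (n + 1) ⟶ bdry K n :=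
  kernel.lift _ (K.toCycles (n + 1) n) (K.toCycles_comp_homologyπ _ _)

instance mono_bdryι : Mono (bdryι K n) :=
  equalizer.ι_mono

theorem toBdry_bdryι : toBdry K n ≫ bdryι K n = K.toCycles (n + 1) n :=
  kernel.lift_ι _ _ _

/-- The short complex `bdry ⟶ cycles ⟶ homology`. -/
@[simps]
def cycleSeq : ShortComplex (ModuleCat.{u} R) :=
  ShortComplex.mk (bdryι K n) (K.homologyπ n) (kernel.condition _)

theorem cycleSeq_shortExact : (cycleSeq K n).ShortExact where
  exact := ShortComplex.exact_kernel (K.homologyπ n)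
  mono_f := mono_bdryι _ _
  epi_g := inferInstanceAs (Epi (K.homologyπ n))

theorem bdryι_injective : Function.Injective (bdryι K n).hom :=
  (ModuleCat.mono_iff_injective _).1 inferInstance

theorem exact_bdryι_homologyπ : Function.Exact (bdryι K n).hom (K.homologyπ n).hom :=
  (ShortComplex.ShortExact.moduleCat_exact_iff_function_exact _).1 (cycleSeq_shortExact K n).exact

theorem toBdry_surjective : Function.Surjective (toBdry K n).hom := by
  intro b
  obtain ⟨x, hx⟩ := (exact_toCycles_homologyπ K n ((bdryι K n).hom b)).1
    ((exact_bdryι_homologyπ K n).apply_apply_eq_zero b)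
  refine ⟨x, bdryι_injective K n ?_⟩
  rw [← hx, ← toBdry_bdryι]
  rfl

variable {K L}

/-- The map induced on boundaries. -/
def bdryMap (φ : K ⟶ L) : bdry K n ⟶ bdry L n :=
  kernel.map _ _ (HomologicalComplex.cyclesMap φ n) (HomologicalComplex.homologyMap φ n)
    (HomologicalComplex.homologyπ_naturality φ n)

theorem bdryMap_ι (φ : K ⟶ L) :
    bdryMap n φ ≫ bdryι L n = bdryι K n ≫ HomologicalComplex.cyclesMap φ n :=
  kernel.lift_ι _ _ _

theorem toBdry_bdryMap (φ : K ⟶ L) :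
    toBdry K n ≫ bdryMap n φ = φ.f (n + 1) ≫ toBdry L n := by
  rw [← cancel_mono (bdryι L n), Category.assoc, bdryMap_ι, reassoc_of% (toBdry_bdryι K n),
    Category.assoc, toBdry_bdryι]
  rw [← cancel_mono (L.iCycles n)]
  simp

/-- The map induced on `cycleSeq`. -/
@[simps]
def cycleSeqMap (φ : K ⟶ L) : cycleSeq K n ⟶ cycleSeq L n where
  τ₁ := bdryMap n φ
  τ₂ := HomologicalComplex.cyclesMap φ n
  τ₃ := HomologicalComplex.homologyMap φ n
  comm₁₂ := bdryMap_ι n φ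
  comm₂₃ := (HomologicalComplex.homologyπ_naturality φ n).symm

end Elements

/-! ### Complexes of projective modules over a principal ideal domain -/

section Projective

variable {R : Type u} [CommRing R]

/-- Degreewise projective complexes of modules. -/
class IsProjectiveComplex (K : ChainComplex (ModuleCat.{u} R) ℕ) : Prop where
  projective : ∀ n, Module.Projective R (K.X n)

attribute [instance] IsProjectiveComplex.projective

variable [IsDomain R] [IsPrincipalIdealRing R] (K : ChainComplex (ModuleCat.{u} R) ℕ)
  [IsProjectiveComplex K] (n : ℕ)

instance projective_cycles : Module.Projective R (K.cycles n) :=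
  projective_of_injective _ (iCycles_injective K n)

instance projective_bdry : Module.Projective R (bdry K n) :=
  projective_of_injective _ (bdryι_injective K n)

instance projective_cycleSeq_one : Projective (cycleSeq K n).X₁ :=
  (IsProjective.iff_projective _).1 (projective_bdry K n)

instance projective_cycleSeq_two : Projective (cycleSeq K n).X₂ :=
  (IsProjective.iff_projective _).1 (projective_cycles K n)

/-- Boundaries embed in the projective module of chains, so they are projective and the surjection
onto them splits. -/
theorem exists_section_toBdry :
    ∃ σ : bdry K n →ₗ[R] K.X (n + 1), (toBdry K n).hom ∘ₗ σ = LinearMap.id :=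
  Module.projective_lifting_property _ _ (toBdry_surjective K n)

/-- With `σ` a section of the differential onto the boundaries, `z - σ (d z)` is a cycle, equal to
`z` when `z` is one. The retraction pulls identities in `M ⊗ K_n` back to `M ⊗ Z_n`. -/
theorem exists_retraction_iCycles :
    ∃ ρ : K.X n →ₗ[R] K.cycles n, ρ ∘ₗ (K.iCycles n).hom = LinearMap.id := by
  cases n with
  | zero =>
    have := K.isIso_iCycles 0 0 (by simp) (K.shape _ _ (by simp))
    exact ⟨(inv (K.iCycles 0)).hom, by rw [← ModuleCat.hom_comp, IsIso.hom_inv_id]; rfl⟩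
  | succ n =>
    obtain ⟨σ, hσ⟩ := exists_section_toBdry K n
    have key (z : K.X (n + 1)) : (K.d (n + 1) n).hom z =
        (K.iCycles n).hom ((bdryι K n).hom ((toBdry K n).hom z)) := by
      rw [← K.toCycles_i, ← toBdry_bdryι]
      rfl
    refine ⟨liftOfInjective _ (iCycles_injective K (n + 1)) (LinearMap.id - σ ∘ₗ (toBdry K n).hom)
      fun z => ?_, ?_⟩
    · refine exists_cycle K (n + 1) _ fun m hm => ?_
      obtain rfl : n = m := by omega
      have : (toBdry K n).hom (σ ((toBdry K n).hom z)) = (toBdry K n).hom z :=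
        LinearMap.congr_fun hσ _
      rw [key]
      simp [this]
    · refine LinearMap.ext fun z => iCycles_injective K (n + 1) ?_
      have h0 : (toBdry K n).hom ((K.iCycles (n + 1)).hom z) = 0 := by
        apply bdryι_injective K n
        apply iCycles_injective K n
        rw [← key, map_zero, map_zero]
        exact (exact_iCycles_d K (n + 1)).apply_apply_eq_zero z
      rw [LinearMap.comp_apply, liftOfInjective_spec]
      simp [h0]

end Projective

end RegularKunneth

end

noncomputable section

namespace RegularKunneth

open TensorProduct

/-! ### The Künneth short exact sequence -/

variable {R : Type u} [CommRing R]

/-- The identification of the complex `J` with the tensor product of the complexes `C` and `C'`,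
given by the components `Jₙ ⟶ Cₚ ⊗ C'_q`, `p + q = n`. -/
structure TensorData (C C' J : ChainComplex (ModuleCat.{u} R) ℕ) where
  comp : ∀ {p q n : ℕ}, p + q = n → (J.X n →ₗ[R] C.X p ⊗[R] C'.X q)
  eq_zero : ∀ {n : ℕ} (z : J.X n), (∀ p q (h : p + q = n), comp h z = 0) → z = 0
  exists_comp : ∀ {n : ℕ} (w : ∀ p q, p + q = n → C.X p ⊗[R] C'.X q),
    ∃ z, ∀ p q (h : p + q = n), comp h z = w p q h
  comp_d : ∀ {p q n : ℕ} (h : p + q = n) (z : J.X (n + 1)), comp h ((J.d (n + 1) n).hom z) =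
    (C.d (p + 1) p).hom.rTensor (C'.X q) (comp (p := p + 1) (q := q) (by omega) z) +
      (-1 : R) ^ p • (C'.d (q + 1) q).hom.lTensor (C.X p)
        (comp (p := p) (q := q + 1) (by omega) z)

-- Elements of the tensor and Tor terms by components

section Terms

variable (C : ChainComplex (ModuleCat.{u} R) ℕ × ChainComplex (ModuleCat.{u} R) ℕ) {n : ℕ}
  {W : Type u} [AddCommGroup W] [Module R W]

/-- The projections of `tensorTerm`. -/
def tensorTermProj (i : {i : ℕ × ℕ // i.1 + i.2 = n}) :
    (tensorTerm R n).obj C →ₗ[R] C.1.homology i.1.1 ⊗[R] C.2.homology i.1.2 :=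
  (biproduct.π (fun i : {i : ℕ × ℕ // i.1 + i.2 = n} =>
    MonoidalCategory.tensorObj (C.1.homology i.1.1) (C.2.homology i.1.2)) i).hom

/-- The map into `tensorTerm` with given components. -/
def tensorTermLift (φ : ∀ i : {i : ℕ × ℕ // i.1 + i.2 = n},
    W →ₗ[R] C.1.homology i.1.1 ⊗[R] C.2.homology i.1.2) : W →ₗ[R] (tensorTerm R n).obj C :=
  (biproduct.lift fun i : {i : ℕ × ℕ // i.1 + i.2 = n} => (ModuleCat.ofHom (φ i) :
    ModuleCat.of R W ⟶ MonoidalCategory.tensorObj (C.1.homology i.1.1) (C.2.homology i.1.2))).hom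

theorem tensorTermProj_lift (φ : ∀ i : {i : ℕ × ℕ // i.1 + i.2 = n},
    W →ₗ[R] C.1.homology i.1.1 ⊗[R] C.2.homology i.1.2) (i) (w : W) :
    tensorTermProj C i (tensorTermLift C φ w) = φ i w :=
  congrArg (fun f => f.hom w) (biproduct.lift_π
    (fun i : {i : ℕ × ℕ // i.1 + i.2 = n} => (ModuleCat.ofHom (φ i) : ModuleCat.of R W ⟶
      MonoidalCategory.tensorObj (C.1.homology i.1.1) (C.2.homology i.1.2))) i)

variable {C} in
theorem tensorTermProj_ext {x y : (tensorTerm R n).obj C}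
    (h : ∀ i, tensorTermProj C i x = tensorTermProj C i y) : x = y :=
  sub_eq_zero.1 (biproduct_ext_zero _ _ fun i => (map_sub (tensorTermProj C i) x y).trans
    (sub_eq_zero.2 (h i)))

theorem tensorTermProj_map {C C₁ : ChainComplex (ModuleCat.{u} R) ℕ × ChainComplex (ModuleCat R) ℕ}
    (φ : C ⟶ C₁) (i : {i : ℕ × ℕ // i.1 + i.2 = n}) (x : (tensorTerm R n).obj C) :
    tensorTermProj C₁ i (((tensorTerm R n).map φ).hom x) =
      TensorProduct.map (HomologicalComplex.homologyMap φ.1 i.1.1).hom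
        (HomologicalComplex.homologyMap φ.2 i.1.2).hom (tensorTermProj C i x) :=
  congrArg (fun f => f.hom x) (biproduct.map_π
    (fun i : {i : ℕ × ℕ // i.1 + i.2 = n} => MonoidalCategory.tensorHom
      (HomologicalComplex.homologyMap φ.1 i.1.1) (HomologicalComplex.homologyMap φ.2 i.1.2)) i)

theorem tensorTermProj_tensorClass (p q : ℕ) (x : C.1.cycles p) (y : C.2.cycles q) :
    tensorTermProj C ⟨(p, q), rfl⟩ (tensorClass R C p q x y) =
      (C.1.homologyπ p).hom x ⊗ₜ (C.2.homologyπ q).hom y :=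
  congrArg (fun f => f.hom ((C.1.homologyπ p).hom x ⊗ₜ[R] (C.2.homologyπ q).hom y))
    (biproduct.ι_π_self (fun i : {i : ℕ × ℕ // i.1 + i.2 = p + q} =>
      MonoidalCategory.tensorObj (C.1.homology i.1.1) (C.2.homology i.1.2)) ⟨(p, q), rfl⟩)

theorem tensorTermProj_tensorClass_of_ne (p q : ℕ) (x : C.1.cycles p) (y : C.2.cycles q)
    (i : {i : ℕ × ℕ // i.1 + i.2 = p + q}) (hi : i.1 ≠ (p, q)) :
    tensorTermProj C i (tensorClass R C p q x y) = 0 :=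
  congrArg (fun f => f.hom ((C.1.homologyπ p).hom x ⊗ₜ[R] (C.2.homologyπ q).hom y))
    (biproduct.ι_π_ne (fun i : {i : ℕ × ℕ // i.1 + i.2 = p + q} =>
      MonoidalCategory.tensorObj (C.1.homology i.1.1) (C.2.homology i.1.2))
      (j := ⟨(p, q), rfl⟩) (j' := i) (fun h => hi (congrArg Subtype.val h).symm))

/-- The projections of `torTerm`. -/
def torTermProj (i : {i : ℕ × ℕ // i.1 + i.2 + 1 = n}) : (torTerm R n).obj C →ₗ[R]
    ((Tor (ModuleCat.{u} R) 1).obj (C.1.homology i.1.1)).obj (C.2.homology i.1.2) :=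
  (biproduct.π (fun i : {i : ℕ × ℕ // i.1 + i.2 + 1 = n} =>
    ((Tor (ModuleCat.{u} R) 1).obj (C.1.homology i.1.1)).obj (C.2.homology i.1.2)) i).hom

/-- The map into `torTerm` with given components. -/
def torTermLift (φ : ∀ i : {i : ℕ × ℕ // i.1 + i.2 + 1 = n},
    W →ₗ[R] ((Tor (ModuleCat.{u} R) 1).obj (C.1.homology i.1.1)).obj (C.2.homology i.1.2)) :
    W →ₗ[R] (torTerm R n).obj C :=
  (biproduct.lift fun i : {i : ℕ × ℕ // i.1 + i.2 + 1 = n} => (ModuleCat.ofHom (φ i) :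
    ModuleCat.of R W ⟶
      ((Tor (ModuleCat.{u} R) 1).obj (C.1.homology i.1.1)).obj (C.2.homology i.1.2))).hom

theorem torTermProj_lift (φ : ∀ i : {i : ℕ × ℕ // i.1 + i.2 + 1 = n},
    W →ₗ[R] ((Tor (ModuleCat.{u} R) 1).obj (C.1.homology i.1.1)).obj (C.2.homology i.1.2))
    (i) (w : W) : torTermProj C i (torTermLift C φ w) = φ i w :=
  congrArg (fun f => f.hom w) (biproduct.lift_π
    (fun i : {i : ℕ × ℕ // i.1 + i.2 + 1 = n} => (ModuleCat.ofHom (φ i) : ModuleCat.of R W ⟶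
      ((Tor (ModuleCat.{u} R) 1).obj (C.1.homology i.1.1)).obj (C.2.homology i.1.2))) i)

variable {C} in
theorem torTermProj_ext {x y : (torTerm R n).obj C}
    (h : ∀ i, torTermProj C i x = torTermProj C i y) : x = y :=
  sub_eq_zero.1 (biproduct_ext_zero _ _ fun i => (map_sub (torTermProj C i) x y).trans
    (sub_eq_zero.2 (h i)))

theorem torTermProj_map {C C₁ : ChainComplex (ModuleCat.{u} R) ℕ × ChainComplex (ModuleCat R) ℕ}
    (φ : C ⟶ C₁) (i : {i : ℕ × ℕ // i.1 + i.2 + 1 = n}) (x : (torTerm R n).obj C) :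
    torTermProj C₁ i (((torTerm R n).map φ).hom x) =
      (((Tor (ModuleCat.{u} R) 1).map (HomologicalComplex.homologyMap φ.1 i.1.1)).app _ ≫
      ((Tor (ModuleCat.{u} R) 1).obj _).map (HomologicalComplex.homologyMap φ.2 i.1.2)).hom
        (torTermProj C i x) :=
  congrArg (fun f => f.hom x) (biproduct.map_π
    (fun i : {i : ℕ × ℕ // i.1 + i.2 + 1 = n} =>
      ((Tor (ModuleCat.{u} R) 1).map (HomologicalComplex.homologyMap φ.1 i.1.1)).app _ ≫
      ((Tor (ModuleCat.{u} R) 1).obj _).map (HomologicalComplex.homologyMap φ.2 i.1.2)) i)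

end Terms

-- Shifts of bigraded families

section Shift

variable {M : ℕ → ℕ → Type*} [∀ p q, Zero (M p q)] {n : ℕ}

/-- The family `(r (p - 1) q)`, extended by zero. -/
def shiftLeft (r : ∀ p q, p + q = n → M (p + 1) q) : ∀ p q, p + q = n + 1 → M p q
  | 0, _, _ => 0
  | p + 1, q, h => r p q (by omega)

/-- The family `(r p (q - 1))`, extended by zero. -/
def shiftRight (r : ∀ p q, p + q = n → M p (q + 1)) : ∀ p q, p + q = n + 1 → M p q
  | _, 0, _ => 0
  | p, q + 1, h => r p q (by omega)

end Shift

-- The map from tensor products of homology to the homology of the tensor product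

namespace TensorData

variable {C C' J : ChainComplex (ModuleCat.{u} R) ℕ} (D : TensorData C C' J)

section General

variable (C C')

/-- The differential of the first factor vanishes on cycles. -/
theorem d_rTensor_iCycles {M : Type*} [AddCommGroup M] [Module R M] (p : ℕ)
    (t : C.cycles (p + 1) ⊗[R] M) :
    (C.d (p + 1) p).hom.rTensor M ((C.iCycles (p + 1)).hom.rTensor M t) = 0 := by
  rw [← LinearMap.rTensor_comp_apply, ← ModuleCat.hom_comp, C.iCycles_d]
  simp

theorem d_lTensor_iCycles {M : Type*} [AddCommGroup M] [Module R M] (p : ℕ)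
    (t : M ⊗[R] C.cycles (p + 1)) :
    (C.d (p + 1) p).hom.lTensor M ((C.iCycles (p + 1)).hom.lTensor M t) = 0 := by
  rw [← LinearMap.lTensor_comp_apply, ← ModuleCat.hom_comp, C.iCycles_d]
  simp

/-- The families of tensors of cycles. -/
abbrev CycleFamily (n : ℕ) : Type u :=
  ∀ i : {i : ℕ × ℕ // i.1 + i.2 = n}, C.cycles i.1.1 ⊗[R] C'.cycles i.1.2

/-- The map onto the direct sum of tensor products of homology modules. -/
def familyClass (n : ℕ) : CycleFamily C C' n →ₗ[R] (tensorTerm R n).obj (C, C') :=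
  tensorTermLift (C, C') fun i =>
    TensorProduct.map (C.homologyπ i.1.1).hom (C'.homologyπ i.1.2).hom ∘ₗ LinearMap.proj i

theorem tensorTermProj_familyClass {n : ℕ} (w : CycleFamily C C' n)
    (i : {i : ℕ × ℕ // i.1 + i.2 = n}) :
    tensorTermProj (C, C') i (familyClass C C' n w) =
      TensorProduct.map (C.homologyπ i.1.1).hom (C'.homologyπ i.1.2).hom (w i) :=
  tensorTermProj_lift _ _ _ _

theorem familyClass_eq_zero_iff {n : ℕ} (w : CycleFamily C C' n) : familyClass C C' n w = 0 ↔
    ∀ i, TensorProduct.map (C.homologyπ i.1.1).hom (C'.homologyπ i.1.2).hom (w i) = 0 := by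
  refine ⟨fun h i => ?_, fun h => tensorTermProj_ext fun i => ?_⟩
  · rw [← tensorTermProj_familyClass, h, map_zero]
  · rw [tensorTermProj_familyClass, h, map_zero]

theorem familyClass_surjective (n : ℕ) : Function.Surjective (familyClass C C' n) := by
  intro x
  have hs (i : {i : ℕ × ℕ // i.1 + i.2 = n}) :=
    TensorProduct.map_surjective (homologyπ_surjective C i.1.1) (homologyπ_surjective C' i.1.2)
      (tensorTermProj (C, C') i x)
  choose w hw using hs
  exact ⟨w, tensorTermProj_ext fun i => (tensorTermProj_familyClass C C' w i).trans (hw i)⟩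

end General

theorem ext {n : ℕ} {z z' : J.X n} (h : ∀ p q (h : p + q = n), D.comp h z = D.comp h z') :
    z = z' :=
  sub_eq_zero.1 (D.eq_zero _ fun p q hpq => by rw [map_sub, h, sub_self])

theorem d_eq_zero_iff {n : ℕ} (z : J.X (n + 1)) : (J.d (n + 1) n).hom z = 0 ↔
    ∀ p q (h : p + q = n),
      (C.d (p + 1) p).hom.rTensor (C'.X q) (D.comp (p := p + 1) (q := q) (by omega) z) +
      (-1 : R) ^ p • (C'.d (q + 1) q).hom.lTensor (C.X p)
        (D.comp (p := p) (q := q + 1) (by omega) z) = 0 := by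
  refine ⟨fun h p q hpq => ?_, fun h => D.eq_zero _ fun p q hpq => ?_⟩
  · rw [← D.comp_d hpq, h, map_zero]
  · rw [D.comp_d hpq, h p q hpq]

/-- All components of a chain. -/
def components (n : ℕ) : J.X n →ₗ[R]
    ∀ i : {i : ℕ × ℕ // i.1 + i.2 = n}, C.X i.1.1 ⊗[R] C'.X i.1.2 :=
  LinearMap.pi fun i => D.comp i.2

theorem components_injective (n : ℕ) : Function.Injective (D.components n) := fun _ _ h =>
  D.ext fun p q hpq => congrFun h ⟨(p, q), hpq⟩

/-- The cycle with a given family of components in the tensor products of cycles. -/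
def familyCycle (n : ℕ) : CycleFamily C C' n →ₗ[R] J.cycles n :=
  liftOfInjective (D.components n ∘ₗ (J.iCycles n).hom)
    ((D.components_injective n).comp (iCycles_injective J n))
    (LinearMap.pi fun i => TensorProduct.map (C.iCycles i.1.1).hom (C'.iCycles i.1.2).hom ∘ₗ
      LinearMap.proj i) (by
      intro w
      obtain ⟨z, hz⟩ := D.exists_comp fun p q h =>
        TensorProduct.map (C.iCycles p).hom (C'.iCycles q).hom (w ⟨(p, q), h⟩)
      -- Every component lies in Z ⊗ Z', so both terms of the Leibniz rule vanish.
      obtain ⟨c, rfl⟩ := exists_cycle J n z (by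
        rintro n rfl
        rw [D.d_eq_zero_iff]
        intro p q h
        rw [hz, hz, map_eq_rTensor_lTensor, d_rTensor_iCycles, map_eq_lTensor_rTensor,
          d_lTensor_iCycles, smul_zero, add_zero])
      exact ⟨c, funext fun i => hz _ _ i.2⟩)

theorem comp_familyCycle {n : ℕ} (w : CycleFamily C C' n) {p q : ℕ} (h : p + q = n) :
    D.comp h ((J.iCycles n).hom (D.familyCycle n w)) =
      TensorProduct.map (C.iCycles p).hom (C'.iCycles q).hom (w ⟨(p, q), h⟩) :=
  congrFun (liftOfInjective_spec (D.components n ∘ₗ (J.iCycles n).hom) _ _ _ w)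
    (⟨(p, q), h⟩ : {i : ℕ × ℕ // i.1 + i.2 = n})

theorem homologyπ_eq_zero_iff {n : ℕ} (c : J.cycles n) : (J.homologyπ n).hom c = 0 ↔
    ∃ y, (J.d (n + 1) n).hom y = (J.iCycles n).hom c := by
  rw [exact_toCycles_homologyπ J n c]
  constructor
  · rintro ⟨y, rfl⟩
    exact ⟨y, by rw [← J.toCycles_i]; rfl⟩
  · rintro ⟨y, hy⟩
    refine ⟨y, iCycles_injective J n ?_⟩
    rw [← hy, ← J.toCycles_i]
    rfl

/-- The kernel of Z ⊗ Z' → H ⊗ H' is generated by Z ⊗ B' and B ⊗ Z', by right exactness, and tensors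
of either kind are boundaries. -/
theorem homologyπ_familyCycle_of_class {n : ℕ} (w : CycleFamily C C' n)
    (hw : familyClass C C' n w = 0) : (J.homologyπ n).hom (D.familyCycle n w) = 0 := by
  rw [familyClass_eq_zero_iff] at hw
  have key (p q : ℕ) (h : p + q = n) : ∃ (s : C.cycles p ⊗[R] C'.X (q + 1))
      (r : C.X (p + 1) ⊗[R] C'.cycles q), (C'.toCycles (q + 1) q).hom.lTensor _ s +
        (C.toCycles (p + 1) p).hom.rTensor _ r = w ⟨(p, q), h⟩ := by
    have hk : w ⟨(p, q), h⟩ ∈ LinearMap.ker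
        (TensorProduct.map (C.homologyπ p).hom (C'.homologyπ q).hom) := hw ⟨(p, q), h⟩
    rw [TensorProduct.map_ker (exact_toCycles_homologyπ C p) (homologyπ_surjective C p)
      (exact_toCycles_homologyπ C' q) (homologyπ_surjective C' q)] at hk
    obtain ⟨_, ⟨s, rfl⟩, _, ⟨r, rfl⟩, hsr⟩ := Submodule.mem_sup.1 hk
    exact ⟨s, r, hsr⟩
  choose s r hsr using key
  -- The bounding chain has `r p q` in bidegree `(p + 1, q)` and `s p q` in bidegree `(p, q + 1)`.
  -- The factor `(-1) ^ p` cancels the Leibniz sign; the other half of each boundary vanishes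
  -- because one tensor factor is already a cycle (`hα`, `hβ`).
  let α := shiftLeft (M := fun p q => C.X p ⊗[R] C'.X q)
    fun p q h => (C'.iCycles q).hom.lTensor _ (r p q h)
  let β := shiftRight (M := fun p q => C.X p ⊗[R] C'.X q)
    fun p q h => (-1 : R) ^ p • (C.iCycles p).hom.rTensor _ (s p q h)
  obtain ⟨y, hy⟩ := D.exists_comp fun p q h => α p q h + β p q h
  rw [homologyπ_eq_zero_iff]
  refine ⟨y, D.ext fun p q h => ?_⟩
  have hα : (C'.d (q + 1) q).hom.lTensor _ (α p (q + 1) (by omega)) = 0 := by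
    cases p with
    | zero => exact map_zero _
    | succ p => exact d_lTensor_iCycles C' q _
  have hβ : (C.d (p + 1) p).hom.rTensor _ (β (p + 1) q (by omega)) = 0 := by
    cases q with
    | zero => exact map_zero _
    | succ q =>
      change (C.d (p + 1) p).hom.rTensor _ (_ • _) = 0
      rw [map_smul, d_rTensor_iCycles C p, smul_zero]
  rw [D.comp_d h, hy, hy, map_add, map_add, hα, hβ, zero_add, add_zero, D.comp_familyCycle, ← hsr,
    map_add, add_comm]
  congr 1
  · change (-1 : R) ^ p • (C'.d (q + 1) q).hom.lTensor _ ((-1 : R) ^ p • _) = _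
    rw [map_smul, smul_smul, negOne_pow_mul_self, one_smul, map_eq_rTensor_lTensor,
      ← LinearMap.lTensor_comp_apply, ← ModuleCat.hom_comp, C'.toCycles_i, rTensor_lTensor_comm]
  · change (C.d (p + 1) p).hom.rTensor _ ((C'.iCycles q).hom.lTensor _ _) = _
    rw [map_eq_lTensor_rTensor, ← LinearMap.rTensor_comp_apply, ← ModuleCat.hom_comp, C.toCycles_i,
      rTensor_lTensor_comm]

/-- The map `⨁ H_p(C) ⊗ H_q(C') ⟶ H_n(J)`, `[x] ⊗ [y] ↦ [x ⊗ y]`. -/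
def tensorToHomology (n : ℕ) : (tensorTerm R n).obj (C, C') ⟶ J.homology n :=
  ModuleCat.ofHom (descOfSurjective (familyClass C C' n) (familyClass_surjective C C' n)
    ((J.homologyπ n).hom ∘ₗ D.familyCycle n) fun w hw => D.homologyπ_familyCycle_of_class w hw)

theorem tensorToHomology_familyClass {n : ℕ} (w : CycleFamily C C' n) :
    (D.tensorToHomology n).hom (familyClass C C' n w) =
      (J.homologyπ n).hom (D.familyCycle n w) :=
  descOfSurjective_spec _ _ _ _ w

end TensorData
end RegularKunneth

end

noncomputable section

namespace RegularKunneth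

open TensorProduct

-- Tensored identities between differentials, cycles and boundaries

section Injections

variable {R : Type u} [CommRing R] (K : ChainComplex (ModuleCat.{u} R) ℕ)

theorem lTensor_d_eq {M : Type*} [AddCommGroup M] [Module R M] (q : ℕ)
    (t : M ⊗[R] K.X (q + 1)) : (K.d (q + 1) q).hom.lTensor M t =
      (K.iCycles q).hom.lTensor M ((bdryι K q).hom.lTensor M ((toBdry K q).hom.lTensor M t)) := by
  rw [← LinearMap.lTensor_comp_apply, ← LinearMap.lTensor_comp_apply, ← ModuleCat.hom_comp,
    ← ModuleCat.hom_comp, reassoc_of% (toBdry_bdryι K q), K.toCycles_i]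

theorem lTensor_toBdry_d {M : Type*} [AddCommGroup M] [Module R M] (q : ℕ)
    (t : M ⊗[R] K.X (q + 2)) :
    (toBdry K q).hom.lTensor M ((K.d (q + 2) (q + 1)).hom.lTensor M t) = 0 := by
  have : K.d (q + 2) (q + 1) ≫ toBdry K q = 0 := by
    rw [← cancel_mono (bdryι K q), Category.assoc, toBdry_bdryι, ← cancel_mono (K.iCycles q)]
    simp
  rw [← LinearMap.lTensor_comp_apply, ← ModuleCat.hom_comp, this]
  simp

theorem lTensor_toBdry_iCycles {M : Type*} [AddCommGroup M] [Module R M] (q : ℕ)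
    (t : M ⊗[R] K.cycles (q + 1)) :
    (toBdry K q).hom.lTensor M ((K.iCycles (q + 1)).hom.lTensor M t) = 0 := by
  have : K.iCycles (q + 1) ≫ toBdry K q = 0 := by
    rw [← cancel_mono (bdryι K q), Category.assoc, toBdry_bdryι, ← cancel_mono (K.iCycles q)]
    simp
  rw [← LinearMap.lTensor_comp_apply, ← ModuleCat.hom_comp, this]
  simp

theorem rTensor_homologyπ_toCycles {M : Type*} [AddCommGroup M] [Module R M] (p : ℕ)
    (t : K.X (p + 1) ⊗[R] M) :
    (K.homologyπ p).hom.rTensor M ((K.toCycles (p + 1) p).hom.rTensor M t) = 0 := by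
  rw [← LinearMap.rTensor_comp_apply, ← ModuleCat.hom_comp, K.toCycles_comp_homologyπ]
  simp

theorem lTensor_homologyπ_bdryι {M : Type*} [AddCommGroup M] [Module R M] (p : ℕ)
    (t : M ⊗[R] bdry K p) :
    (K.homologyπ p).hom.lTensor M ((bdryι K p).hom.lTensor M t) = 0 := by
  rw [← LinearMap.lTensor_comp_apply, ← ModuleCat.hom_comp,
    show bdryι K p ≫ K.homologyπ p = 0 from (cycleSeq K p).zero]
  simp

theorem rTensor_pOpcycles_d {M : Type*} [AddCommGroup M] [Module R M] (p : ℕ)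
    (t : K.X (p + 1) ⊗[R] M) :
    (K.pOpcycles p).hom.rTensor M ((K.d (p + 1) p).hom.rTensor M t) = 0 := by
  rw [← LinearMap.rTensor_comp_apply, ← ModuleCat.hom_comp, K.d_pOpcycles]
  simp

theorem rTensor_homologyι_homologyπ {M : Type*} [AddCommGroup M] [Module R M] (p : ℕ)
    (t : K.cycles p ⊗[R] M) :
    (K.homologyι p).hom.rTensor M ((K.homologyπ p).hom.rTensor M t) =
      (K.pOpcycles p).hom.rTensor M ((K.iCycles p).hom.rTensor M t) := by
  rw [← LinearMap.rTensor_comp_apply, ← LinearMap.rTensor_comp_apply, ← ModuleCat.hom_comp,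
    ← ModuleCat.hom_comp, K.homology_π_ι]

theorem d_iCycles_apply {n m : ℕ} (c : K.cycles n) :
    (K.d n m).hom ((K.iCycles n).hom c) = 0 := by
  rw [← LinearMap.comp_apply, ← ModuleCat.hom_comp, K.iCycles_d]
  rfl

end Injections

-- The map to the Tor term and exactness of the Künneth sequence

namespace TensorData

variable {R : Type u} [CommRing R] {C C' J : ChainComplex (ModuleCat.{u} R) ℕ}
  (D : TensorData C C' J)

/-- The map `z ↦ (1 ⊗ d) z_{p, q + 1}`, modulo the boundaries of the first complex. -/
def chainToOpcycles {p q n : ℕ} (h : p + (q + 1) = n) :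
    J.X n →ₗ[R] C.opcycles p ⊗[R] bdry C' q :=
  TensorProduct.map (C.pOpcycles p).hom (toBdry C' q).hom ∘ₗ D.comp h

/-- Of the two Leibniz terms, the one with `d ⊗ 1` dies modulo the boundaries of `C`, the one with
`1 ⊗ d` dies since `d ∘ d = 0`. -/
theorem chainToOpcycles_d {p q n : ℕ} (h : p + (q + 1) = n) (z : J.X (n + 1)) :
    D.chainToOpcycles h ((J.d (n + 1) n).hom z) = 0 := by
  rw [chainToOpcycles, LinearMap.comp_apply, D.comp_d, map_add, map_smul, map_eq_lTensor_rTensor,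
    rTensor_pOpcycles_d, map_zero, zero_add, map_eq_rTensor_lTensor, lTensor_toBdry_d, map_zero,
    smul_zero]

/-- The map induced by `chainToOpcycles` on homology. -/
def homologyToOpcycles {p q n : ℕ} (h : p + (q + 1) = n) :
    J.homology n →ₗ[R] C.opcycles p ⊗[R] bdry C' q :=
  descOfSurjective (J.homologyπ n).hom (homologyπ_surjective J n)
    (D.chainToOpcycles h ∘ₗ (J.iCycles n).hom) fun c hc => by
      obtain ⟨y, hy⟩ := (homologyπ_eq_zero_iff c).1 hc
      rw [LinearMap.comp_apply, ← hy, D.chainToOpcycles_d]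

theorem homologyToOpcycles_π {p q n : ℕ} (h : p + (q + 1) = n) (c : J.cycles n) :
    D.homologyToOpcycles h ((J.homologyπ n).hom c) =
      D.chainToOpcycles h ((J.iCycles n).hom c) :=
  descOfSurjective_spec _ _ _ _ c

variable [IsDomain R] [IsPrincipalIdealRing R] [IsProjectiveComplex C']

/-- The image of a component of a chain `z` under `1 ⊗ d` consists of cycles as soon as the same
holds trivially for the boundary of `z`. -/
theorem exists_cycle_tensor {p q n : ℕ} (h : p + (q + 1) = n + 1) (z : J.X (n + 1))
    (hz : ∀ p q (h : p + (q + 1) = n),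
      (toBdry C' q).hom.lTensor _ (D.comp h ((J.d (n + 1) n).hom z)) = 0) :
    ∃ v : C.cycles p ⊗[R] bdry C' q, (C.iCycles p).hom.rTensor _ v =
      (toBdry C' q).hom.lTensor _ (D.comp h z) := by
  -- By flatness of the boundaries, it remains to see that `d ⊗ 1` kills the element. For positive
  -- first index this is the component of the boundary of `z` with that index lowered by one, whose
  -- other Leibniz term is killed by `toBdry`.
  refine (Module.Flat.rTensor_exact (bdry C' q) (exact_iCycles_d C p) _).1 ?_
  cases p with
  | zero => rw [C.shape 0 (0 - 1) (by simp), ModuleCat.hom_zero, LinearMap.rTensor_zero]; rfl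
  | succ p =>
    have := hz p q (by omega)
    rw [D.comp_d, map_add, map_smul, lTensor_toBdry_d, smul_zero, add_zero,
      ← rTensor_lTensor_comm] at this
    exact this

/-- If `y` bounds the family `w`, then `(1 ⊗ d) y_{p,q+1}` comes from some `v` in Z_p ⊗ B'_q.
Retracting the second factor onto cycles exhibits `w` in bidegree `(p, q)` as a sum of an element of
the image of C_{p+1} ⊗ Z'_q and one of Z_p ⊗ B'_q; both die in H ⊗ H'. -/
theorem familyClass_eq_zero_of_homologyπ {n : ℕ} (w : CycleFamily C C' n)
    (hw : (J.homologyπ n).hom (D.familyCycle n w) = 0) : familyClass C C' n w = 0 := by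
  obtain ⟨y, hy⟩ := (homologyπ_eq_zero_iff _).1 hw
  rw [familyClass_eq_zero_iff]
  rintro ⟨⟨p, q⟩, h⟩
  change p + q = n at h
  have hcomp := D.comp_familyCycle w h
  rw [← hy, D.comp_d, map_eq_lTensor_rTensor, lTensor_d_eq] at hcomp
  obtain ⟨v, hv⟩ := D.exists_cycle_tensor (p := p) (q := q) (by omega) y fun p q h => by
    rw [hy, D.comp_familyCycle, map_eq_lTensor_rTensor, lTensor_toBdry_iCycles]
  obtain ⟨ρ, hρ⟩ := exists_retraction_iCycles C' q
  have hρ' {M : Type u} [AddCommGroup M] [Module R M] (t : M ⊗[R] C'.cycles q) :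
      ρ.lTensor M ((C'.iCycles q).hom.lTensor M t) = t := by
    rw [← LinearMap.lTensor_comp_apply, hρ, LinearMap.lTensor_id_apply]
  have h1 := congrArg (ρ.lTensor (C.X p)) hcomp
  rw [map_add, map_smul, hρ', hρ', ← hv, ← rTensor_lTensor_comm, ← rTensor_lTensor_comm,
    ← C.toCycles_i, ModuleCat.hom_comp, LinearMap.rTensor_comp_apply, ← map_smul, ← map_add] at h1
  -- All terms of `h1` now come from Z_p ⊗ Z'_q, which embeds in C_p ⊗ Z'_q, so the inclusion can be
  -- cancelled.
  have h2 := Module.Flat.rTensor_preserves_injective_linearMap (M := C'.cycles q)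
    (C.iCycles p).hom (iCycles_injective C p) h1
  change TensorProduct.map (C.homologyπ p).hom (C'.homologyπ q).hom (w ⟨(p, q), h⟩) = 0
  rw [← h2, map_add, map_smul, map_eq_lTensor_rTensor, rTensor_homologyπ_toCycles, map_zero,
    zero_add, map_eq_rTensor_lTensor, lTensor_homologyπ_bdryι, map_zero, smul_zero]

theorem tensorToHomology_injective (n : ℕ) : Function.Injective (D.tensorToHomology n).hom := by
  rw [injective_iff_map_eq_zero]
  intro x hx
  obtain ⟨w, rfl⟩ := familyClass_surjective C C' n x
  rw [D.tensorToHomology_familyClass] at hx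
  exact D.familyClass_eq_zero_of_homologyπ w hx

variable (C C') in
/-- The embedding of `Tor(H_p(C), H_q(C'))` into `H_p(C) ⊗ B_q(C')`. -/
def torBdry (p q : ℕ) : ((Tor (ModuleCat.{u} R) 1).obj (C.homology p)).obj (C'.homology q) →ₗ[R]
    C.homology p ⊗[R] bdry C' q :=
  (torι (C.homology p) (cycleSeq C' q) (cycleSeq_shortExact C' q)).hom

variable (C C') in
theorem torBdry_injective (p q : ℕ) : Function.Injective (torBdry C C' p q) :=
  (ModuleCat.mono_iff_injective _).1
    (mono_torι (C.homology p) (cycleSeq C' q) (cycleSeq_shortExact C' q))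

variable (C C') in
theorem exact_torBdry (p q : ℕ) :
    Function.Exact (torBdry C C' p q) ((bdryι C' q).hom.lTensor (C.homology p)) :=
  (ShortComplex.ShortExact.moduleCat_exact_iff_function_exact _).1
    (exact_torι (C.homology p) (cycleSeq C' q) (cycleSeq_shortExact C' q))

variable (C C') in
/-- The embedding of `Tor(H_p(C), H_q(C'))` into `(C_p / B_p(C)) ⊗ B_q(C')`. -/
def torOpcycles (p q : ℕ) :
    ((Tor (ModuleCat.{u} R) 1).obj (C.homology p)).obj (C'.homology q) →ₗ[R]
    C.opcycles p ⊗[R] bdry C' q :=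
  (C.homologyι p).hom.rTensor _ ∘ₗ torBdry C C' p q

variable (C C') in
theorem torOpcycles_injective (p q : ℕ) : Function.Injective (torOpcycles C C' p q) :=
  (Module.Flat.rTensor_preserves_injective_linearMap _ (homologyι_injective C p)).comp
    (torBdry_injective C C' p q)

/-- For a cycle `c`, the element `(1 ⊗ d) c_{p,q+1}` comes from `v` in Z_p ⊗ B'_q. Vanishing of the
boundary in bidegree `(p, q)` says that the image of `v` in Z_p ⊗ Z'_q is, up to sign, a boundary in
the first factor. It therefore vanishes in H_p ⊗ Z'_q, which is the condition for the class of `v`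
in H_p ⊗ B'_q to lie in Tor. -/
theorem exists_tor {p q n : ℕ} (h : p + (q + 1) = n) (x : J.homology n) :
    ∃ t, torOpcycles C C' p q t = D.homologyToOpcycles h x := by
  obtain ⟨c, rfl⟩ := homologyπ_surjective J n x
  obtain _ | n := n
  · omega
  obtain ⟨v, hv⟩ := D.exists_cycle_tensor h ((J.iCycles (n + 1)).hom c) fun p q h => by
    rw [d_iCycles_apply, map_zero, map_zero]
  obtain ⟨ρ, hρ⟩ := exists_retraction_iCycles C' q
  have hρ' {M : Type u} [AddCommGroup M] [Module R M] (t : M ⊗[R] C'.cycles q) :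
      ρ.lTensor M ((C'.iCycles q).hom.lTensor M t) = t := by
    rw [← LinearMap.lTensor_comp_apply, hρ, LinearMap.lTensor_id_apply]
  have h1 := congrArg (ρ.lTensor (C.X p)) (congrArg (D.comp (p := p) (q := q) (by omega))
    (d_iCycles_apply J (m := n) c))
  rw [D.comp_d, lTensor_d_eq, map_add, map_smul, hρ', map_zero, map_zero, ← hv,
    ← rTensor_lTensor_comm, ← rTensor_lTensor_comm,
    ← C.toCycles_i, ModuleCat.hom_comp, LinearMap.rTensor_comp_apply, ← map_smul, ← map_add] at h1
  have h2 := Module.Flat.rTensor_preserves_injective_linearMap (M := C'.cycles q)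
    (C.iCycles p).hom (iCycles_injective C p) (h1.trans (map_zero _).symm)
  have h3 := congrArg ((C.homologyπ p).hom.rTensor (C'.cycles q)) h2
  rw [map_add, map_smul, rTensor_homologyπ_toCycles, zero_add, map_zero] at h3
  have h4 : (bdryι C' q).hom.lTensor _ ((C.homologyπ p).hom.rTensor _ v) = 0 := by
    rw [← rTensor_lTensor_comm, ← one_smul R (LinearMap.rTensor _ _ _),
      ← negOne_pow_mul_self p, mul_smul, h3, smul_zero]
  obtain ⟨t, ht⟩ := (exact_torBdry C C' p q _).1 h4
  refine ⟨t, ?_⟩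
  rw [torOpcycles, LinearMap.comp_apply, ht, rTensor_homologyι_homologyπ, hv,
    D.homologyToOpcycles_π, chainToOpcycles, LinearMap.comp_apply, map_eq_rTensor_lTensor]

/-- The map `H_n(J) ⟶ ⨁ Tor(H_p(C), H_q(C'))`. -/
def homologyToTor (n : ℕ) : J.homology n ⟶ (torTerm R n).obj (C, C') :=
  ModuleCat.ofHom (torTermLift (W := J.homology n) (C, C') fun i => liftOfInjective (torOpcycles C C' i.1.1 i.1.2)
    (torOpcycles_injective C C' i.1.1 i.1.2)
    (D.homologyToOpcycles (p := i.1.1) (q := i.1.2) i.2) (D.exists_tor _))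

theorem torOpcycles_homologyToTor {n : ℕ} (x : J.homology n)
    (i : {i : ℕ × ℕ // i.1 + i.2 + 1 = n}) :
    torOpcycles C C' i.1.1 i.1.2 (torTermProj (C, C') i ((D.homologyToTor n).hom x)) =
      D.homologyToOpcycles (p := i.1.1) (q := i.1.2) i.2 x := by
  refine (congrArg _ (torTermProj_lift (W := J.homology n) (C, C') _ i x)).trans ?_
  exact liftOfInjective_spec _ _ _ _ _

theorem homologyToTor_eq_zero_iff {n : ℕ} (c : J.cycles n) :
    (D.homologyToTor n).hom ((J.homologyπ n).hom c) = 0 ↔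
      ∀ p q (h : p + (q + 1) = n), D.chainToOpcycles h ((J.iCycles n).hom c) = 0 := by
  constructor
  · intro h0 p q h
    rw [← D.homologyToOpcycles_π, ← D.torOpcycles_homologyToTor _ ⟨(p, q), h⟩, h0, map_zero,
      map_zero]
  · intro h0
    refine torTermProj_ext fun i => torOpcycles_injective C C' _ _ ?_
    rw [D.torOpcycles_homologyToTor, D.homologyToOpcycles_π, map_zero, map_zero]
    exact h0 i.1.1 i.1.2 i.2

theorem tensorToHomology_comp_homologyToTor (n : ℕ) :
    D.tensorToHomology n ≫ D.homologyToTor n = 0 := by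
  refine ModuleCat.hom_ext (LinearMap.ext fun x => ?_)
  obtain ⟨w, rfl⟩ := familyClass_surjective C C' n x
  rw [ModuleCat.hom_comp, LinearMap.comp_apply, D.tensorToHomology_familyClass]
  refine (D.homologyToTor_eq_zero_iff _).2 fun p q h => ?_
  rw [chainToOpcycles, LinearMap.comp_apply, D.comp_familyCycle, map_eq_rTensor_lTensor,
    map_eq_lTensor_rTensor, lTensor_toBdry_iCycles, map_zero]

/-- If the Tor class vanishes, `(1 ⊗ d) c_{p,q+1}` equals `(d ⊗ 1) t` for some `t` in C_{p+1} ⊗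
B'_q. Lifting `t` to C_{p+1} ⊗ C'_{q+1} and subtracting the boundary of the lift leaves a homologous
cycle whose components all lie in Z ⊗ Z'. -/
theorem exists_familyClass [IsProjectiveComplex C] {n : ℕ} (c : J.cycles n)
    (hc : (D.homologyToTor n).hom ((J.homologyπ n).hom c) = 0) :
    ∃ x, (D.tensorToHomology n).hom x = (J.homologyπ n).hom c := by
  rw [homologyToTor_eq_zero_iff] at hc
  have ht (p q : ℕ) (h : p + (q + 1) = n) : ∃ t, (C.d (p + 1) p).hom.rTensor (bdry C' q) t =
      (toBdry C' q).hom.lTensor _ (D.comp h ((J.iCycles n).hom c)) := by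
    have := hc p q h
    rw [chainToOpcycles, LinearMap.comp_apply, map_eq_rTensor_lTensor] at this
    exact (rTensor_exact (bdry C' q) (exact_d_pOpcycles C p) (pOpcycles_surjective C p) _).1 this
  choose t ht using ht
  choose σ hσ using exists_section_toBdry C'
  -- For `b = 0` no correction is needed, as `1 ⊗ d` out of second degree 0 is zero.
  let r : ∀ p b, p + b = n → C.X (p + 1) ⊗[R] C'.X b := fun p b h =>
    match b, h with
    | 0, _ => 0
    | q + 1, h => (σ q).lTensor _ (t p q h)
  obtain ⟨y, hy⟩ := D.exists_comp (shiftLeft (M := fun p q => C.X p ⊗[R] C'.X q) r)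
  let z := (J.iCycles n).hom c - (J.d (n + 1) n).hom y
  have hz (p q : ℕ) (h : p + (q + 1) = n) :
      (toBdry C' q).hom.lTensor _ (D.comp h z) = 0 := by
    rw [map_sub, D.comp_d, hy, map_sub, ← ht, map_add, map_smul, lTensor_toBdry_d, smul_zero,
      add_zero, sub_eq_zero]
    change _ = (toBdry C' q).hom.lTensor _ ((C.d (p + 1) p).hom.rTensor _
      ((σ q).lTensor _ (t p q h)))
    rw [← rTensor_lTensor_comm, ← LinearMap.lTensor_comp_apply, hσ, LinearMap.lTensor_id_apply]
  have hdz (m : ℕ) (h : n = m + 1) : (J.d n m).hom z = 0 := by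
    rw [map_sub, d_iCycles_apply, zero_sub, neg_eq_zero, ← LinearMap.comp_apply,
      ← ModuleCat.hom_comp, J.d_comp_d]
    rfl
  have hw (i : {i : ℕ × ℕ // i.1 + i.2 = n}) : ∃ w : C.cycles i.1.1 ⊗[R] C'.cycles i.1.2,
      TensorProduct.map (C.iCycles i.1.1).hom (C'.iCycles i.1.2).hom w = D.comp i.2 z := by
    obtain ⟨⟨p, q⟩, h⟩ := i
    -- By `hz`, `1 ⊗ d` kills every component of `z`; since `z` is a cycle, the Leibniz rule then
    -- leaves `d ⊗ 1` zero on each component as well. The intersection of the two kernels is Z ⊗ Z'.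
    refine exists_map_eq_of_exact (iCycles_injective C p) (exact_iCycles_d C p)
      (exact_iCycles_d C' q) _ ?_ ?_
    · cases p with
      | zero => rw [C.shape 0 (0 - 1) (by simp), ModuleCat.hom_zero, LinearMap.rTensor_zero]; rfl
      | succ p =>
        obtain ⟨m, rfl⟩ : ∃ m, n = m + 1 := ⟨p + q, by simp only at h; omega⟩
        have := (D.d_eq_zero_iff z).1 (hdz m rfl) p q (by simp only at h; omega)
        rw [lTensor_d_eq, hz, map_zero, map_zero, smul_zero, add_zero] at this
        exact this
    · cases q with
      | zero => rw [C'.shape 0 (0 - 1) (by simp), ModuleCat.hom_zero, LinearMap.lTensor_zero]; rfl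
      | succ q =>
        refine (lTensor_d_eq C' q _).trans ?_
        rw [hz, map_zero, map_zero]
  choose w hw using hw
  refine ⟨familyClass C C' n w, ?_⟩
  rw [D.tensorToHomology_familyClass, eq_comm, ← sub_eq_zero, ← map_sub, homologyπ_eq_zero_iff]
  refine ⟨y, ?_⟩
  have : (J.iCycles n).hom (D.familyCycle n w) = z := D.ext fun p q h =>
    (D.comp_familyCycle w h).trans (hw _)
  rw [map_sub, this, sub_sub_cancel]

/-- A Tor element in H_p ⊗ B'_q lifts to `v` in Z_p ⊗ B'_q. Since it vanishes in H_p ⊗ Z'_q, the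
image of `v` in Z_p ⊗ Z'_q is the boundary in the first factor of some `s` in C_{p+1} ⊗ Z'_q. A lift
of `v` through `1 ⊗ d`, corrected by `s`, is the required cycle. -/
theorem homologyToTor_surjective (n : ℕ) : Function.Surjective (D.homologyToTor n).hom := by
  intro x
  obtain _ | n := n
  -- In degree 0 the Tor term has no summands.
  · exact ⟨0, torTermProj_ext fun i => absurd i.2 (by omega)⟩
  have hv (p q : ℕ) (h : p + q = n) : ∃ v : C.cycles p ⊗[R] bdry C' q,
      (C.homologyπ p).hom.rTensor _ v =
        torBdry C C' p q (torTermProj (C, C') ⟨(p, q), congrArg (· + 1) h⟩ x) :=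
    LinearMap.rTensor_surjective _ (homologyπ_surjective C p) _
  choose v hv using hv
  have hs (p q : ℕ) (h : p + q = n) : ∃ s : C.X (p + 1) ⊗[R] C'.cycles q,
      (C.toCycles (p + 1) p).hom.rTensor _ s = (bdryι C' q).hom.lTensor _ (v p q h) := by
    refine (rTensor_exact _ (exact_toCycles_homologyπ C p) (homologyπ_surjective C p) _).1 ?_
    rw [rTensor_lTensor_comm, hv]
    exact (exact_torBdry C C' p q).apply_apply_eq_zero _
  choose s hs using hs
  choose σ hσ using exists_section_toBdry C'
  -- `α` carries the Tor data: `1 ⊗ d` recovers `v` from it and `d ⊗ 1` kills it. `β` has second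
  -- factor a cycle, so it does not change the Tor class, and its sign is chosen so that `(d ⊗ 1) β`
  -- cancels `(-1) ^ p (1 ⊗ d) α`.
  let α := shiftRight (M := fun p q => C.X p ⊗[R] C'.X q)
    fun p q h => (σ q).lTensor _ ((C.iCycles p).hom.rTensor _ (v p q h))
  let β := shiftLeft (M := fun p q => C.X p ⊗[R] C'.X q)
    fun p q h => -((-1 : R) ^ p • (C'.iCycles q).hom.lTensor _ (s p q h))
  obtain ⟨z, hz⟩ := D.exists_comp fun p q h => α p q h + β p q h
  have hα (p q : ℕ) (h : p + 1 + q = n + 1) :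
      (C.d (p + 1) p).hom.rTensor _ (α (p + 1) q h) = 0 := by
    cases q with
    | zero => exact map_zero _
    | succ q =>
      change (C.d (p + 1) p).hom.rTensor _ ((σ q).lTensor _ _) = 0
      rw [rTensor_lTensor_comm, d_rTensor_iCycles C p, map_zero]
  have hβ (p q : ℕ) (h : p + (q + 1) = n + 1) :
      (toBdry C' q).hom.lTensor _ (β p (q + 1) h) = 0 := by
    cases p with
    | zero => exact map_zero _
    | succ p =>
      change (toBdry C' q).hom.lTensor _ (-(_ • _)) = 0
      rw [map_neg, map_smul, lTensor_toBdry_iCycles, smul_zero, neg_zero]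
  have hα' (p q : ℕ) (h : p + (q + 1) = n + 1) : (toBdry C' q).hom.lTensor _ (α p (q + 1) h) =
      (C.iCycles p).hom.rTensor _ (v p q (by omega)) := by
    change (toBdry C' q).hom.lTensor _ ((σ q).lTensor _ _) = _
    rw [← LinearMap.lTensor_comp_apply, hσ, LinearMap.lTensor_id_apply]
  have hdz : (J.d (n + 1) n).hom z = 0 := by
    rw [D.d_eq_zero_iff]
    intro p q h
    rw [hz, hz, map_add, hα, zero_add, lTensor_d_eq, map_add, hβ, add_zero, hα']
    change (C.d (p + 1) p).hom.rTensor _ (-(_ • _)) + _ = 0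
    rw [map_neg, map_smul, neg_add_eq_zero, ← C.toCycles_i, ModuleCat.hom_comp,
      LinearMap.rTensor_comp_apply, rTensor_lTensor_comm, rTensor_lTensor_comm, hs,
      ← rTensor_lTensor_comm, ← rTensor_lTensor_comm, ← rTensor_lTensor_comm]
  obtain ⟨c, rfl⟩ := exists_cycle J (n + 1) z (by rintro m hm; obtain rfl : n = m := by omega
                                                  exact hdz)
  refine ⟨(J.homologyπ (n + 1)).hom c, torTermProj_ext ?_⟩
  rintro ⟨⟨p, q⟩, h⟩
  have h' : p + (q + 1) = n + 1 := h
  refine torOpcycles_injective C C' _ _ ?_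
  rw [D.torOpcycles_homologyToTor, D.homologyToOpcycles_π, chainToOpcycles, LinearMap.comp_apply]
  change TensorProduct.map (C.pOpcycles p).hom (toBdry C' q).hom (D.comp h' _) =
    (C.homologyι p).hom.rTensor _ (torBdry C C' p q _)
  rw [← hv p q (by omega), hz, map_add, map_eq_rTensor_lTensor, map_eq_rTensor_lTensor, hβ, hα',
    map_zero, add_zero, rTensor_homologyι_homologyπ]

/-- The Künneth short exact sequence. -/
theorem shortExact [IsProjectiveComplex C] (n : ℕ) :
    (ShortComplex.mk (D.tensorToHomology n) (D.homologyToTor n)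
      (D.tensorToHomology_comp_homologyToTor n)).ShortExact where
  exact := (ShortComplex.ShortExact.moduleCat_exact_iff_function_exact _).2 fun x => by
    refine ⟨fun hx => ?_, ?_⟩
    · obtain ⟨c, rfl⟩ := homologyπ_surjective J n x
      exact D.exists_familyClass c hx
    · rintro ⟨u, rfl⟩
      exact congrArg (fun f => f.hom u) (D.tensorToHomology_comp_homologyToTor n)
  mono_f := (ModuleCat.mono_iff_injective _).2 (D.tensorToHomology_injective n)
  epi_g := (ModuleCat.epi_iff_surjective _).2 (D.homologyToTor_surjective n)

end TensorData

end RegularKunneth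

end

noncomputable section

namespace RegularKunneth

open TensorProduct

/-! ### Naturality of the Künneth short exact sequence -/

section TensorElements

variable {R : Type*} [CommRing R] {W X Y X' Y' Z Z' : Type*} [AddCommGroup W] [Module R W]
  [AddCommGroup X] [Module R X] [AddCommGroup Y] [Module R Y] [AddCommGroup X'] [Module R X']
  [AddCommGroup Y'] [Module R Y'] [AddCommGroup Z] [Module R Z] [AddCommGroup Z'] [Module R Z']

theorem map_map_apply (f : X →ₗ[R] Y) (f' : X' →ₗ[R] Y') (g : Y →ₗ[R] Z) (g' : Y' →ₗ[R] Z')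
    (t : X ⊗[R] X') : TensorProduct.map g g' (TensorProduct.map f f' t) =
      TensorProduct.map (g ∘ₗ f) (g' ∘ₗ f') t := by
  rw [TensorProduct.map_comp]
  rfl

theorem homologyMap_homologyπ_apply {R : Type u} [CommRing R]
    {K L : ChainComplex (ModuleCat.{u} R) ℕ} (φ : K ⟶ L) {n : ℕ} (c : K.cycles n) :
    (HomologicalComplex.homologyMap φ n).hom ((K.homologyπ n).hom c) =
      (L.homologyπ n).hom ((HomologicalComplex.cyclesMap φ n).hom c) :=
  congrArg (fun f => f.hom c) (HomologicalComplex.homologyπ_naturality φ n)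

theorem iCycles_cyclesMap_apply {R : Type u} [CommRing R]
    {K L : ChainComplex (ModuleCat.{u} R) ℕ} (φ : K ⟶ L) {n : ℕ} (c : K.cycles n) :
    (L.iCycles n).hom ((HomologicalComplex.cyclesMap φ n).hom c) =
      (φ.f n).hom ((K.iCycles n).hom c) :=
  congrArg (fun f => f.hom c) (HomologicalComplex.cyclesMap_i φ n)

end TensorElements

-- Compatible chain maps

namespace TensorData

variable {R : Type u} [CommRing R] {C C' J C₁ C₁' J₁ : ChainComplex (ModuleCat.{u} R) ℕ}
  {D : TensorData C C' J} {D₁ : TensorData C₁ C₁' J₁} {a : C ⟶ C₁} {a' : C' ⟶ C₁'} {j : J ⟶ J₁}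

/-- Compatibility of chain maps with identifications as tensor products. -/
def Compatible (D : TensorData C C' J) (D₁ : TensorData C₁ C₁' J₁) (a : C ⟶ C₁) (a' : C' ⟶ C₁')
    (j : J ⟶ J₁) : Prop :=
  ∀ ⦃p q n : ℕ⦄ (h : p + q = n) (z : J.X n), D₁.comp h ((j.f n).hom z) =
    TensorProduct.map (a.f p).hom (a'.f q).hom (D.comp h z)

theorem tensorToHomology_naturality (h : Compatible D D₁ a a' j) (n : ℕ) :
    D.tensorToHomology n ≫ HomologicalComplex.homologyMap j n =
      (tensorTerm R n).map (X := (C, C')) (Y := (C₁, C₁')) (a, a') ≫ D₁.tensorToHomology n := by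
  refine ModuleCat.hom_ext (LinearMap.ext fun x => ?_)
  obtain ⟨w, rfl⟩ := familyClass_surjective C C' n x
  let w₁ : CycleFamily C₁ C₁' n := fun i =>
    TensorProduct.map (HomologicalComplex.cyclesMap a i.1.1).hom
      (HomologicalComplex.cyclesMap a' i.1.2).hom (w i)
  have h1 : ((tensorTerm R n).map (X := (C, C')) (Y := (C₁, C₁')) (a, a')).hom
      (familyClass C C' n w) = familyClass C₁ C₁' n w₁ := by
    refine tensorTermProj_ext fun i => ?_
    rw [tensorTermProj_map, tensorTermProj_familyClass, tensorTermProj_familyClass, map_map_apply,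
      map_map_apply]
    simp only [← ModuleCat.hom_comp, HomologicalComplex.homologyπ_naturality]
  have h2 : (HomologicalComplex.cyclesMap j n).hom (D.familyCycle n w) = D₁.familyCycle n w₁ := by
    refine iCycles_injective J₁ n (D₁.ext fun p q hpq => ?_)
    rw [iCycles_cyclesMap_apply, h, comp_familyCycle, comp_familyCycle,
      map_map_apply, map_map_apply]
    simp only [← ModuleCat.hom_comp, HomologicalComplex.cyclesMap_i]
  rw [ModuleCat.hom_comp, ModuleCat.hom_comp, LinearMap.comp_apply, LinearMap.comp_apply, h1,
    tensorToHomology_familyClass, tensorToHomology_familyClass, ← h2, homologyMap_homologyπ_apply]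

/-- The family that is `x ⊗ y` in bidegree `(p, q)` and zero elsewhere represents the tensor class;
its cycle has the same components as `z`, hence is `z`. -/
theorem tensorToHomology_tensorClass (D : TensorData C C' J) {p q : ℕ} (x : C.cycles p)
    (y : C'.cycles q) (z : J.cycles (p + q))
    (h : D.comp rfl ((J.iCycles (p + q)).hom z) = (C.iCycles p).hom x ⊗ₜ (C'.iCycles q).hom y)
    (h0 : ∀ p' q' (h : p' + q' = p + q), (p', q') ≠ (p, q) →
      D.comp h ((J.iCycles (p + q)).hom z) = 0) :
    (D.tensorToHomology (p + q)).hom (tensorClass R (C, C') p q x y) =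
      (J.homologyπ (p + q)).hom z := by
  classical
  let w : CycleFamily C C' (p + q) := Pi.single ⟨(p, q), rfl⟩ (x ⊗ₜ y)
  have h1 : tensorClass R (C, C') p q x y = familyClass C C' (p + q) w := by
    refine tensorTermProj_ext fun i => ?_
    rw [tensorTermProj_familyClass]
    by_cases hi : i = ⟨(p, q), rfl⟩
    · subst hi
      rw [tensorTermProj_tensorClass]
      simp [w]
    · rw [tensorTermProj_tensorClass_of_ne _ _ _ _ _ _ fun h => hi (Subtype.ext h)]
      simp [w, Pi.single_eq_of_ne hi]
  have h2 : D.familyCycle (p + q) w = z := by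
    refine iCycles_injective J _ (D.ext fun p' q' hpq => ?_)
    rw [comp_familyCycle]
    by_cases hi : (p', q') = (p, q)
    · obtain ⟨rfl, rfl⟩ := Prod.mk.inj hi
      rw [h]
      simp [w]
    · rw [h0 _ _ hpq hi]
      have : w ⟨(p', q'), hpq⟩ = 0 := Pi.single_eq_of_ne (fun h => hi (congrArg Subtype.val h)) _
      rw [this, map_zero]
  rw [h1, tensorToHomology_familyClass, h2]

variable [IsDomain R] [IsPrincipalIdealRing R] [IsProjectiveComplex C'] [IsProjectiveComplex C₁']

theorem torOpcycles_map (a : C ⟶ C₁) (a' : C' ⟶ C₁') (p q : ℕ)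
    (t : ((Tor (ModuleCat.{u} R) 1).obj (C.homology p)).obj (C'.homology q)) :
    torOpcycles C₁ C₁' p q
      ((((Tor (ModuleCat.{u} R) 1).map (HomologicalComplex.homologyMap a p)).app _ ≫
        ((Tor (ModuleCat.{u} R) 1).obj _).map (HomologicalComplex.homologyMap a' q)).hom t) =
      TensorProduct.map (HomologicalComplex.opcyclesMap a p).hom (bdryMap q a').hom
        (torOpcycles C C' p q t) := by
  have h : torBdry C₁ C₁' p q
      ((((Tor (ModuleCat.{u} R) 1).map (HomologicalComplex.homologyMap a p)).app _ ≫
        ((Tor (ModuleCat.{u} R) 1).obj _).map (HomologicalComplex.homologyMap a' q)).hom t) =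
      TensorProduct.map (HomologicalComplex.homologyMap a p).hom (bdryMap q a').hom
        (torBdry C C' p q t) :=
    congrArg (fun f => f.hom t) (torι_naturality (cycleSeq_shortExact C' q)
      (cycleSeq_shortExact C₁' q) (HomologicalComplex.homologyMap a p) (cycleSeqMap q a'))
  rw [torOpcycles, LinearMap.comp_apply, h, torOpcycles, LinearMap.comp_apply, LinearMap.rTensor,
    map_map_apply, LinearMap.rTensor, map_map_apply, ← ModuleCat.hom_comp, ← ModuleCat.hom_comp,
    HomologicalComplex.homologyι_naturality, LinearMap.id_comp, LinearMap.comp_id]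

/-- Tor embeds in (C_p / B_p) ⊗ B'_q compatibly with maps, so naturality can be checked there, where
the map is an explicit formula on chains. -/
theorem homologyToTor_naturality (h : Compatible D D₁ a a' j) (n : ℕ) :
    HomologicalComplex.homologyMap j n ≫ D₁.homologyToTor n =
      D.homologyToTor n ≫ (torTerm R n).map (X := (C, C')) (Y := (C₁, C₁')) (a, a') := by
  refine ModuleCat.hom_ext (LinearMap.ext fun x => ?_)
  obtain ⟨c, rfl⟩ := homologyπ_surjective J n x
  refine torTermProj_ext fun i => torOpcycles_injective C₁ C₁' _ _ ?_
  rw [ModuleCat.hom_comp, LinearMap.comp_apply, torOpcycles_homologyToTor, ModuleCat.hom_comp,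
    LinearMap.comp_apply, torTermProj_map, torOpcycles_map, torOpcycles_homologyToTor,
    homologyToOpcycles_π, homologyMap_homologyπ_apply, homologyToOpcycles_π,
    iCycles_cyclesMap_apply, chainToOpcycles, LinearMap.comp_apply, h, chainToOpcycles,
    LinearMap.comp_apply, map_map_apply, map_map_apply]
  simp only [← ModuleCat.hom_comp, HomologicalComplex.p_opcyclesMap, toBdry_bdryMap]

end TensorData

/-- The natural Künneth sequences attached to natural identifications of complexes with tensor
products. -/
def naturalKU {R : Type u} [CommRing R] [IsDomain R] [IsPrincipalIdealRing R]
    {P : Type (u + 1)} [Category.{u} P]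
    (C : P ⥤ ChainComplex (ModuleCat.{u} R) ℕ × ChainComplex (ModuleCat.{u} R) ℕ)
    (J : P ⥤ ChainComplex (ModuleCat.{u} R) ℕ)
    (h₁ : ∀ X, IsProjectiveComplex (C.obj X).1) (h₂ : ∀ X, IsProjectiveComplex (C.obj X).2)
    (D : ∀ X, TensorData (C.obj X).1 (C.obj X).2 (J.obj X))
    (hD : ∀ {X Y : P} (φ : X ⟶ Y),
      (D X).Compatible (D Y) (C.map φ).1 (C.map φ).2 (J.map φ)) (n : ℕ) : NaturalKU C J n where
  f := { app := fun X => (D X).tensorToHomology n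
         naturality := fun _ _ φ => (TensorData.tensorToHomology_naturality (hD φ) n).symm }
  g := { app := fun X => (D X).homologyToTor n
         naturality := fun _ _ φ => TensorData.homologyToTor_naturality (hD φ) n }
  zero := by
    ext1
    exact funext fun X => (D X).tensorToHomology_comp_homologyToTor n
  exact X := (D X).shortExact n

end RegularKunneth

end

noncomputable section

namespace RegularKunneth

open TensorProduct

/-! ### The infimum complex of a join -/

variable {R : Type u} [CommRing R]

-- Diagonal operators: coordinate projections and signs

section Diag

variable {B B' : Type u}

/-- The diagonal operator that multiplies the generator `b` by `c b`. -/
def diag (c : B → R) : (B →₀ R) →ₗ[R] (B →₀ R) :=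
  Finsupp.lsum R fun b => c b • Finsupp.lsingle b

theorem diag_single (c : B → R) (b : B) (r : R) :
    diag c (Finsupp.single b r) = Finsupp.single b (c b * r) := by
  simp [diag]

theorem diag_apply (c : B → R) (x : B →₀ R) (b : B) : diag c x b = c b * x b := by
  classical
  induction x using Finsupp.induction_linear with
  | zero => simp
  | add x y hx hy => rw [map_add, Finsupp.add_apply, hx, hy, Finsupp.add_apply, mul_add]
  | single a r =>
    rw [diag_single, Finsupp.single_apply, Finsupp.single_apply]
    split_ifs with h
    · rw [h]
    · rw [mul_zero]

theorem diag_comp_diag_comm (c c' : B → R) : diag c ∘ₗ diag c' = diag c' ∘ₗ diag c := by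
  refine LinearMap.ext fun x => Finsupp.ext fun b => ?_
  simp only [LinearMap.comp_apply, diag_apply]
  ring

theorem diag_comp_eq {c : B → R} {c' : B' → R} (f : (B →₀ R) →ₗ[R] (B' →₀ R))
    (h : ∀ b, f (Finsupp.single b 1) ∈ Finsupp.supported R R {b' | c' b' = c b}) :
    diag c' ∘ₗ f = f ∘ₗ diag c := by
  refine Finsupp.lhom_ext' fun b => LinearMap.ext_ring (Finsupp.ext fun b' => ?_)
  have h1 : diag c (Finsupp.single b 1) = c b • Finsupp.single b 1 := by
    rw [diag_single, Finsupp.smul_single, smul_eq_mul]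
  simp only [LinearMap.comp_apply, Finsupp.lsingle_apply]
  rw [diag_apply, h1, map_smul, Finsupp.smul_apply, smul_eq_mul]
  by_cases h0 : f (Finsupp.single b 1) b' = 0
  · rw [h0, mul_zero, mul_zero]
  · rw [(Finsupp.mem_supported R _).1 (h b) (Finsupp.mem_support_iff.2 h0)]

open Classical in
/-- The projection onto the span of the generators in a set. -/
def spanProj (R : Type u) [CommRing R] (S : Set B) : (B →₀ R) →ₗ[R] (B →₀ R) :=
  diag fun b => if b ∈ S then 1 else 0

theorem spanProj_apply_of_mem {S : Set B} (x : B →₀ R) {b : B} (hb : b ∈ S) :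
    spanProj R S x b = x b := by
  rw [spanProj, diag_apply, if_pos hb, one_mul]

theorem spanProj_apply_of_notMem {S : Set B} (x : B →₀ R) {b : B} (hb : b ∉ S) :
    spanProj R S x b = 0 := by
  rw [spanProj, diag_apply, if_neg hb, zero_mul]

theorem mem_supported_of_apply {S : Set B} {x : B →₀ R} (h : ∀ b ∉ S, x b = 0) :
    x ∈ Finsupp.supported R R S := by
  rw [Finsupp.mem_supported]
  intro b hb
  by_contra hS
  exact Finsupp.mem_support_iff.1 hb (h b hS)

theorem apply_of_mem_supported {S : Set B} {x : B →₀ R} (h : x ∈ Finsupp.supported R R S) {b : B}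
    (hb : b ∉ S) : x b = 0 := by
  by_contra h0
  exact hb ((Finsupp.mem_supported R x).1 h (Finsupp.mem_support_iff.2 h0))

theorem spanProj_mem_supported {S T U : Set B} {x : B →₀ R} (h : x ∈ Finsupp.supported R R T)
    (hU : ∀ b, b ∈ S → b ∈ T → b ∈ U) : spanProj R S x ∈ Finsupp.supported R R U := by
  refine mem_supported_of_apply fun b hb => ?_
  by_cases hS : b ∈ S
  · rw [spanProj_apply_of_mem _ hS, apply_of_mem_supported h fun hT => hb (hU b hS hT)]
  · exact spanProj_apply_of_notMem _ hS

theorem spanProj_eq_self {S : Set B} {x : B →₀ R} (h : x ∈ Finsupp.supported R R S) :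
    spanProj R S x = x := by
  refine Finsupp.ext fun b => ?_
  by_cases hb : b ∈ S
  · exact spanProj_apply_of_mem _ hb
  · rw [spanProj_apply_of_notMem _ hb, apply_of_mem_supported h hb]

theorem spanProj_eq_zero {S T : Set B} {x : B →₀ R} (h : x ∈ Finsupp.supported R R T)
    (hST : ∀ b, b ∈ S → b ∉ T) : spanProj R S x = 0 := by
  refine Finsupp.ext fun b => ?_
  by_cases hb : b ∈ S
  · rw [spanProj_apply_of_mem _ hb, apply_of_mem_supported h (hST b hb), Finsupp.zero_apply]
  · rw [spanProj_apply_of_notMem _ hb, Finsupp.zero_apply]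

/-- Used with sets of generators of a fixed degree: a map that is homogeneous on generators commutes
with the projections to homogeneous parts, with the index shifted for a boundary. -/
theorem spanProj_comp_eq {S : Set B} {S' : Set B'} (f : (B →₀ R) →ₗ[R] (B' →₀ R))
    (h : ∀ b, f (Finsupp.single b 1) ∈ Finsupp.supported R R {b' | b' ∈ S' ↔ b ∈ S}) :
    spanProj R S' ∘ₗ f = f ∘ₗ spanProj R S := by
  refine diag_comp_eq f fun b => Finsupp.supported_mono ?_ (h b)
  intro b' hb'
  simp only [Set.mem_ofPred_eq] at hb' ⊢
  by_cases hb : b ∈ S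
  · rw [if_pos hb, if_pos (hb'.2 hb)]
  · rw [if_neg hb, if_neg fun h => hb (hb'.1 h)]

end Diag

-- Coordinates on the tensor product of free modules

section Coord

variable {B B' B'' : Type u}

theorem coord_rTensor_diag (c : B → R) (t : (B →₀ R) ⊗[R] (B' →₀ R)) (b : B) (b' : B') :
    finsuppTensorFinsupp' R B B' ((diag c).rTensor _ t) (b, b') =
      c b * finsuppTensorFinsupp' R B B' t (b, b') := by
  induction t with
  | zero => simp
  | add x y hx hy => simp only [map_add, Finsupp.add_apply, hx, hy, mul_add]
  | tmul x y =>
    rw [LinearMap.rTensor_tmul, finsuppTensorFinsupp'_apply_apply,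
      finsuppTensorFinsupp'_apply_apply, diag_apply, mul_assoc]

theorem coord_lTensor_diag (c : B' → R) (t : (B →₀ R) ⊗[R] (B' →₀ R)) (b : B) (b' : B') :
    finsuppTensorFinsupp' R B B' ((diag c).lTensor _ t) (b, b') =
      c b' * finsuppTensorFinsupp' R B B' t (b, b') := by
  induction t with
  | zero => simp
  | add x y hx hy => simp only [map_add, Finsupp.add_apply, hx, hy, mul_add]
  | tmul x y =>
    rw [LinearMap.lTensor_tmul, finsuppTensorFinsupp'_apply_apply,
      finsuppTensorFinsupp'_apply_apply, diag_apply, mul_left_comm]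

theorem coord_ext {t t' : (B →₀ R) ⊗[R] (B' →₀ R)}
    (h : ∀ b b', finsuppTensorFinsupp' R B B' t (b, b') =
      finsuppTensorFinsupp' R B B' t' (b, b')) : t = t' :=
  (finsuppTensorFinsupp' R B B').injective (Finsupp.ext fun p => h p.1 p.2)

/-- The linear extension of the join of generators. -/
def joinLin (j : B → B' → B'') : (B →₀ R) ⊗[R] (B' →₀ R) →ₗ[R] (B'' →₀ R) :=
  Finsupp.lmapDomain R R (Function.uncurry j) ∘ₗ (finsuppTensorFinsupp' R B B').toLinearMap

theorem joinLin_single (j : B → B' → B'') (b : B) (b' : B') (r r' : R) :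
    joinLin j (Finsupp.single b r ⊗ₜ Finsupp.single b' r') = Finsupp.single (j b b') (r * r') := by
  rw [joinLin, LinearMap.comp_apply, LinearEquiv.coe_coe, finsuppTensorFinsupp'_single_tmul_single,
    Finsupp.lmapDomain_apply, Finsupp.mapDomain_single, Function.uncurry_apply_pair]

theorem joinLin_tmul (j : B → B' → B'') (x : B →₀ R) (y : B' →₀ R) :
    joinLin j (x ⊗ₜ y) = x.sum fun b r => y.sum fun b' r' => Finsupp.single (j b b') (r * r') := by
  conv_lhs => rw [← x.sum_single, ← y.sum_single]
  simp only [Finsupp.sum, TensorProduct.sum_tmul, TensorProduct.tmul_sum, map_sum, joinLin_single]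
  exact Finset.sum_comm

theorem joinLin_tmul_mem_supported (j : B → B' → B'') {x : B →₀ R} {y : B' →₀ R} {S : Set B}
    {S' : Set B'} {T : Set B''} (hx : x ∈ Finsupp.supported R R S)
    (hy : y ∈ Finsupp.supported R R S') (h : ∀ b ∈ S, ∀ b' ∈ S', j b b' ∈ T) :
    joinLin j (x ⊗ₜ[R] y) ∈ Finsupp.supported R R T := by
  rw [joinLin_tmul]
  exact Submodule.sum_mem _ fun b hb => Submodule.sum_mem _ fun b' hb' =>
    Finsupp.single_mem_supported R _
      (h b ((Finsupp.mem_supported R x).1 hx hb) b' ((Finsupp.mem_supported R y).1 hy hb'))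

end Coord

/-- A join operation on the generators of three based complexes that makes the third one the tensor
product of the first two, restricted to subsets of the generators. -/
structure IsJoin {B B' B'' : Type u} (deg : B → ℕ) (d : (B →₀ R) →ₗ[R] (B →₀ R)) (A : Set B)
    (deg' : B' → ℕ) (d' : (B' →₀ R) →ₗ[R] (B' →₀ R)) (A' : Set B')
    (deg'' : B'' → ℕ) (d'' : (B'' →₀ R) →ₗ[R] (B'' →₀ R)) (A'' : Set B'')
    (j : B → B' → B'') : Prop where
  inj : Function.Injective (Function.uncurry j)
  deg_join : ∀ b b', deg'' (j b b') = deg b + deg' b'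
  aug : A'' = Set.image2 j A A'
  comp_self : d ∘ₗ d = 0
  comp_self' : d' ∘ₗ d' = 0
  comp_self'' : d'' ∘ₗ d'' = 0
  homog : ∀ b, d (Finsupp.single b 1) ∈ Finsupp.supported R R {c | deg c + 1 = deg b}
  homog' : ∀ b, d' (Finsupp.single b 1) ∈ Finsupp.supported R R {c | deg' c + 1 = deg' b}
  leibniz : d'' ∘ₗ joinLin j = joinLin j ∘ₗ
    (d.rTensor _ + (diag fun b => (-1) ^ deg b).rTensor _ ∘ₗ d'.lTensor _)

-- The infimum complex as a kernel

section InfModule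

variable {B : Type u} {deg : B → ℕ} {d : (B →₀ R) →ₗ[R] (B →₀ R)} {A : Set B}

/-- The projection onto the chains of degree `p`. -/
abbrev degProj (R : Type u) [CommRing R] (deg : B → ℕ) (p : ℕ) : (B →₀ R) →ₗ[R] (B →₀ R) :=
  spanProj R {b | deg b = p}

theorem degProj_comp_d
    (hd : ∀ b, d (Finsupp.single b 1) ∈ Finsupp.supported R R {c | deg c + 1 = deg b}) (p : ℕ) :
    degProj R deg p ∘ₗ d = d ∘ₗ degProj R deg (p + 1) := by
  refine spanProj_comp_eq d fun b => Finsupp.supported_mono ?_ (hd b)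
  intro c hc
  simp only [Set.mem_ofPred_eq] at hc ⊢
  omega

variable (d A) in
/-- Two conditions that cut out the ungraded infimum complex: the components outside `A` of a chain
and of its boundary. -/
def outside : (B →₀ R) →ₗ[R] (B →₀ R) × (B →₀ R) :=
  (spanProj R Aᶜ).prod (spanProj R Aᶜ ∘ₗ d)

theorem spanProj_compl_eq_zero {x : B →₀ R} (h : spanProj R Aᶜ x = 0) :
    x ∈ Finsupp.supported R R A := by
  refine mem_supported_of_apply fun b hb => ?_
  rw [← spanProj_apply_of_mem x (S := Aᶜ) hb, h, Finsupp.zero_apply]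

/-- As the boundary is homogeneous, the homogeneous parts of an ungraded infimum chain are infimum
chains. The intersection argument can thus be carried out without grading, and degrees selected
afterwards. -/
theorem degProj_mem_infModule
    (hd : ∀ b, d (Finsupp.single b 1) ∈ Finsupp.supported R R {c | deg c + 1 = deg b}) (p : ℕ)
    (x : LinearMap.ker (outside d A)) : degProj R deg p x.1 ∈ infModule deg d A p := by
  have h0 : (spanProj R Aᶜ x.1, spanProj R Aᶜ (d x.1)) = 0 := x.2
  have h1 := spanProj_compl_eq_zero (Prod.mk.inj h0).1
  have h2 := spanProj_compl_eq_zero (Prod.mk.inj h0).2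
  refine ⟨spanProj_mem_supported h1 fun b hb hA => ⟨hA, hb⟩, ?_⟩
  have h3 : spanProj R {b | deg b + 1 = p} ∘ₗ d = d ∘ₗ degProj R deg p := by
    refine spanProj_comp_eq d fun b => Finsupp.supported_mono ?_ (hd b)
    intro c hc
    simp only [Set.mem_ofPred_eq] at hc ⊢
    omega
  rw [SetLike.mem_coe, Submodule.mem_comap, ← LinearMap.comp_apply, ← h3]
  exact spanProj_mem_supported h2 fun b hb hA => ⟨hA, hb⟩

theorem projective_submodule [IsDomain R] [IsPrincipalIdealRing R] {M : Type u} [AddCommGroup M]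
    [Module R M] [Module.Projective R M] (N : Submodule R M) : Module.Projective R N :=
  projective_of_injective (R := R) (N := N) (M := M) N.subtype N.injective_subtype

theorem projective_infModule [IsDomain R] [IsPrincipalIdealRing R] (n : ℕ) :
    Module.Projective R (infModule deg d A n) :=
  projective_submodule _

theorem isProjectiveComplex_infComplex [IsDomain R] [IsPrincipalIdealRing R] (hd : d ∘ₗ d = 0) :
    IsProjectiveComplex (infComplex deg d A hd) :=
  ⟨fun n => projective_infModule (deg := deg) (d := d) (A := A) n⟩

end InfModule

-- Chains of a join as tensors

namespace IsJoin

variable {B B' B'' : Type u} {deg : B → ℕ} {d : (B →₀ R) →ₗ[R] (B →₀ R)} {A : Set B}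
  {deg' : B' → ℕ} {d' : (B' →₀ R) →ₗ[R] (B' →₀ R)} {A' : Set B'}
  {deg'' : B'' → ℕ} {d'' : (B'' →₀ R) →ₗ[R] (B'' →₀ R)} {A'' : Set B''}
  {j : B → B' → B''} (H : IsJoin deg d A deg' d' A' deg'' d'' A'' j)

/-- The inverse of `joinLin` on the chains of the join. -/
def unjoin (H : IsJoin deg d A deg' d' A' deg'' d'' A'' j) :
    (B'' →₀ R) →ₗ[R] (B →₀ R) ⊗[R] (B' →₀ R) :=
  (finsuppTensorFinsupp' R B B').symm.toLinearMap ∘ₗ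
    Finsupp.lcomapDomain (Function.uncurry j) H.inj

theorem coord_unjoin (x : B'' →₀ R) (b : B) (b' : B') :
    finsuppTensorFinsupp' R B B' (H.unjoin x) (b, b') = x (j b b') := by
  rw [unjoin, LinearMap.comp_apply, LinearEquiv.coe_coe, LinearEquiv.apply_symm_apply]
  rfl

theorem unjoin_joinLin (t : (B →₀ R) ⊗[R] (B' →₀ R)) : H.unjoin (joinLin j t) = t := by
  refine coord_ext fun b b' => ?_
  rw [coord_unjoin]
  exact Finsupp.mapDomain_apply H.inj _ (b, b')

/-- The support condition is needed: a generator such as a sequence with a vertex of `V'` before a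
vertex of `V` is not a join, and `unjoin` discards it. -/
theorem joinLin_unjoin {x : B'' →₀ R} (hx : x ∈ Finsupp.supported R R A'') :
    joinLin j (H.unjoin x) = x := by
  refine Finsupp.ext fun c => ?_
  by_cases hc : c ∈ Set.range (Function.uncurry j)
  · obtain ⟨⟨b, b'⟩, rfl⟩ := hc
    exact (Finsupp.mapDomain_apply H.inj _ (b, b')).trans (H.coord_unjoin x b b')
  · rw [apply_of_mem_supported hx]
    · exact Finsupp.mapDomain_of_notMem_range _ _ hc
    · rw [H.aug]
      rintro ⟨b, -, b', -, rfl⟩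
      exact hc ⟨(b, b'), rfl⟩

theorem unjoin_d {x : B'' →₀ R} (hx : x ∈ Finsupp.supported R R A'') :
    H.unjoin (d'' x) = d.rTensor _ (H.unjoin x) +
      (diag fun b => (-1) ^ deg b).rTensor _ (d'.lTensor _ (H.unjoin x)) := by
  conv_lhs => rw [← H.joinLin_unjoin hx]
  rw [← LinearMap.comp_apply d'', H.leibniz, LinearMap.comp_apply, unjoin_joinLin]
  rfl

theorem rTensor_spanProj_unjoin {x : B'' →₀ R} (hx : x ∈ Finsupp.supported R R A'') :
    (spanProj R Aᶜ).rTensor _ (H.unjoin x) = 0 := by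
  refine coord_ext fun b b' => ?_
  rw [spanProj, coord_rTensor_diag, coord_unjoin, map_zero, Finsupp.zero_apply]
  split_ifs with hb
  · rw [one_mul, apply_of_mem_supported hx]
    rw [H.aug]
    rintro ⟨c, hc, c', -, h⟩
    exact hb ((Prod.mk.inj (H.inj (a₁ := (c, c')) (a₂ := (b, b')) h)).1 ▸ hc)
  · rw [zero_mul]

theorem lTensor_spanProj_unjoin {x : B'' →₀ R} (hx : x ∈ Finsupp.supported R R A'') :
    (spanProj R A'ᶜ).lTensor _ (H.unjoin x) = 0 := by
  refine coord_ext fun b b' => ?_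
  rw [spanProj, coord_lTensor_diag, coord_unjoin, map_zero, Finsupp.zero_apply]
  split_ifs with hb
  · rw [one_mul, apply_of_mem_supported hx]
    rw [H.aug]
    rintro ⟨c, -, c', hc, h⟩
    exact hb ((Prod.mk.inj (H.inj (a₁ := (c, c')) (a₂ := (b, b')) h)).2 ▸ hc)
  · rw [zero_mul]

theorem sign_comp_sign :
    (diag fun b => (-1) ^ deg b) ∘ₗ (diag fun b => (-1) ^ deg b) =
      (LinearMap.id : (B →₀ R) →ₗ[R] (B →₀ R)) := by
  refine LinearMap.ext fun x => Finsupp.ext fun b => ?_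
  rw [LinearMap.comp_apply, diag_apply, diag_apply, ← mul_assoc, negOne_pow_mul_self, one_mul,
    LinearMap.id_apply]

theorem degProj_comp_sign (p : ℕ) :
    degProj R deg p ∘ₗ (diag fun b => (-1) ^ deg b) = (-1 : R) ^ p • degProj R deg p := by
  refine LinearMap.ext fun x => Finsupp.ext fun b => ?_
  rw [LinearMap.comp_apply, LinearMap.smul_apply, Finsupp.smul_apply, smul_eq_mul]
  by_cases hb : b ∈ {b | deg b = p}
  · rw [spanProj_apply_of_mem _ hb, spanProj_apply_of_mem _ hb, diag_apply,
      Set.mem_ofPred_eq.mp hb]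
  · rw [spanProj_apply_of_notMem _ hb, spanProj_apply_of_notMem _ hb, mul_zero]

/-- Apply P ⊗ 1 to the Leibniz rule for the boundary of `x`, with `P` the projection outside `A`.
Diagonal operators commute, so P ⊗ 1 passes through the sign and through `1 ⊗ d'` to reach `unjoin
x`, which it kills; only the term with `P d ⊗ 1` survives. -/
theorem rTensor_spanProj_d_unjoin {x : B'' →₀ R} (hx : x ∈ Finsupp.supported R R A'')
    (hx' : d'' x ∈ Finsupp.supported R R A'') :
    (spanProj R Aᶜ ∘ₗ d).rTensor _ (H.unjoin x) = 0 := by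
  have h := H.rTensor_spanProj_unjoin hx'
  rwa [H.unjoin_d hx, map_add, ← LinearMap.rTensor_comp_apply, ← LinearMap.rTensor_comp_apply,
    show spanProj R Aᶜ ∘ₗ (diag fun b => (-1) ^ deg b) = (diag fun b => (-1) ^ deg b) ∘ₗ
      spanProj R Aᶜ from diag_comp_diag_comm _ _,
    LinearMap.rTensor_comp_apply _ (diag fun b => (-1) ^ deg b), rTensor_lTensor_comm,
    H.rTensor_spanProj_unjoin hx, map_zero, map_zero, add_zero] at h

/-- The same argument on the other factor leaves the surviving term multiplied by the sign operator,
which is an involution and is removed by applying it again. -/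
theorem lTensor_spanProj_d_unjoin {x : B'' →₀ R} (hx : x ∈ Finsupp.supported R R A'')
    (hx' : d'' x ∈ Finsupp.supported R R A'') :
    (spanProj R A'ᶜ ∘ₗ d').lTensor _ (H.unjoin x) = 0 := by
  have h := H.lTensor_spanProj_unjoin hx'
  rw [H.unjoin_d hx, map_add, ← rTensor_lTensor_comm, H.lTensor_spanProj_unjoin hx, map_zero,
    zero_add, ← rTensor_lTensor_comm, ← LinearMap.lTensor_comp_apply] at h
  have h1 := congrArg ((diag fun b => (-1) ^ deg b).rTensor (B' →₀ R)) h
  rwa [← LinearMap.rTensor_comp_apply, sign_comp_sign, LinearMap.rTensor_id_apply, map_zero] at h1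

/-- The component of bidegree `(p, q)` of an element of the tensor product. -/
abbrev bidegProj (deg : B → ℕ) (deg' : B' → ℕ) (p q : ℕ) :
    (B →₀ R) ⊗[R] (B' →₀ R) →ₗ[R] (B →₀ R) ⊗[R] (B' →₀ R) :=
  TensorProduct.map (degProj R deg p) (degProj R deg' q)

theorem coord_bidegProj_of_eq {p q : ℕ} (t : (B →₀ R) ⊗[R] (B' →₀ R)) {b : B} {b' : B'}
    (h : deg b = p) (h' : deg' b' = q) :
    finsuppTensorFinsupp' R B B' (bidegProj deg deg' p q t) (b, b') =
      finsuppTensorFinsupp' R B B' t (b, b') := by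
  rw [bidegProj, map_eq_rTensor_lTensor, degProj, degProj, spanProj, spanProj, coord_rTensor_diag,
    coord_lTensor_diag, if_pos (show b ∈ {b | deg b = p} from h),
    if_pos (show b' ∈ {b | deg' b = q} from h'), one_mul, one_mul]

end IsJoin

-- Infimum complexes inside the free modules of chains

section Incl

variable {B B' : Type u} {deg : B → ℕ} {d : (B →₀ R) →ₗ[R] (B →₀ R)} {A : Set B}
  {deg' : B' → ℕ} {d' : (B' →₀ R) →ₗ[R] (B' →₀ R)} {A' : Set B'}
  (hd : d ∘ₗ d = 0) (hd' : d' ∘ₗ d' = 0)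

/-- The inclusion of the infimum complex into the chains. -/
def infIncl (n : ℕ) : (infComplex deg d A hd).X n →ₗ[R] (B →₀ R) :=
  (infModule deg d A n).subtype

theorem infIncl_injective (n : ℕ) : Function.Injective (infIncl (deg := deg) (A := A) hd n) :=
  (infModule deg d A n).injective_subtype

theorem infIncl_mem (n : ℕ) (z : (infComplex deg d A hd).X n) :
    infIncl hd n z ∈ infModule deg d A n :=
  Subtype.property (p := fun y => y ∈ infModule deg d A n) z

theorem exists_infIncl_eq (n : ℕ) {x : B →₀ R} (hx : x ∈ infModule deg d A n) :
    ∃ z : (infComplex deg d A hd).X n, infIncl hd n z = x :=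
  ⟨(⟨x, hx⟩ : infModule deg d A n), rfl⟩

theorem infIncl_d (n : ℕ) (z : (infComplex deg d A hd).X (n + 1)) :
    infIncl hd n (((infComplex deg d A hd).d (n + 1) n).hom z) = d (infIncl hd (n + 1) z) := by
  have h : (infComplex deg d A hd).d (n + 1) n =
      ModuleCat.ofHom (d.restrict (boundary_mem_infModule hd n)) := by
    simp only [infComplex, ChainComplex.of, ChainComplex.of_d]
  rw [h]
  rfl

theorem infIncl_infMap (g : (B →₀ R) →ₗ[R] (B' →₀ R)) (hg : IsInfMap deg d A deg' d' A' g) (n : ℕ)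
    (z : (infComplex deg d A hd).X n) :
    infIncl hd' n (((infMap hd hd' g hg).f n).hom z) = g (infIncl hd n z) :=
  rfl

theorem degProj_infIncl (n : ℕ) (z : (infComplex deg d A hd).X n) :
    degProj R deg n (infIncl hd n z) = infIncl hd n z :=
  spanProj_eq_self (Finsupp.supported_mono (fun _ hb => hb.2) (infIncl_mem hd n z).1)

theorem degProj_infIncl_of_ne {m n : ℕ} (h : m ≠ n) (z : (infComplex deg d A hd).X n) :
    degProj R deg m (infIncl hd n z) = 0 :=
  spanProj_eq_zero (infIncl_mem hd n z).1 fun _ hb hb' => h (Eq.trans (Eq.symm hb) hb'.2)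

theorem supported_of_mem_infModule {n : ℕ} {x : B →₀ R} (hx : x ∈ infModule deg d A n) :
    x ∈ Finsupp.supported R R A ∧ d x ∈ Finsupp.supported R R A :=
  ⟨Finsupp.supported_mono (fun _ hb => hb.1) hx.1,
    Finsupp.supported_mono (fun _ hb => hb.1) (Submodule.mem_comap.1 hx.2)⟩

/-- The inclusion of the tensor product of two infimum complexes into the tensor product of the
chains. -/
abbrev infInclTensor (p q : ℕ) : (infComplex deg d A hd).X p ⊗[R] (infComplex deg' d' A' hd').X q
    →ₗ[R] (B →₀ R) ⊗[R] (B' →₀ R) :=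
  TensorProduct.map (infIncl hd p) (infIncl hd' q)

end Incl

section RTensor

variable {M N X Y : Type u} [AddCommGroup M] [AddCommGroup N] [AddCommGroup X] [AddCommGroup Y]
  [Module R M] [Module R N] [Module R X] [Module R Y]

theorem rTensor_prod_eq_zero {f : M →ₗ[R] X} {g : M →ₗ[R] Y} {t : M ⊗[R] N}
    (hf : f.rTensor N t = 0) (hg : g.rTensor N t = 0) : (f.prod g).rTensor N t = 0 := by
  have h : f.prod g = LinearMap.inl R X Y ∘ₗ f + LinearMap.inr R X Y ∘ₗ g := by ext <;> simp
  rw [h, LinearMap.rTensor_add, LinearMap.add_apply, LinearMap.rTensor_comp_apply,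
    LinearMap.rTensor_comp_apply, hf, hg, map_zero, map_zero, add_zero]

theorem lTensor_prod_eq_zero {f : M →ₗ[R] X} {g : M →ₗ[R] Y} {t : N ⊗[R] M}
    (hf : f.lTensor N t = 0) (hg : g.lTensor N t = 0) : (f.prod g).lTensor N t = 0 := by
  have h : f.prod g = LinearMap.inl R X Y ∘ₗ f + LinearMap.inr R X Y ∘ₗ g := by ext <;> simp
  rw [h, LinearMap.lTensor_add, LinearMap.add_apply, LinearMap.lTensor_comp_apply,
    LinearMap.lTensor_comp_apply, hf, hg, map_zero, map_zero, add_zero]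

end RTensor

section Map

variable {K K' L L' X Y : Type u} [AddCommMonoid K] [AddCommMonoid K'] [AddCommMonoid L]
  [AddCommMonoid L'] [AddCommMonoid X] [AddCommMonoid Y] [Module R K] [Module R K'] [Module R L]
  [Module R L'] [Module R X] [Module R Y]

theorem exists_map_eq_of_forall {i : L →ₗ[R] X} {i' : L' →ₗ[R] Y} {f : K →ₗ[R] X} {f' : K' →ₗ[R] Y}
    (h : ∀ k, ∃ l, i l = f k) (h' : ∀ k, ∃ l, i' l = f' k) (s : K ⊗[R] K') :
    ∃ w, TensorProduct.map i i' w = TensorProduct.map f f' s := by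
  induction s with
  | zero => exact ⟨0, by rw [map_zero, map_zero]⟩
  | add x y hx hy =>
    obtain ⟨v, hv⟩ := hx
    obtain ⟨w, hw⟩ := hy
    exact ⟨v + w, by rw [map_add, map_add, hv, hw]⟩
  | tmul x y =>
    obtain ⟨v, hv⟩ := h x
    obtain ⟨w, hw⟩ := h' y
    exact ⟨v ⊗ₜ w, by rw [TensorProduct.map_tmul, TensorProduct.map_tmul, hv, hw]⟩

end Map

-- The bigraded components of a chain of a join

namespace IsJoin

variable {B B' B'' : Type u} {deg : B → ℕ} {d : (B →₀ R) →ₗ[R] (B →₀ R)} {A : Set B}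
  {deg' : B' → ℕ} {d' : (B' →₀ R) →ₗ[R] (B' →₀ R)} {A' : Set B'}
  {deg'' : B'' → ℕ} {d'' : (B'' →₀ R) →ₗ[R] (B'' →₀ R)} {A'' : Set B''}
  {j : B → B' → B''} (H : IsJoin deg d A deg' d' A' deg'' d'' A'' j)

theorem bidegProj_infInclTensor (p q : ℕ)
    (w : (infComplex deg d A H.comp_self).X p ⊗[R] (infComplex deg' d' A' H.comp_self').X q) :
    bidegProj deg deg' p q (infInclTensor H.comp_self H.comp_self' p q w) =
      infInclTensor H.comp_self H.comp_self' p q w := by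
  induction w with
  | zero => simp only [map_zero]
  | add x y hx hy => simp only [map_add, hx, hy]
  | tmul x y => rw [TensorProduct.map_tmul, TensorProduct.map_tmul, degProj_infIncl,
      degProj_infIncl]

theorem bidegProj_infInclTensor_of_ne {p q p' q' : ℕ} (h : (p', q') ≠ (p, q))
    (w : (infComplex deg d A H.comp_self).X p ⊗[R] (infComplex deg' d' A' H.comp_self').X q) :
    bidegProj deg deg' p' q' (infInclTensor H.comp_self H.comp_self' p q w) = 0 := by
  induction w with
  | zero => simp only [map_zero]
  | add x y hx hy => rw [map_add, map_add, hx, hy, add_zero]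
  | tmul x y =>
    rw [TensorProduct.map_tmul, TensorProduct.map_tmul]
    by_cases hp : p' = p
    · have hq : q' ≠ q := fun hq => h (by rw [hp, hq])
      rw [degProj_infIncl_of_ne _ hq, TensorProduct.tmul_zero]
    · rw [degProj_infIncl_of_ne _ hp, TensorProduct.zero_tmul]

/-- The easy inclusion: by the Leibniz rule, the boundary of a join of infimum chains is a
combination of joins of chains supported on `A` and `A'`, the signs being diagonal. -/
theorem joinLin_mem_infModule (p q : ℕ)
    (w : (infComplex deg d A H.comp_self).X p ⊗[R] (infComplex deg' d' A' H.comp_self').X q) :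
    joinLin j (infInclTensor H.comp_self H.comp_self' p q w) ∈ infModule deg'' d'' A'' (p + q) := by
  induction w with
  | zero => simp only [map_zero, Submodule.zero_mem]
  | add x y hx hy => simpa only [map_add] using Submodule.add_mem _ hx hy
  | tmul x y =>
    have hx := infIncl_mem H.comp_self p x
    have hy := infIncl_mem H.comp_self' q y
    rw [TensorProduct.map_tmul]
    refine ⟨joinLin_tmul_mem_supported j hx.1 hy.1 ?_, ?_⟩
    · rintro b ⟨hb, rfl⟩ b' ⟨hb', rfl⟩
      exact ⟨H.aug ▸ Set.mem_image2_of_mem hb hb', H.deg_join b b'⟩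
    · rw [SetLike.mem_coe, Submodule.mem_comap, ← LinearMap.comp_apply, H.leibniz,
        LinearMap.comp_apply, LinearMap.add_apply, map_add, LinearMap.comp_apply,
        LinearMap.rTensor_tmul, LinearMap.lTensor_tmul, LinearMap.rTensor_tmul]
      refine Submodule.add_mem _ (joinLin_tmul_mem_supported j hx.2 hy.1 ?_)
        (joinLin_tmul_mem_supported (S := {b | b ∈ A ∧ deg b = p}) j ?_ hy.2 ?_)
      · rintro b ⟨hb, rfl⟩ b' ⟨hb', rfl⟩
        refine ⟨H.aug ▸ Set.mem_image2_of_mem hb hb', ?_⟩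
        rw [H.deg_join]
        omega
      · refine mem_supported_of_apply fun b hb => ?_
        rw [diag_apply, apply_of_mem_supported hx.1 hb, mul_zero]
      · rintro b ⟨hb, rfl⟩ b' ⟨hb', rfl⟩
        refine ⟨H.aug ▸ Set.mem_image2_of_mem hb hb', ?_⟩
        rw [H.deg_join]
        omega

variable [IsDomain R] [IsPrincipalIdealRing R]

theorem infInclTensor_injective (p q : ℕ) :
    Function.Injective (infInclTensor (deg := deg) (A := A) (deg' := deg') (A' := A')
      H.comp_self H.comp_self' p q) := by
  have := isProjectiveComplex_infComplex (deg := deg) (A := A) H.comp_self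
  exact map_injective_of_flat (infIncl_injective _ p) (infIncl_injective _ q)

/-- The heart of the identification: the tensor is annihilated by `outside ⊗ 1` and by `1 ⊗
outside`, and for flat modules the intersection of these kernels is the tensor product of the
kernels. -/
theorem exists_map_ker_eq_unjoin {x : B'' →₀ R} (h1 : x ∈ Finsupp.supported R R A'')
    (h2 : d'' x ∈ Finsupp.supported R R A'') :
    ∃ s : LinearMap.ker (outside d A) ⊗[R] LinearMap.ker (outside d' A'),
      TensorProduct.map (LinearMap.ker (outside d A)).subtype
        (LinearMap.ker (outside d' A')).subtype s = H.unjoin x := by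
  have : Module.Projective R (LinearMap.ker (outside d A)) := projective_submodule _
  have e := rTensor_prod_eq_zero (H.rTensor_spanProj_unjoin h1) (H.rTensor_spanProj_d_unjoin h1 h2)
  have e' := lTensor_prod_eq_zero (H.lTensor_spanProj_unjoin h1) (H.lTensor_spanProj_d_unjoin h1 h2)
  exact exists_map_eq_of_exact (R := R) (K := LinearMap.ker (outside d A))
    (K' := LinearMap.ker (outside d' A'))
    (Submodule.injective_subtype _) (LinearMap.exact_subtype_ker_map _)
    (LinearMap.exact_subtype_ker_map _) (H.unjoin x) e e'

theorem exists_infInclTensor {n : ℕ} {x : B'' →₀ R} (hx : x ∈ infModule deg'' d'' A'' n)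
    (p q : ℕ) : ∃ w : (infComplex deg d A H.comp_self).X p ⊗[R]
        (infComplex deg' d' A' H.comp_self').X q,
      infInclTensor H.comp_self H.comp_self' p q w = bidegProj deg deg' p q (H.unjoin x) := by
  obtain ⟨h1, h2⟩ := supported_of_mem_infModule hx
  obtain ⟨s, hs⟩ := H.exists_map_ker_eq_unjoin h1 h2
  have e := exists_map_eq_of_forall (i := infIncl H.comp_self p) (i' := infIncl H.comp_self' q)
    (f := degProj R deg p ∘ₗ (LinearMap.ker (outside d A)).subtype)
    (f' := degProj R deg' q ∘ₗ (LinearMap.ker (outside d' A')).subtype)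
    (fun k => exists_infIncl_eq H.comp_self p (degProj_mem_infModule H.homog p k))
    (fun k => exists_infIncl_eq H.comp_self' q (degProj_mem_infModule H.homog' q k)) s
  rwa [TensorProduct.map_comp, LinearMap.comp_apply, hs] at e

/-- The component in bidegree `(p, q)` of a chain of the join. -/
def comp (p q n : ℕ) : (infComplex deg'' d'' A'' H.comp_self'').X n →ₗ[R]
    (infComplex deg d A H.comp_self).X p ⊗[R] (infComplex deg' d' A' H.comp_self').X q :=
  liftOfInjective (R := R) (W := (infComplex deg'' d'' A'' H.comp_self'').X n)
    (X := (infComplex deg d A H.comp_self).X p ⊗[R] (infComplex deg' d' A' H.comp_self').X q)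
    (Y := (B →₀ R) ⊗[R] (B' →₀ R))
    (infInclTensor H.comp_self H.comp_self' p q) (H.infInclTensor_injective p q)
    (bidegProj deg deg' p q ∘ₗ H.unjoin ∘ₗ infIncl H.comp_self'' n)
    (fun z => H.exists_infInclTensor (infIncl_mem H.comp_self'' n z) p q)

theorem infInclTensor_comp (p q n : ℕ) (z : (infComplex deg'' d'' A'' H.comp_self'').X n) :
    infInclTensor H.comp_self H.comp_self' p q (H.comp p q n z) =
      bidegProj deg deg' p q (H.unjoin (infIncl H.comp_self'' n z)) :=
  liftOfInjective_spec (R := R) (W := (infComplex deg'' d'' A'' H.comp_self'').X n)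
    (X := (infComplex deg d A H.comp_self).X p ⊗[R] (infComplex deg' d' A' H.comp_self').X q)
    (Y := (B →₀ R) ⊗[R] (B' →₀ R))
    (infInclTensor H.comp_self H.comp_self' p q) (H.infInclTensor_injective p q)
    (bidegProj deg deg' p q ∘ₗ H.unjoin ∘ₗ infIncl H.comp_self'' n)
    (fun z => H.exists_infInclTensor (infIncl_mem H.comp_self'' n z) p q) z

theorem eq_zero_of_comp {n : ℕ} (z : (infComplex deg'' d'' A'' H.comp_self'').X n)
    (h : ∀ p q, p + q = n → H.comp p q n z = 0) : z = 0 := by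
  have hz := infIncl_mem H.comp_self'' n z
  refine infIncl_injective H.comp_self'' n ?_
  rw [map_zero, ← H.joinLin_unjoin (supported_of_mem_infModule hz).1]
  refine (congrArg (joinLin j) (coord_ext fun b b' => ?_)).trans (map_zero (joinLin j))
  rw [map_zero, Finsupp.zero_apply]
  -- The coordinate at `(b, b')` is seen by the component of bidegree `(deg b, deg' b')`, if the
  -- total degree is right, and is zero otherwise.
  by_cases hb : deg b + deg' b' = n
  · rw [← coord_bidegProj_of_eq _ rfl rfl, ← infInclTensor_comp, h _ _ hb, map_zero, map_zero,
      Finsupp.zero_apply]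
  · rw [coord_unjoin]
    exact apply_of_mem_supported hz.1 fun h' => hb ((H.deg_join b b').symm.trans h'.2)

theorem exists_comp_eq {n : ℕ} (w : ∀ p q, p + q = n →
      (infComplex deg d A H.comp_self).X p ⊗[R] (infComplex deg' d' A' H.comp_self').X q) :
    ∃ z, ∀ p q (h : p + q = n), H.comp p q n z = w p q h := by
  have := Fintype.ofFinite {i : ℕ × ℕ // i.1 + i.2 = n}
  obtain ⟨z, hz⟩ := exists_infIncl_eq H.comp_self'' n (x := ∑ i : {i : ℕ × ℕ // i.1 + i.2 = n},
    joinLin j (infInclTensor H.comp_self H.comp_self' i.1.1 i.1.2 (w _ _ i.2)))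
    (Submodule.sum_mem _ fun i _ => by
      have := H.joinLin_mem_infModule _ _ (w _ _ i.2)
      rwa [i.2] at this)
  refine ⟨z, fun p q h => H.infInclTensor_injective p q ?_⟩
  rw [infInclTensor_comp, hz, map_sum, map_sum, Finset.sum_eq_single ⟨(p, q), h⟩]
  · rw [unjoin_joinLin, H.bidegProj_infInclTensor]
  · intro i _ hi
    rw [unjoin_joinLin]
    exact H.bidegProj_infInclTensor_of_ne (fun h' => hi (Subtype.ext h'.symm)) _
  · exact fun h' => absurd (Finset.mem_univ _) h'

/-- Components are determined by their images in the tensor product of all chains. There the degree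
projections commute with the boundaries up to a shift, and the sign operator becomes the scalar
`(-1) ^ p` on degree `p`. -/
theorem comp_d (p q n : ℕ) (z : (infComplex deg'' d'' A'' H.comp_self'').X (n + 1)) :
    H.comp p q n (((infComplex deg'' d'' A'' H.comp_self'').d (n + 1) n).hom z) =
      ((infComplex deg d A H.comp_self).d (p + 1) p).hom.rTensor _ (H.comp (p + 1) q (n + 1) z) +
      (-1 : R) ^ p • ((infComplex deg' d' A' H.comp_self').d (q + 1) q).hom.lTensor _
        (H.comp p (q + 1) (n + 1) z) := by
  have e1 : infIncl H.comp_self p ∘ₗ ((infComplex deg d A H.comp_self).d (p + 1) p).hom =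
      d ∘ₗ infIncl H.comp_self (p + 1) := LinearMap.ext (infIncl_d H.comp_self p)
  have e2 : infIncl H.comp_self' q ∘ₗ ((infComplex deg' d' A' H.comp_self').d (q + 1) q).hom =
      d' ∘ₗ infIncl H.comp_self' (q + 1) := LinearMap.ext (infIncl_d H.comp_self' q)
  refine H.infInclTensor_injective p q ?_
  rw [infInclTensor_comp, infIncl_d,
    H.unjoin_d (supported_of_mem_infModule (infIncl_mem H.comp_self'' _ z)).1, map_add, map_add,
    map_smul]
  congr 1
  · have h := congrArg (d.rTensor (B' →₀ R)) (H.infInclTensor_comp (p + 1) q (n + 1) z)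
    rw [infInclTensor, bidegProj, LinearMap.rTensor, map_map_apply, map_map_apply, ← e1,
      ← degProj_comp_d H.homog, LinearMap.id_comp, LinearMap.id_comp] at h
    rw [infInclTensor, bidegProj, LinearMap.rTensor, map_map_apply, LinearMap.rTensor,
      map_map_apply, LinearMap.comp_id, LinearMap.comp_id, h]
  · have h := congrArg (d'.lTensor (B →₀ R)) (H.infInclTensor_comp p (q + 1) (n + 1) z)
    rw [infInclTensor, bidegProj, LinearMap.lTensor, map_map_apply, map_map_apply, ← e2,
      ← degProj_comp_d H.homog', LinearMap.id_comp, LinearMap.id_comp] at h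
    rw [infInclTensor, bidegProj, LinearMap.rTensor, LinearMap.lTensor, map_map_apply,
      map_map_apply, LinearMap.lTensor, map_map_apply, LinearMap.comp_id, LinearMap.comp_id,
      LinearMap.comp_id, h, degProj_comp_sign, TensorProduct.map_smul_left, LinearMap.smul_apply]

/-- The infimum complex of a join is the tensor product of the infimum complexes. -/
def tensorData : TensorData (infComplex deg d A H.comp_self) (infComplex deg' d' A' H.comp_self')
    (infComplex deg'' d'' A'' H.comp_self'') where
  comp {p q n} _ := H.comp p q n
  eq_zero := H.eq_zero_of_comp
  exists_comp := H.exists_comp_eq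
  comp_d _ z := H.comp_d _ _ _ z

theorem tensorData_comp_of_eq_join {p q n : ℕ} (x : (infComplex deg d A H.comp_self).X p)
    (y : (infComplex deg' d' A' H.comp_self').X q)
    (z : (infComplex deg'' d'' A'' H.comp_self'').X n)
    (h : infIncl H.comp_self'' n z =
      joinLin j (infIncl H.comp_self p x ⊗ₜ infIncl H.comp_self' q y)) (hn : p + q = n) :
    H.tensorData.comp hn z = x ⊗ₜ y := by
  refine H.infInclTensor_injective p q ?_
  refine (H.infInclTensor_comp p q n z).trans ?_
  rw [h, unjoin_joinLin, TensorProduct.map_tmul, TensorProduct.map_tmul, degProj_infIncl,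
    degProj_infIncl]

theorem tensorData_comp_of_eq_join_of_ne {p q p' q' n : ℕ}
    (x : (infComplex deg d A H.comp_self).X p) (y : (infComplex deg' d' A' H.comp_self').X q)
    (z : (infComplex deg'' d'' A'' H.comp_self'').X n)
    (h : infIncl H.comp_self'' n z =
      joinLin j (infIncl H.comp_self p x ⊗ₜ infIncl H.comp_self' q y)) (hn : p' + q' = n)
    (hne : (p', q') ≠ (p, q)) :
    H.tensorData.comp hn z = 0 := by
  refine H.infInclTensor_injective p' q' ?_
  refine (H.infInclTensor_comp p' q' n z).trans ?_
  rw [h, unjoin_joinLin, ← TensorProduct.map_tmul (infIncl H.comp_self p),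
    H.bidegProj_infInclTensor_of_ne hne, map_zero]

section Compatible

variable {B₁ B₁' B₁'' : Type u} {deg₁ : B₁ → ℕ} {d₁ : (B₁ →₀ R) →ₗ[R] (B₁ →₀ R)} {A₁ : Set B₁}
  {deg₁' : B₁' → ℕ} {d₁' : (B₁' →₀ R) →ₗ[R] (B₁' →₀ R)} {A₁' : Set B₁'}
  {deg₁'' : B₁'' → ℕ} {d₁'' : (B₁'' →₀ R) →ₗ[R] (B₁'' →₀ R)} {A₁'' : Set B₁''}
  {j₁ : B₁ → B₁' → B₁''} (H₁ : IsJoin deg₁ d₁ A₁ deg₁' d₁' A₁' deg₁'' d₁'' A₁'' j₁)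

/-- `IsInfMap` controls degrees only on the generators in `A`. Commutation with the degree
projections is an identity on all chains, hence the homogeneity hypotheses on every generator. -/
theorem tensorData_compatible {g : (B →₀ R) →ₗ[R] (B₁ →₀ R)} {g' : (B' →₀ R) →ₗ[R] (B₁' →₀ R)}
    {g'' : (B'' →₀ R) →ₗ[R] (B₁'' →₀ R)} (hg : IsInfMap deg d A deg₁ d₁ A₁ g)
    (hg' : IsInfMap deg' d' A' deg₁' d₁' A₁' g') (hg'' : IsInfMap deg'' d'' A'' deg₁'' d₁'' A₁'' g'')
    (hdeg : ∀ b, g (Finsupp.single b 1) ∈ Finsupp.supported R R {c | deg₁ c = deg b})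
    (hdeg' : ∀ b, g' (Finsupp.single b 1) ∈ Finsupp.supported R R {c | deg₁' c = deg' b})
    (h : g'' ∘ₗ joinLin j = joinLin j₁ ∘ₗ TensorProduct.map g g') :
    H.tensorData.Compatible H₁.tensorData (infMap H.comp_self H₁.comp_self g hg)
      (infMap H.comp_self' H₁.comp_self' g' hg') (infMap H.comp_self'' H₁.comp_self'' g'' hg'') := by
  intro p q n hn z
  have e1 : infIncl H₁.comp_self p ∘ₗ ((infMap H.comp_self H₁.comp_self g hg).f p).hom =
      g ∘ₗ infIncl H.comp_self p := rfl
  have e2 : infIncl H₁.comp_self' q ∘ₗ ((infMap H.comp_self' H₁.comp_self' g' hg').f q).hom =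
      g' ∘ₗ infIncl H.comp_self' q := rfl
  have c1 : degProj R deg₁ p ∘ₗ g = g ∘ₗ degProj R deg p := by
    refine spanProj_comp_eq g fun b => Finsupp.supported_mono (fun c hc => ?_) (hdeg b)
    simp only [Set.mem_ofPred_eq] at hc ⊢
    rw [hc]
  have c2 : degProj R deg₁' q ∘ₗ g' = g' ∘ₗ degProj R deg' q := by
    refine spanProj_comp_eq g' fun b => Finsupp.supported_mono (fun c hc => ?_) (hdeg' b)
    simp only [Set.mem_ofPred_eq] at hc ⊢
    rw [hc]
  have hz := H.joinLin_unjoin (supported_of_mem_infModule (infIncl_mem H.comp_self'' n z)).1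
  refine H₁.infInclTensor_injective p q ((H₁.infInclTensor_comp p q n _).trans ?_)
  have hc := congrArg (TensorProduct.map g g') (H.infInclTensor_comp p q n z)
  rw [infInclTensor, bidegProj, map_map_apply, map_map_apply, ← e1, ← e2, ← c1, ← c2] at hc
  rw [infIncl_infMap, ← hz, ← LinearMap.comp_apply g'', h, LinearMap.comp_apply, unjoin_joinLin,
    map_map_apply, map_map_apply]
  exact hc.symm

end Compatible

end IsJoin

end RegularKunneth

end

noncomputable section

namespace RegularKunneth

open TensorProduct

/-! ### The joins of hyperdigraphs and of hypergraphs -/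

variable {R : Type u} [CommRing R] {V V' W W' : Type u}

-- Joins of sequences

section Sequences

theorem joinLin_consChain_tmul (a : V) (x : List V →₀ R) (y : List V' →₀ R) :
    joinLin joinList (consChain a x ⊗ₜ[R] y) =
      consChain (Sum.inlₗ a) (joinLin joinList (x ⊗ₜ[R] y)) := by
  induction x using Finsupp.induction_linear with
  | zero => simp
  | add x x' hx hx' => simp only [map_add, TensorProduct.add_tmul, hx, hx']
  | single l r =>
    induction y using Finsupp.induction_linear with
    | zero => simp
    | add y y' hy hy' => simp only [map_add, TensorProduct.tmul_add, hy, hy']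
    | single l' r' =>
      rw [consChain_single, joinLin_single, joinLin_single, consChain_single]
      rfl

theorem joinLin_nil_consChain (a : V') (y : List V' →₀ R) :
    joinLin joinList ((Finsupp.single [] 1 : List V →₀ R) ⊗ₜ[R] consChain a y) =
      consChain (Sum.inrₗ a) (joinLin joinList ((Finsupp.single [] 1 : List V →₀ R) ⊗ₜ[R] y)) := by
  induction y using Finsupp.induction_linear with
  | zero => simp
  | add y y' hy hy' => simp only [map_add, TensorProduct.tmul_add, hy, hy']
  | single l' r' =>
    rw [consChain_single, joinLin_single, joinLin_single, consChain_single]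
    rfl

theorem joinLin_nil_nil : joinLin joinList ((Finsupp.single [] 1 : List V →₀ R) ⊗ₜ[R]
    (Finsupp.single [] 1 : List V' →₀ R)) = Finsupp.single [] 1 := by
  rw [joinLin_single, one_mul]
  rfl

/-- Two linear maps on the tensor product of chains of sequences agree if they agree on the empty
sequences and behave in the same way when a vertex is prepended. -/
theorem listTensorHom_ext {M : Type*} [AddCommGroup M] [Module R M]
    {f g : (List V →₀ R) ⊗[R] (List V' →₀ R) →ₗ[R] M}
    (h0 : f (Finsupp.single [] 1 ⊗ₜ Finsupp.single [] 1) =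
      g (Finsupp.single [] 1 ⊗ₜ Finsupp.single [] 1))
    (h1 : ∀ a y, f (Finsupp.single [] 1 ⊗ₜ y) = g (Finsupp.single [] 1 ⊗ₜ y) →
      f (Finsupp.single [] 1 ⊗ₜ consChain a y) = g (Finsupp.single [] 1 ⊗ₜ consChain a y))
    (h2 : ∀ a x y, f (x ⊗ₜ y) = g (x ⊗ₜ y) → f (consChain a x ⊗ₜ y) = g (consChain a x ⊗ₜ y)) :
    f = g := by
  refine TensorProduct.ext (listHom_ext ?_ fun a x hx => ?_)
  · exact listHom_ext h0 h1
  · exact LinearMap.ext fun y => h2 a x y (LinearMap.congr_fun hx y)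

theorem sign_consChain (a : V) (x : List V →₀ R) :
    diag (fun l => (-1) ^ l.length) (consChain a x) =
      (-1 : R) • consChain a (diag (fun l => (-1) ^ l.length) x) := by
  induction x using Finsupp.induction_linear with
  | zero => simp
  | add x x' hx hx' => simp only [map_add, hx, hx', smul_add]
  | single l r =>
    rw [consChain_single, diag_single, diag_single, consChain_single, Finsupp.smul_single, smul_eq_mul,
      List.length_cons, pow_succ]
    congr 1
    ring

theorem sign_nil : diag (fun l => (-1) ^ l.length) (Finsupp.single ([] : List V) (1 : R)) =
    Finsupp.single [] 1 := by
  rw [diag_single, List.length_nil, pow_zero, one_mul]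

theorem joinList_injective :
    Function.Injective (Function.uncurry (joinList (V := V) (V' := V'))) := by
  -- Selecting the entries from `V` and those from `V'` recovers both sequences.
  have h : Function.LeftInverse
      (fun l : List (V ⊕ₗ V') => (l.filterMap fun x => (ofLex x).getLeft?,
        l.filterMap fun x => (ofLex x).getRight?)) (Function.uncurry joinList) := by
    rintro ⟨l, l'⟩
    simp only [Function.uncurry_apply_pair, joinList, List.filterMap_append, List.filterMap_map]
    have e1 : ((fun x : V ⊕ₗ V' => (ofLex x).getLeft?) ∘ Sum.inlₗ) = some := rfl
    have e2 : ((fun x : V ⊕ₗ V' => (ofLex x).getLeft?) ∘ Sum.inrₗ) = fun _ => none := rfl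
    have e3 : ((fun x : V ⊕ₗ V' => (ofLex x).getRight?) ∘ Sum.inlₗ) = fun _ => none := rfl
    have e4 : ((fun x : V ⊕ₗ V' => (ofLex x).getRight?) ∘ Sum.inrₗ) = some := rfl
    rw [e1, e2, e3, e4]
    simp
  exact h.injective

/-- Prepending a vertex satisfies `∂ ∘ cons = id - cons ∘ ∂` and passes through the join from the
left factor, so induction reduces to an empty left factor; there it passes through from the right
factor. -/
theorem boundaryD_leibniz :
    boundaryD R (V ⊕ₗ V') ∘ₗ joinLin joinList = joinLin joinList ∘ₗ
      ((boundaryD R V).rTensor _ + (diag fun l => (-1) ^ l.length).rTensor _ ∘ₗ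
        (boundaryD R V').lTensor _) := by
  refine listTensorHom_ext ?_ ?_ ?_
  · simp [joinLin_nil_nil, boundaryD_nil]
  · intro a y h
    simp only [LinearMap.comp_apply, LinearMap.add_apply, LinearMap.rTensor_tmul,
      LinearMap.lTensor_tmul, boundaryD_nil, TensorProduct.zero_tmul, zero_add, sign_nil] at h ⊢
    rw [joinLin_nil_consChain, boundaryD_consChain, h, boundaryD_consChain, TensorProduct.tmul_sub,
      map_sub, joinLin_nil_consChain]
  · intro a x y h
    simp only [LinearMap.comp_apply, LinearMap.add_apply, LinearMap.rTensor_tmul,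
      LinearMap.lTensor_tmul, map_add] at h ⊢
    rw [joinLin_consChain_tmul, boundaryD_consChain, h, boundaryD_consChain, TensorProduct.sub_tmul,
      map_sub, joinLin_consChain_tmul, sign_consChain, ← TensorProduct.smul_tmul',
      map_smul, joinLin_consChain_tmul, map_add, neg_one_smul]
    abel

theorem boundaryD_homog (l : List V) : boundaryD R V (Finsupp.single l 1) ∈
    Finsupp.supported R R {c | c.length + 1 = l.length} := by
  simp only [boundaryD, Finsupp.lift_apply, zero_smul, Finsupp.sum_single_index, one_smul]
  refine Submodule.sum_mem _ fun i _ => Finsupp.single_mem_supported R _ ?_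
  have := i.2
  rw [Set.mem_ofPred_eq, List.length_eraseIdx_of_lt i.2]
  omega

/-- The adjoined empty sequence turns the three kinds of directed hyperedges of a join into a full
product of generators. For this reason the complexes are augmented and graded by the number of
vertices. -/
theorem aug_joinD (H : Hyperdigraph V) (H' : Hyperdigraph V') :
    (H.join H').aug = Set.image2 joinList H.aug H'.aug := by
  rw [Hyperdigraph.aug, Hyperdigraph.aug, Hyperdigraph.aug, Set.image2_insert_left,
    Set.image2_insert_right, Set.image_insert_eq]
  have e1 : joinList ([] : List V) = List.map (Sum.inrₗ (α := V) (β := V')) := rfl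
  have e2 : (fun l : List V => joinList l ([] : List V')) = List.map Sum.inlₗ :=
    funext fun l => List.append_nil _
  rw [e1, e2, List.map_nil]
  ext l
  simp only [Hyperdigraph.join, Set.mem_insert_iff, Set.mem_union]
  tauto

theorem isJoin_joinList (H : Hyperdigraph V) (H' : Hyperdigraph V') :
    IsJoin List.length (boundaryD R V) H.aug List.length (boundaryD R V') H'.aug List.length
      (boundaryD R (V ⊕ₗ V')) (H.join H').aug joinList where
  inj := joinList_injective
  deg_join l l' := by simp [joinList]
  aug := aug_joinD H H'
  comp_self := boundaryD_comp_self
  comp_self' := boundaryD_comp_self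
  comp_self'' := boundaryD_comp_self
  homog := boundaryD_homog
  homog' := boundaryD_homog
  leibniz := boundaryD_leibniz

theorem chainMapD_comp_joinLin (φ : V → W) (φ' : V' → W') :
    chainMapD R (sumMap φ φ') ∘ₗ joinLin joinList =
      joinLin joinList ∘ₗ TensorProduct.map (chainMapD R φ) (chainMapD R φ') := by
  have h0 : ∀ {X Y : Type u} (ψ : X → Y),
      chainMapD R ψ (Finsupp.single [] 1) = Finsupp.single [] 1 := fun ψ => by simp [chainMapD]
  refine listTensorHom_ext ?_ ?_ ?_
  · simp only [LinearMap.comp_apply, TensorProduct.map_tmul, h0, joinLin_nil_nil]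
  · intro a y h
    simp only [LinearMap.comp_apply, TensorProduct.map_tmul, h0, joinLin_nil_consChain,
      chainMapD_consChain] at h ⊢
    rw [h]
    rfl
  · intro a x y h
    simp only [LinearMap.comp_apply, TensorProduct.map_tmul, joinLin_consChain_tmul,
      chainMapD_consChain] at h ⊢
    rw [h]
    rfl

theorem chainMapD_homog (φ : V → W) (l : List V) : chainMapD R φ (Finsupp.single l 1) ∈
    Finsupp.supported R R {c | c.length = l.length} := by
  rw [chainMapD, Finsupp.lmapDomain_apply, Finsupp.mapDomain_single]
  exact Finsupp.single_mem_supported R _ (List.length_map _)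

end Sequences

theorem sign_empty : diag (fun s => (-1) ^ s.card) (Finsupp.single (∅ : Finset V) (1 : R)) =
    Finsupp.single ∅ 1 := by
  rw [diag_single, Finset.card_empty, pow_zero, one_mul]

-- Joins of finite sets and the projection

section Sets

variable [LinearOrder V] [LinearOrder V'] [LinearOrder W] [LinearOrder W']

theorem inl_mem_joinFinset {s : Finset V} {s' : Finset V'} {a : V} :
    Sum.inlₗ a ∈ joinFinset s s' ↔ a ∈ s := by
  simp [joinFinset]

theorem inr_mem_joinFinset {s : Finset V} {s' : Finset V'} {a : V'} :
    Sum.inrₗ a ∈ joinFinset s s' ↔ a ∈ s' := by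
  simp [joinFinset]

/-- No vertex of `V'` precedes one of `V`, so exterior multiplication by a vertex of `V` carries the
same sign before and after joining. -/
theorem card_filter_lt_inl (s : Finset V) (s' : Finset V') (a : V) :
    ((joinFinset s s').filter (· < Sum.inlₗ a)).card = (s.filter (· < a)).card := by
  have h : (joinFinset s s').filter (· < Sum.inlₗ a) = (s.filter (· < a)).image Sum.inlₗ := by
    ext x
    rcases x with x | x
    · change Sum.inlₗ x ∈ _ ↔ Sum.inlₗ x ∈ _
      simp [inl_mem_joinFinset]
    · change Sum.inrₗ x ∈ _ ↔ Sum.inrₗ x ∈ _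
      simp [inr_mem_joinFinset]
  rw [h]
  exact Finset.card_image_of_injective _ Sum.inl_injective

/-- With a nonempty first factor all its elements would be counted too; the inductions need only the
empty one. -/
theorem card_filter_lt_inr (s' : Finset V') (a : V') :
    ((joinFinset (∅ : Finset V) s').filter (· < Sum.inrₗ a)).card =
      (s'.filter (· < a)).card := by
  have h : (joinFinset (∅ : Finset V) s').filter (· < Sum.inrₗ a) =
      (s'.filter (· < a)).image Sum.inrₗ := by
    ext x
    rcases x with x | x
    · change Sum.inlₗ x ∈ _ ↔ Sum.inlₗ x ∈ _
      simp [inl_mem_joinFinset]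
    · change Sum.inrₗ x ∈ _ ↔ Sum.inrₗ x ∈ _
      simp [inr_mem_joinFinset]
  rw [h]
  exact Finset.card_image_of_injective _ Sum.inr_injective

theorem joinLin_wedge_tmul (a : V) (x : Finset V →₀ R) (y : Finset V' →₀ R) :
    joinLin joinFinset (wedge a x ⊗ₜ[R] y) =
      wedge (Sum.inlₗ a) (joinLin joinFinset (x ⊗ₜ[R] y)) := by
  induction x using Finsupp.induction_linear with
  | zero => simp
  | add x x' hx hx' => simp only [map_add, TensorProduct.add_tmul, hx, hx']
  | single s r =>
    induction y using Finsupp.induction_linear with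
    | zero => simp
    | add y y' hy hy' => simp only [map_add, TensorProduct.tmul_add, hy, hy']
    | single s' r' =>
      rw [joinLin_single]
      by_cases ha : a ∈ s
      · rw [wedge_mem ha, TensorProduct.zero_tmul, map_zero, wedge_mem (inl_mem_joinFinset.2 ha)]
      · rw [wedge_notMem ha, wedge_notMem (fun h => ha (inl_mem_joinFinset.1 h)), joinLin_single,
          card_filter_lt_inl, mul_right_comm]
        congr 1
        ext
        simp [joinFinset]

theorem joinLin_empty_wedge (a : V') (y : Finset V' →₀ R) :
    joinLin joinFinset ((Finsupp.single ∅ 1 : Finset V →₀ R) ⊗ₜ[R] wedge a y) =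
      wedge (Sum.inrₗ a) (joinLin joinFinset ((Finsupp.single ∅ 1 : Finset V →₀ R) ⊗ₜ[R] y)) := by
  induction y using Finsupp.induction_linear with
  | zero => simp
  | add y y' hy hy' => simp only [map_add, TensorProduct.tmul_add, hy, hy']
  | single s' r' =>
    rw [joinLin_single]
    by_cases ha : a ∈ s'
    · rw [wedge_mem ha, TensorProduct.tmul_zero, map_zero, wedge_mem (inr_mem_joinFinset.2 ha)]
    · rw [wedge_notMem ha, wedge_notMem (fun h => ha (inr_mem_joinFinset.1 h)), joinLin_single,
        card_filter_lt_inr, mul_assoc]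
      congr 1
      ext
      simp [joinFinset]

theorem joinLin_empty_empty : joinLin joinFinset ((Finsupp.single ∅ 1 : Finset V →₀ R) ⊗ₜ[R]
    (Finsupp.single ∅ 1 : Finset V' →₀ R)) = Finsupp.single ∅ 1 := by
  rw [joinLin_single, one_mul]
  rfl

/-- Every finite set is, up to sign, an iterated exterior product of its vertices, in any order;
hence no sorting sign of a join has to be computed. -/
theorem finsetTensorHom_ext {M : Type*} [AddCommGroup M] [Module R M]
    {f g : (Finset V →₀ R) ⊗[R] (Finset V' →₀ R) →ₗ[R] M}
    (h0 : f (Finsupp.single ∅ 1 ⊗ₜ Finsupp.single ∅ 1) =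
      g (Finsupp.single ∅ 1 ⊗ₜ Finsupp.single ∅ 1))
    (h1 : ∀ a y, f (Finsupp.single ∅ 1 ⊗ₜ y) = g (Finsupp.single ∅ 1 ⊗ₜ y) →
      f (Finsupp.single ∅ 1 ⊗ₜ wedge a y) = g (Finsupp.single ∅ 1 ⊗ₜ wedge a y))
    (h2 : ∀ a x y, f (x ⊗ₜ y) = g (x ⊗ₜ y) → f (wedge a x ⊗ₜ y) = g (wedge a x ⊗ₜ y)) :
    f = g := by
  refine TensorProduct.ext (finsetHom_ext ?_ fun a x hx => ?_)
  · exact finsetHom_ext h0 h1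
  · exact LinearMap.ext fun y => h2 a x y (LinearMap.congr_fun hx y)

theorem sign_wedge (a : V) (x : Finset V →₀ R) :
    diag (fun s => (-1) ^ s.card) (wedge a x) =
      (-1 : R) • wedge a (diag (fun s => (-1) ^ s.card) x) := by
  induction x using Finsupp.induction_linear with
  | zero => simp
  | add x x' hx hx' => simp only [map_add, hx, hx', smul_add]
  | single s r =>
    by_cases ha : a ∈ s
    · rw [diag_single, wedge_mem ha, wedge_mem ha, map_zero, smul_zero]
    · rw [diag_single, wedge_notMem ha, wedge_notMem ha, diag_single, Finsupp.smul_single, smul_eq_mul,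
        Finset.card_insert_of_notMem ha, pow_succ]
      congr 1
      ring

theorem joinFinset_injective :
    Function.Injective (Function.uncurry (joinFinset (V := V) (V' := V'))) := by
  rintro ⟨s, s'⟩ ⟨t, t'⟩ h
  simp only [Function.uncurry_apply_pair] at h
  refine Prod.ext (Finset.ext fun a => ?_) (Finset.ext fun a => ?_)
  · rw [← inl_mem_joinFinset (s' := s'), h, inl_mem_joinFinset]
  · rw [← inr_mem_joinFinset (s := s), h, inr_mem_joinFinset]

theorem card_joinFinset (s : Finset V) (s' : Finset V') :
    (joinFinset s s').card = s.card + s'.card := by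
  rw [joinFinset, Finset.card_union_of_disjoint]
  · exact congrArg₂ _ (Finset.card_image_of_injective _ Sum.inl_injective)
      (Finset.card_image_of_injective _ Sum.inr_injective)
  · rw [Finset.disjoint_left]
    simp

theorem boundaryU_leibniz :
    boundaryU R (V ⊕ₗ V') ∘ₗ joinLin joinFinset = joinLin joinFinset ∘ₗ
      ((boundaryU R V).rTensor _ + (diag fun s => (-1) ^ s.card).rTensor _ ∘ₗ
        (boundaryU R V').lTensor _) := by
  refine finsetTensorHom_ext ?_ ?_ ?_
  · simp [joinLin_empty_empty, boundaryU_empty]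
  · intro a y h
    simp only [LinearMap.comp_apply, LinearMap.add_apply, LinearMap.rTensor_tmul,
      LinearMap.lTensor_tmul, boundaryU_empty, TensorProduct.zero_tmul, zero_add, sign_empty] at h ⊢
    rw [joinLin_empty_wedge, boundaryU_wedge, h, boundaryU_wedge, TensorProduct.tmul_sub,
      map_sub, joinLin_empty_wedge]
  · intro a x y h
    simp only [LinearMap.comp_apply, LinearMap.add_apply, LinearMap.rTensor_tmul,
      LinearMap.lTensor_tmul, map_add] at h ⊢
    rw [joinLin_wedge_tmul, boundaryU_wedge, h, boundaryU_wedge, TensorProduct.sub_tmul,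
      map_sub, joinLin_wedge_tmul, sign_wedge, ← TensorProduct.smul_tmul',
      map_smul, joinLin_wedge_tmul, map_add, neg_one_smul]
    abel

theorem boundaryU_homog (s : Finset V) : boundaryU R V (Finsupp.single s 1) ∈
    Finsupp.supported R R {c | c.card + 1 = s.card} := by
  rw [boundaryU_single]
  exact Submodule.sum_mem _ fun v hv => Finsupp.single_mem_supported R _
    (Finset.card_erase_add_one hv)

theorem aug_joinU (H : Hypergraph V) (H' : Hypergraph V') :
    (H.join H').aug = Set.image2 joinFinset H.aug H'.aug := by
  rw [Hypergraph.aug, Hypergraph.aug, Hypergraph.aug, Set.image2_insert_left,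
    Set.image2_insert_right, Set.image_insert_eq]
  have e1 : joinFinset (∅ : Finset V) = Finset.image (Sum.inrₗ (α := V) (β := V')) :=
    funext fun s => Finset.empty_union _
  have e2 : (fun s : Finset V => joinFinset s (∅ : Finset V')) = Finset.image Sum.inlₗ :=
    funext fun s => Finset.union_empty _
  rw [e1, e2, Finset.image_empty]
  ext l
  simp only [Hypergraph.join, Set.mem_insert_iff, Set.mem_union]
  tauto

theorem isJoin_joinFinset (H : Hypergraph V) (H' : Hypergraph V') :
    IsJoin Finset.card (boundaryU R V) H.aug Finset.card (boundaryU R V') H'.aug Finset.card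
      (boundaryU R (V ⊕ₗ V')) (H.join H').aug joinFinset where
  inj := joinFinset_injective
  deg_join := card_joinFinset
  aug := aug_joinU H H'
  comp_self := boundaryU_comp_self
  comp_self' := boundaryU_comp_self
  comp_self'' := boundaryU_comp_self
  homog := boundaryU_homog
  homog' := boundaryU_homog
  leibniz := boundaryU_leibniz

/-- The vertex maps need not be monotone or injective. Both sides intertwine exterior multiplication
by a vertex with that by its image, which accounts for signs and collisions at once. -/
theorem chainMapU_comp_joinLin (φ : V → W) (φ' : V' → W') :
    chainMapU R (sumMap φ φ') ∘ₗ joinLin joinFinset =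
      joinLin joinFinset ∘ₗ TensorProduct.map (chainMapU R φ) (chainMapU R φ') := by
  refine finsetTensorHom_ext ?_ ?_ ?_
  · simp only [LinearMap.comp_apply, TensorProduct.map_tmul, chainMapU_empty, joinLin_empty_empty]
  · intro a y h
    simp only [LinearMap.comp_apply, TensorProduct.map_tmul, chainMapU_empty, joinLin_empty_wedge,
      chainMapU_wedge] at h ⊢
    rw [h]
    rfl
  · intro a x y h
    simp only [LinearMap.comp_apply, TensorProduct.map_tmul, joinLin_wedge_tmul,
      chainMapU_wedge] at h ⊢
    rw [h]
    rfl

theorem chainMapU_homog (φ : V → W) (s : Finset V) : chainMapU R φ (Finsupp.single s 1) ∈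
    Finsupp.supported R R {c | c.card = s.card} := by
  by_cases h : Set.InjOn φ s
  · rw [chainMapU_of_injOn h]
    exact Finsupp.single_mem_supported R _ (Finset.card_image_of_injOn h)
  · rw [chainMapU_of_not_injOn h]
    exact Submodule.zero_mem _

theorem projChain_comp_joinLin : projChain R (V ⊕ₗ V') ∘ₗ joinLin joinList =
    joinLin joinFinset ∘ₗ TensorProduct.map (projChain R V) (projChain R V') := by
  refine listTensorHom_ext ?_ ?_ ?_
  · simp only [LinearMap.comp_apply, TensorProduct.map_tmul, projChain_nil, joinLin_nil_nil,
      joinLin_empty_empty]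
  · intro a y h
    simp only [LinearMap.comp_apply, TensorProduct.map_tmul, projChain_nil, joinLin_nil_consChain,
      projChain_consChain, joinLin_empty_wedge] at h ⊢
    rw [h]
  · intro a x y h
    simp only [LinearMap.comp_apply, TensorProduct.map_tmul, joinLin_consChain_tmul,
      projChain_consChain, joinLin_wedge_tmul] at h ⊢
    rw [h]

theorem projChain_homog (l : List V) : projChain R V (Finsupp.single l 1) ∈
    Finsupp.supported R R {c | c.card = l.length} := by
  by_cases h : l.Nodup
  · rw [projChain_of_nodup h]
    exact Finsupp.single_mem_supported R _ (List.toFinset_card_of_nodup h)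
  · rw [projChain_of_not_nodup h]
    exact Submodule.zero_mem _

end Sets

end RegularKunneth

end

noncomputable section

namespace RegularKunneth

open TensorProduct

/-! ### The Künneth sequences of joins -/

variable {R : Type u} [CommRing R] [IsDomain R] [IsPrincipalIdealRing R]

instance isProjectiveComplex_infD (X : HyperdigraphCat.{u}) :
    IsProjectiveComplex ((infD R).obj X) :=
  isProjectiveComplex_infComplex boundaryD_comp_self

instance isProjectiveComplex_infU (X : HypergraphCat.{u}) : IsProjectiveComplex ((infU R).obj X) :=
  isProjectiveComplex_infComplex boundaryU_comp_self

/-- The infimum complex of a join of hyperdigraphs as a tensor product. -/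
def tensorDataD (P : HyperdigraphCat.{u} × HyperdigraphCat.{u}) :
    TensorData ((infD R).obj P.1) ((infD R).obj P.2) ((infD R).obj (joinD.obj P)) :=
  (isJoin_joinList P.1.graph P.2.graph).tensorData

/-- The infimum complex of a join of hypergraphs as a tensor product. -/
def tensorDataU (P : HypergraphCat.{u} × HypergraphCat.{u}) :
    TensorData ((infU R).obj P.1) ((infU R).obj P.2) ((infU R).obj (joinU.obj P)) :=
  (isJoin_joinFinset P.1.graph P.2.graph).tensorData

theorem tensorDataD_compatible {P Q : HyperdigraphCat.{u} × HyperdigraphCat.{u}} (φ : P ⟶ Q) :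
    (tensorDataD (R := R) P).Compatible (tensorDataD Q) ((infD R).map φ.1) ((infD R).map φ.2)
      ((infD R).map (joinD.map φ)) :=
  (isJoin_joinList P.1.graph P.2.graph).tensorData_compatible
    (isJoin_joinList Q.1.graph Q.2.graph) (isInfMap_chainMapD φ.1) (isInfMap_chainMapD φ.2)
    (isInfMap_chainMapD (joinD.map φ)) (chainMapD_homog _) (chainMapD_homog _)
    (chainMapD_comp_joinLin _ _)

theorem tensorDataU_compatible {P Q : HypergraphCat.{u} × HypergraphCat.{u}} (φ : P ⟶ Q) :
    (tensorDataU (R := R) P).Compatible (tensorDataU Q) ((infU R).map φ.1) ((infU R).map φ.2)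
      ((infU R).map (joinU.map φ)) :=
  (isJoin_joinFinset P.1.graph P.2.graph).tensorData_compatible
    (isJoin_joinFinset Q.1.graph Q.2.graph) (isInfMap_chainMapU φ.1) (isInfMap_chainMapU φ.2)
    (isInfMap_chainMapU (joinU.map φ)) (chainMapU_homog _) (chainMapU_homog _)
    (chainMapU_comp_joinLin _ _)

theorem projInfJoin_compatible (P : HyperdigraphCat.{u} × HyperdigraphCat.{u}) :
    (tensorDataD (R := R) P).Compatible
      (tensorDataU (underlyingFunctor.obj P.1, underlyingFunctor.obj P.2))
      ((projInf R).app P.1) ((projInf R).app P.2) ((projInfJoin R).app P) := by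
  have h := (isInfMap_projChain (R := R) (joinD.obj P)).comp
    (isInfMap_chainMapU (underlyingJoin.app P))
  -- On chains this is the projection followed by the map induced by the identity of the vertices,
  -- which is the identity by `chainMapU_id`.
  have e : (projInfJoin R).app P = infMap boundaryD_comp_self boundaryU_comp_self _ h :=
    (infMap_comp _ _ _ _ (isInfMap_projChain (joinD.obj P)) _
      (isInfMap_chainMapU (underlyingJoin.app P)) _ h rfl).symm
  rw [e]
  refine (isJoin_joinList P.1.graph P.2.graph).tensorData_compatible
    (isJoin_joinFinset (underlyingFunctor.obj P.1).graph (underlyingFunctor.obj P.2).graph)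
    (isInfMap_projChain P.1) (isInfMap_projChain P.2) h projChain_homog projChain_homog ?_
  exact LinearMap.ext fun t => (LinearMap.congr_fun chainMapU_id _).trans
    (LinearMap.congr_fun projChain_comp_joinLin t)

variable (R)

/-- The Künneth sequences of the joins of hyperdigraphs. -/
def kunnethD (n : ℕ) : NaturalKU ((infD.{u} R).prod (infD R)) (joinD ⋙ infD R) n :=
  naturalKU _ _ (fun P => isProjectiveComplex_infD P.1)
    (fun P => isProjectiveComplex_infD P.2) tensorDataD tensorDataD_compatible n

/-- The Künneth sequences of the joins of hypergraphs. -/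
def kunnethU (n : ℕ) : NaturalKU ((infU.{u} R).prod (infU R)) (joinU ⋙ infU R) n :=
  naturalKU _ _ (fun P => isProjectiveComplex_infU P.1)
    (fun P => isProjectiveComplex_infU P.2) tensorDataU tensorDataU_compatible n

/-- The projections, as a natural transformation between functors to pairs of complexes. -/
def projInfProd : (infD.{u} R).prod (infD R) ⟶
    underlyingFunctor.prod underlyingFunctor ⋙ (infU R).prod (infU R) where
  app P := ((projInf R).app P.1, (projInf R).app P.2)
  naturality _ _ φ := Prod.ext ((projInf R).naturality φ.1) ((projInf R).naturality φ.2)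

/-- The morphism of Künneth sequences induced by the projections. -/
def kunnethProj (n : ℕ) : (kunnethD.{u} R n).functor ⟶
    underlyingFunctor.prod underlyingFunctor ⋙ (kunnethU R n).functor where
  app P :=
    { τ₁ := (Functor.whiskerRight (projInfProd R) (tensorTerm R n)).app P
      τ₂ := HomologicalComplex.homologyMap ((projInfJoin R).app P) n
      τ₃ := (Functor.whiskerRight (projInfProd R) (torTerm R n)).app P
      comm₁₂ := (TensorData.tensorToHomology_naturality (projInfJoin_compatible P) n).symm
      comm₂₃ :=
        TensorData.homologyToTor_naturality (projInfJoin_compatible P) n }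
  naturality P Q φ := by
    ext1
    · exact (Functor.whiskerRight (projInfProd R) (tensorTerm R n)).naturality φ
    · exact (Functor.whiskerRight (projInfJoin R)
        (HomologicalComplex.homologyFunctor _ _ n)).naturality φ
    · exact (Functor.whiskerRight (projInfProd R) (torTerm R n)).naturality φ

theorem kunnethD_tensorClass (X X' : HyperdigraphCat.{u}) (p q : ℕ) (x : ((infD R).obj X).cycles p)
    (y : ((infD R).obj X').cycles q) (z : ((infD R).obj (joinD.obj (X, X'))).cycles (p + q))
    (h : cycleD R _ _ z = joinChainD R (cycleD R X p x) (cycleD R X' q y)) :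
    ((kunnethD R (p + q)).f.app (X, X')).hom
        (tensorClass R ((infD R).obj X, (infD R).obj X') p q x y) =
      (((infD R).obj (joinD.obj (X, X'))).homologyπ (p + q)).hom z := by
  have H := h.trans (joinLin_tmul joinList (cycleD R X p x) (cycleD R X' q y)).symm
  exact TensorData.tensorToHomology_tensorClass (tensorDataD (X, X')) x y z
    ((isJoin_joinList X.graph X'.graph).tensorData_comp_of_eq_join _ _ _ H rfl)
    fun p' q' hn hne =>
      (isJoin_joinList X.graph X'.graph).tensorData_comp_of_eq_join_of_ne _ _ _ H hn hne

theorem kunnethU_tensorClass (X X' : HypergraphCat.{u}) (p q : ℕ) (x : ((infU R).obj X).cycles p)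
    (y : ((infU R).obj X').cycles q) (z : ((infU R).obj (joinU.obj (X, X'))).cycles (p + q))
    (h : cycleU R _ _ z = joinChainU R (cycleU R X p x) (cycleU R X' q y)) :
    ((kunnethU R (p + q)).f.app (X, X')).hom
        (tensorClass R ((infU R).obj X, (infU R).obj X') p q x y) =
      (((infU R).obj (joinU.obj (X, X'))).homologyπ (p + q)).hom z := by
  have H := h.trans (joinLin_tmul joinFinset (cycleU R X p x) (cycleU R X' q y)).symm
  exact TensorData.tensorToHomology_tensorClass (tensorDataU (X, X')) x y z
    ((isJoin_joinFinset X.graph X'.graph).tensorData_comp_of_eq_join _ _ _ H rfl)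
    fun p' q' hn hne =>
      (isJoin_joinFinset X.graph X'.graph).tensorData_comp_of_eq_join_of_ne _ _ _ H hn hne

/-- A `k`-regular map on a graph is a morphism from every sub-hyperdigraph of the `(k-1)`-skeleton of
the directed independence complex to the directed matroid. -/
def regularHom {𝔽 : Type u} [Field 𝔽] {N : ℕ} {S : Finset (Fin N → 𝔽)} [LinearOrder S]
    {V : Type u} [LinearOrder V] {G : SimpleGraph V} {k : ℕ} {f : V → (Fin N → 𝔽)}
    (hf : IsRegular G k f) (hS : ∀ v, f v ∈ S) {H : Hyperdigraph V}
    (hH : H.edges ⊆ ((directedInd G).skeleton k).edges) :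
    HyperdigraphCat.mk V H ⟶ HyperdigraphCat.mk S (directedMatroid S) :=
  HyperdigraphCat.Hom.mk (X := ⟨V, H⟩) (Y := ⟨S, directedMatroid S⟩) (fun v => ⟨f v, hS v⟩) (by
    intro l hl
    obtain ⟨⟨hne, hnd, hadj⟩, hk⟩ := hH hl
    -- Regularity is applied to the entries of the directed hyperedge itself. Independence makes
    -- their images distinct, hence the image sequence is without repetition.
    have hli := hf l.length hk l.get (List.nodup_iff_injective_get.1 hnd)
      fun i j => hadj _ (l.get_mem i) _ (l.get_mem j)
    refine ⟨by simpa using hne, List.Nodup.map_on ?_ hnd, ?_⟩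
    · intro v hv w hw h
      obtain ⟨i, rfl⟩ := List.get_of_mem hv
      obtain ⟨j, rfl⟩ := List.get_of_mem hw
      rw [hli.injective (congrArg Subtype.val h)]
    -- The matroid condition concerns the set of entries rather than an indexed family: choosing a
    -- position for each entry presents it as a reindexing of the independent family.
    · have hmem : ∀ v : {v : S // v ∈ l.map fun v => (⟨f v, hS v⟩ : S)},
          ∃ i, f (l.get i) = v.1.1 := by
        rintro ⟨v, hv⟩
        obtain ⟨w, hw, rfl⟩ := List.mem_map.1 hv
        obtain ⟨i, rfl⟩ := List.get_of_mem hw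
        exact ⟨i, rfl⟩
      choose e he using hmem
      have hcomp := hli.comp e fun v w h => Subtype.ext (Subtype.ext (by rw [← he, ← he, h]))
      have heq : (fun i => f (l.get i)) ∘ e = fun v => v.1.1 := funext he
      rwa [heq] at hcomp)

end RegularKunneth

end

open RegularKunneth in
theorem theorem8p10 (R : Type u) [CommRing R] [IsDomain R] [IsPrincipalIdealRing R] :
    -- natural Künneth-type short exact sequences for the joins of hyperdigraphs and of hypergraphs,
    -- and a natural morphism from the former to the latter
    ∃ (KD : ∀ n : ℕ, NaturalKU ((infD.{u} R).prod (infD R)) (joinD ⋙ infD R) n)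
      (KU : ∀ n : ℕ, NaturalKU ((infU.{u} R).prod (infU R)) (joinU ⋙ infU R) n)
      (π : ∀ n : ℕ, (KD n).functor ⟶ underlyingFunctor.prod underlyingFunctor ⋙ (KU n).functor),
      -- the first map of each sequence is `[x] ⊗ [y] ↦ [x * y]`
      (∀ (X X' : HyperdigraphCat.{u}) (p q : ℕ) (x : ((infD R).obj X).cycles p)
        (y : ((infD R).obj X').cycles q) (z : ((infD R).obj (joinD.obj (X, X'))).cycles (p + q)),
        cycleD R _ _ z = joinChainD R (cycleD R X p x) (cycleD R X' q y) →
        ((KD (p + q)).f.app (X, X')).hom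
            (tensorClass R ((infD R).obj X, (infD R).obj X') p q x y) =
          (((infD R).obj (joinD.obj (X, X'))).homologyπ (p + q)).hom z) ∧
      (∀ (X X' : HypergraphCat.{u}) (p q : ℕ) (x : ((infU R).obj X).cycles p)
        (y : ((infU R).obj X').cycles q) (z : ((infU R).obj (joinU.obj (X, X'))).cycles (p + q)),
        cycleU R _ _ z = joinChainU R (cycleU R X p x) (cycleU R X' q y) →
        ((KU (p + q)).f.app (X, X')).hom
            (tensorClass R ((infU R).obj X, (infU R).obj X') p q x y) =
          (((infU R).obj (joinU.obj (X, X'))).homologyπ (p + q)).hom z) ∧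
      -- the vertical morphisms are those induced by the projections
      (∀ (n : ℕ) (X X' : HyperdigraphCat.{u}),
        ((π n).app (X, X')).τ₁ =
          (tensorTerm R n).map
            (X := ((infD R).obj X, (infD R).obj X'))
            (Y := ((infU R).obj (underlyingFunctor.obj X), (infU R).obj (underlyingFunctor.obj X')))
            ((projInf R).app X, (projInf R).app X') ∧
        ((π n).app (X, X')).τ₂ =
          HomologicalComplex.homologyMap ((projInfJoin R).app (X, X')) n ∧
        ((π n).app (X, X')).τ₃ =
          (torTerm R n).map
            (X := ((infD R).obj X, (infD R).obj X'))
            (Y := ((infU R).obj (underlyingFunctor.obj X), (infU R).obj (underlyingFunctor.obj X')))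
            ((projInf R).app X, (projInf R).app X')) ∧
      -- the commutative diagram of a pair of regular maps
      ∀ (𝔽 : Type u) [Field 𝔽] (N N' : ℕ) (S : Finset (Fin N → 𝔽)) (S' : Finset (Fin N' → 𝔽))
        [LinearOrder S] [LinearOrder S']
        (V V' : Type u) [LinearOrder V] [LinearOrder V'] (G : SimpleGraph V) (G' : SimpleGraph V')
        (k k' : ℕ) (f : V → (Fin N → 𝔽)) (f' : V' → (Fin N' → 𝔽)),
        IsRegular G k f → IsRegular G' k' f' → (∀ v, f v ∈ S) → (∀ v, f' v ∈ S') →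
        ∀ (H : Hyperdigraph V) (H' : Hyperdigraph V'),
          H.edges ⊆ ((directedInd G).skeleton k).edges →
          H'.edges ⊆ ((directedInd G').skeleton k').edges →
          ∃ (F : HyperdigraphCat.mk V H ⟶ HyperdigraphCat.mk S (directedMatroid S))
            (F' : HyperdigraphCat.mk V' H' ⟶ HyperdigraphCat.mk S' (directedMatroid S')),
            (∀ v, (F.toFun v : Fin N → 𝔽) = f v) ∧ (∀ v, (F'.toFun v : Fin N' → 𝔽) = f' v) ∧
            ∀ n : ℕ,
              CommSq
                ((KD n).functor.map (X := (_, _)) (Y := (_, _)) (F, F'))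
                ((π n).app (_, _)) ((π n).app (_, _))
                ((KU n).functor.map (X := (_, _)) (Y := (_, _))
                  (underlyingFunctor.map F, underlyingFunctor.map F')) ∧
              -- functoriality of the diagram: compatible morphisms of the data give a commutative cube
              ∀ (X X' Y Y' : HyperdigraphCat.{u}) (E : X ⟶ Y) (E' : X' ⟶ Y')
                (a : X ⟶ HyperdigraphCat.mk V H) (a' : X' ⟶ HyperdigraphCat.mk V' H')
                (b : Y ⟶ HyperdigraphCat.mk S (directedMatroid S))
                (b' : Y' ⟶ HyperdigraphCat.mk S' (directedMatroid S')),
                E ≫ b = a ≫ F → E' ≫ b' = a' ≫ F' →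
                CommSq
                  ((KD n).functor.map (X := (_, _)) (Y := (_, _)) (E, E'))
                  ((KD n).functor.map (X := (_, _)) (Y := (_, _)) (a, a'))
                  ((KD n).functor.map (X := (_, _)) (Y := (_, _)) (b, b'))
                  ((KD n).functor.map (X := (_, _)) (Y := (_, _)) (F, F')) ∧
                CommSq
                  ((KU n).functor.map (X := (_, _)) (Y := (_, _))
                    (underlyingFunctor.map E, underlyingFunctor.map E'))
                  ((KU n).functor.map (X := (_, _)) (Y := (_, _))
                    (underlyingFunctor.map a, underlyingFunctor.map a'))
                  ((KU n).functor.map (X := (_, _)) (Y := (_, _))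
                    (underlyingFunctor.map b, underlyingFunctor.map b'))
                  ((KU n).functor.map (X := (_, _)) (Y := (_, _))
                    (underlyingFunctor.map F, underlyingFunctor.map F')) ∧
                CommSq
                  ((KD n).functor.map (X := (_, _)) (Y := (_, _)) (E, E'))
                  ((π n).app (_, _)) ((π n).app (_, _))
                  ((KU n).functor.map (X := (_, _)) (Y := (_, _))
                    (underlyingFunctor.map E, underlyingFunctor.map E')) ∧
                CommSq
                  ((KD n).functor.map (X := (_, _)) (Y := (_, _)) (a, a'))
                  ((π n).app (_, _)) ((π n).app (_, _))
                  ((KU n).functor.map (X := (_, _)) (Y := (_, _))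
                    (underlyingFunctor.map a, underlyingFunctor.map a')) ∧
                CommSq
                  ((KD n).functor.map (X := (_, _)) (Y := (_, _)) (b, b'))
                  ((π n).app (_, _)) ((π n).app (_, _))
                  ((KU n).functor.map (X := (_, _)) (Y := (_, _))
                    (underlyingFunctor.map b, underlyingFunctor.map b')) := by
  refine ⟨kunnethD R, kunnethU R, kunnethProj R, kunnethD_tensorClass R, kunnethU_tensorClass R,
    fun n X X' => ⟨rfl, rfl, rfl⟩, ?_⟩
  intro 𝔽 _ N N' S S' _ _ V V' _ _ G G' k k' f f' hf hf' hS hS' H H' hH hH'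
  refine ⟨regularHom hf hS hH, regularHom hf' hS' hH', fun _ => rfl, fun _ => rfl, fun n => ?_⟩
  -- Naturality of the projection gives the square of the regular maps and the three faces of the
  -- cube that have vertical projections besides it.
  have hπ : ∀ {P Q : HyperdigraphCat.{u} × HyperdigraphCat.{u}} (φ : P ⟶ Q),
      CommSq ((kunnethD R n).functor.map φ) ((kunnethProj R n).app P) ((kunnethProj R n).app Q)
        ((kunnethU R n).functor.map ((underlyingFunctor.prod underlyingFunctor).map φ)) :=
    fun φ => ⟨(kunnethProj R n).naturality φ⟩
  refine ⟨hπ _, fun X X' Y Y' E E' a a' b b' h h' => ?_⟩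
  -- The two remaining faces are images of this square of pairs of hyperdigraphs under the Künneth
  -- functors, for hypergraphs after passing to underlying hypergraphs.
  have hc : CommSq (C := HyperdigraphCat.{u} × HyperdigraphCat.{u}) (W := (X, X')) (X := (Y, Y'))
      (Y := (⟨V, H⟩, ⟨V', H'⟩)) (Z := (⟨S, directedMatroid S⟩, ⟨S', directedMatroid S'⟩))
      (E, E') (a, a') (b, b') (regularHom hf hS hH, regularHom hf' hS' hH') :=
    ⟨Prod.ext h h'⟩
  exact ⟨hc.map _, (hc.map (underlyingFunctor.prod underlyingFunctor)).map _, hπ _, hπ _, hπ _⟩
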